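/- Let $F$ be a totally real number field and let $V$ be a quadratic space over $F$ of dimension $m+2$, $m\ge 1$, with quadratic form $Q$ and bilinear form $(x,y)=Q(x+y)-Q(x)-Q(y)$. Let $\Sigma_+$ be a non-empty set of embeddings $\sigma:F\to\mathbb R$ such that $V_\sigma=V\otimes_{F,\sigma}\mathbb R$ has signature $(m,2)$ for $\sigma\in\Sigma_+$ and $(m+2,0)$ for $\sigma\notin\Sigma_+$. Let $G=R_{F/\mathbb Q}\mathrm{GSpin}(V)$, let $G(\mathbb Q)_+\subset G(\mathbb Q)$ be the subgroup of elements with totally positive spinor norm, let $D=\prod_{\sigma\in\Sigma_+}D^{(\sigma)}$ with $D^{(\sigma)}$ the space of oriented negative $2$-planes in $V_\sigma$, and fix a connected component $D^+$ of $D$. For a totally positive definite subspace $W\subset V$ let $D_W\subset D$ be the set of all $z$ with $z_\sigma\perp W$ for all $\sigma\in\Sigma_+$, and let $D_W^+=D_W\cap D^+$. Let $K\subset G(\mathbb A_f)$ be a compact open subgroup, and for $g\in G(\mathbb A_f)$ let $\Gamma_g$ be the image of $G(\mathbb Q)_+\cap gKg^{-1}$ in $\mathrm{SO}(V)$; assume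 that all $\Gamma_g$ are neat (as is the case if $K$ is neat). Let $S_K=G(\mathbb Q)\backslash D\times G(\mathbb A_f)/K$ and write $G(\mathbb A_f)=\bigsqcup_j G(\mathbb Q)_+g_jK$, so that $S_K=\bigsqcup_j\Gamma_{g_j}\backslash D^+$ through $z\mapsto[z,g_j]$. For a totally positive definite subspace $W$ of $V$ define: * the connected cycle $Z(W)_{\Gamma_{g_j}}$, the image of $D_W^+$ in $\Gamma_{g_j}\backslash D^+\subset S_K$; * for $g\in G(\mathbb A_f)$, the natural cycle $Z(W,g,K)^\natural$, the push-forward to $S_K$ of the fundamental cycle of $H(\mathbb Q)\backslash D_W\times H(\mathbb A_f)/K_{H,g}$ under $[z,h]\mapsto[z,hg]$, where $H$ is the pointwise stabilizer of $W$ in $G$ and $K_{H,g}=H(\mathbb A_f)\cap gKg^{-1}$. Let $1\le n\le m$, let $T\in\mathrm{Sym}_n(F)$ be totally positive definite, and let $\mathcal O_T=\{x\in V^n: \tfrac12((x_i,x_j))_{i,j}=T\}$. Suppose that $\mathcal O_T(F)\ne\emptyset$ and fix $x_0\in\mathcal O_T(F)$. For $x\in V(F)^n$ let $W(x)$ be the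 span of its components. Let $\varphi$ be a $K$-invariant, locally constant, compactly supported complex-valued function on $V(\mathbb A_f)^n$, and write $$\mathrm{supp}(\varphi)\cap\mathcal O_T(\mathbb A_f)=\bigsqcup_r K\,\xi_r^{-1}x_0,\qquad \xi_r\in G(\mathbb A_f).$$ Then the weighted cycle defined by connected cycles and the weighted cycle defined by natural cycles, $$Z(T,\varphi,K)=\sum_j\ \sum_{x\in\mathcal O_T(F)\bmod\Gamma_{g_j}}\varphi(g_j^{-1}x)\,Z(W(x))_{\Gamma_{g_j}},\qquad Z(T,\varphi,K)^\natural=\sum_r\varphi(\xi_r^{-1}x_0)\,Z(W(x_0),\xi_r,K)^\natural ,$$ coincide: $Z(T,\varphi,K)=Z(T,\varphi,K)^\natural$. The equality holds as cycles on $S_K$: each subvariety occurs in only finitely many terms with non-zero coefficient, and it has the same multiplicity on both sides. -/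

import Mathlib

open scoped TensorProduct NumberField
open CliffordAlgebra (ι)

namespace OrthShimura

noncomputable section

/-! ### The group `GSpin` of a quadratic form -/

section Clifford

variable {R M : Type*} [CommRing R] [AddCommGroup M] [Module R M] (Q : QuadraticForm R M)

/-- `GSpin(M)`: the even units of the Clifford algebra that normalize `M`. -/
def GSpin : Subgroup (CliffordAlgebra Q)ˣ where
  carrier := {g | (g : CliffordAlgebra Q) ∈ CliffordAlgebra.even Q ∧
    ((g⁻¹ : (CliffordAlgebra Q)ˣ) : CliffordAlgebra Q) ∈ CliffordAlgebra.even Q ∧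
    (∀ v, ∃ w, (g : CliffordAlgebra Q) * ι Q v * ((g⁻¹ : (CliffordAlgebra Q)ˣ) :) = ι Q w) ∧
    (∀ v, ∃ w, ((g⁻¹ : (CliffordAlgebra Q)ˣ) :) * ι Q v * (g : CliffordAlgebra Q) = ι Q w)}
  one_mem' := by
    refine ⟨?_, ?_, fun v => ⟨v, ?_⟩, fun v => ⟨v, ?_⟩⟩ <;> simp [one_mem]
  mul_mem' := by
    rintro a b ⟨ha, ha', hac, hac'⟩ ⟨hb, hb', hbc, hbc'⟩
    refine ⟨?_, ?_, fun v => ?_, fun v => ?_⟩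
    · simpa using mul_mem ha hb
    · simpa using mul_mem hb' ha'
    · obtain ⟨w, hw⟩ := hbc v
      obtain ⟨u, hu⟩ := hac w
      refine ⟨u, ?_⟩
      rw [← hu, ← hw]
      simp [mul_assoc]
    · obtain ⟨w, hw⟩ := hac' v
      obtain ⟨u, hu⟩ := hbc' w
      refine ⟨u, ?_⟩
      rw [← hu, ← hw]
      simp [mul_assoc]
  inv_mem' := by
    rintro a ⟨ha, ha', hac, hac'⟩
    exact ⟨ha', by simpa using ha, by simpa using hac', by simpa using hac⟩

variable [Invertible (2 : R)]

theorem iota_injective : Function.Injective (ι Q) := by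
  intro x y h
  have := congrArg (CliffordAlgebra.equivExterior Q) h
  simp only [CliffordAlgebra.equivExterior, CliffordAlgebra.changeFormEquiv_apply,
    CliffordAlgebra.changeForm_ι] at this
  exact ExteriorAlgebra.ι_leftInverse.injective this

theorem algebraMap_clifford_injective :
    Function.Injective (algebraMap R (CliffordAlgebra Q)) := by
  intro x y h
  have := congrArg (CliffordAlgebra.equivExterior Q) h
  simp only [CliffordAlgebra.equivExterior, CliffordAlgebra.changeFormEquiv_apply,
    CliffordAlgebra.changeForm_algebraMap] at this
  exact (ExteriorAlgebra.algebraMap_leftInverse M).injective this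

/-- The vector `g v g⁻¹ ∈ M`. -/
def rhoFun (g : GSpin Q) (v : M) : M := Classical.choose (g.2.2.2.1 v)

theorem iota_rhoFun (g : GSpin Q) (v : M) :
    ι Q (rhoFun Q g v) = ((g : (CliffordAlgebra Q)ˣ) : CliffordAlgebra Q) * ι Q v *
      (((g : (CliffordAlgebra Q)ˣ)⁻¹ : (CliffordAlgebra Q)ˣ) : CliffordAlgebra Q) :=
  (Classical.choose_spec (g.2.2.2.1 v)).symm

/-- The action `v ↦ g v g⁻¹` of `GSpin(M)` on `M`, through which it maps to `SO(M)`. -/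
def rho : GSpin Q →* (M ≃ₗ[R] M) where
  toFun g :=
    { toFun := rhoFun Q g
      invFun := rhoFun Q g⁻¹
      map_add' := fun x y => iota_injective Q (by simp [iota_rhoFun, mul_add, add_mul])
      map_smul' := fun c x => iota_injective Q (by simp [iota_rhoFun])
      left_inv := fun x => iota_injective Q (by simp [iota_rhoFun, mul_assoc])
      right_inv := fun x => iota_injective Q (by simp [iota_rhoFun, mul_assoc]) }
  map_one' := LinearEquiv.ext fun x => iota_injective Q (by simp [iota_rhoFun])
  map_mul' a b := LinearEquiv.ext fun x => iota_injective Q (by simp [iota_rhoFun, mul_assoc])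

theorem iota_rho (g : GSpin Q) (v : M) :
    ι Q (rho Q g v) = ((g : (CliffordAlgebra Q)ˣ) : CliffordAlgebra Q) * ι Q v *
      (((g : (CliffordAlgebra Q)ˣ)⁻¹ : (CliffordAlgebra Q)ˣ) : CliffordAlgebra Q) :=
  iota_rhoFun Q g v

theorem form_rho (g : GSpin Q) (v : M) : Q (rho Q g v) = Q v := by
  apply algebraMap_clifford_injective Q
  rw [← CliffordAlgebra.ι_sq_scalar, iota_rho]
  have h : ∀ a b c : CliffordAlgebra Q, c * a = 1 → a * b * c * (a * b * c) = a * (b * b) * c := by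
    intro a b c hca
    calc a * b * c * (a * b * c) = a * b * (c * a) * b * c := by simp only [mul_assoc]
      _ = _ := by rw [hca]; simp only [mul_assoc, mul_one]
  rw [h _ _ _ (by simp), CliffordAlgebra.ι_sq_scalar, ← Algebra.commutes, mul_assoc]
  simp

/-- The pointwise stabilizer in `GSpin(M)` of a set of vectors. -/
def pointwiseStabilizer (s : Set M) : Subgroup (GSpin Q) where
  carrier := {g | ∀ w ∈ s, rho Q g w = w}
  one_mem' := fun w _ => by simp
  mul_mem' := fun {a b} ha hb w hw => by
    rw [map_mul, LinearEquiv.mul_apply, hb w hw, ha w hw]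
  inv_mem' := fun {a} ha w hw => by
    have h := ha w hw
    rw [map_inv, LinearEquiv.coe_inv, LinearEquiv.symm_apply_eq, h]

end Clifford

/-! ### Extension of scalars -/

section BaseChange

variable {R M : Type*} [CommRing R] [AddCommGroup M] [Module R M] [Invertible (2 : R)]
  (Q : QuadraticForm R M) (A : Type*) [CommRing A] [Algebra R A]

/-- The canonical map of Clifford algebras `Cl(M) → Cl(A ⊗ M)`. -/
def cliffordBC : CliffordAlgebra Q →ₐ[R] CliffordAlgebra (Q.baseChange A) :=
  ((CliffordAlgebra.ofBaseChange A Q).restrictScalars R).comp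
    Algebra.TensorProduct.includeRight

theorem cliffordBC_iota (v : M) :
    cliffordBC Q A (ι Q v) = ι (Q.baseChange A) (1 ⊗ₜ v) :=
  CliffordAlgebra.ofBaseChange_tmul_ι A Q 1 v

theorem cliffordBC_even (x : CliffordAlgebra Q) (hx : x ∈ CliffordAlgebra.evenOdd Q 0) :
    cliffordBC Q A x ∈ CliffordAlgebra.even (Q.baseChange A) := by
  induction x, hx using CliffordAlgebra.even_induction with
  | algebraMap r =>
    rw [AlgHom.commutes, IsScalarTower.algebraMap_apply R A]
    exact Subalgebra.algebraMap_mem _ _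
  | add x y hx hy ihx ihy =>
    rw [map_add]
    exact add_mem ihx ihy
  | ι_mul_ι_mul a b x hx ih =>
    rw [map_mul, map_mul, cliffordBC_iota, cliffordBC_iota]
    exact mul_mem (CliffordAlgebra.ι_mul_ι_mem_evenOdd_zero _ _ _) ih

theorem conj_baseChange (a b : CliffordAlgebra (Q.baseChange A))
    (h : ∀ v : M, ∃ w : A ⊗[R] M, a * ι (Q.baseChange A) (1 ⊗ₜ v) * b = ι (Q.baseChange A) w)
    (v : A ⊗[R] M) : ∃ w, a * ι (Q.baseChange A) v * b = ι (Q.baseChange A) w := by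
  induction v using TensorProduct.induction_on with
  | zero => exact ⟨0, by simp⟩
  | tmul c v =>
    obtain ⟨w, hw⟩ := h v
    refine ⟨c • w, ?_⟩
    have : c ⊗ₜ[R] v = c • ((1 : A) ⊗ₜ[R] v) := by simp [TensorProduct.smul_tmul']
    rw [this, map_smul, map_smul, ← hw]
    simp
  | add x y hx hy =>
    obtain ⟨w, hw⟩ := hx
    obtain ⟨u, hu⟩ := hy
    exact ⟨w + u, by rw [map_add, map_add, ← hw, ← hu, mul_add, add_mul]⟩

/-- The map `GSpin(M) → GSpin(A ⊗ M)` on points. -/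
def gspinBC : GSpin Q →* GSpin (Q.baseChange A) :=
  ((Units.map (cliffordBC Q A : CliffordAlgebra Q →* CliffordAlgebra (Q.baseChange A))).comp (GSpin Q).subtype).codRestrict (GSpin (Q.baseChange A)) (by
    rintro ⟨g, h1, h2, h3, h4⟩
    refine ⟨cliffordBC_even Q A _ h1, cliffordBC_even Q A _ h2, ?_, ?_⟩
    · refine conj_baseChange Q A _ _ fun v => ?_
      obtain ⟨w, hw⟩ := h3 v
      refine ⟨1 ⊗ₜ w, ?_⟩
      have := congrArg (cliffordBC Q A) hw
      rw [map_mul, map_mul, cliffordBC_iota, cliffordBC_iota] at this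
      exact this
    · refine conj_baseChange Q A _ _ fun v => ?_
      obtain ⟨w, hw⟩ := h4 v
      refine ⟨1 ⊗ₜ w, ?_⟩
      have := congrArg (cliffordBC Q A) hw
      rw [map_mul, map_mul, cliffordBC_iota, cliffordBC_iota] at this
      exact this)

theorem rho_gspinBC [Invertible (2 : A)] (g : GSpin Q) (v : M) :
    rho (Q.baseChange A) (gspinBC Q A g) (1 ⊗ₜ v) = 1 ⊗ₜ rho Q g v := by
  apply iota_injective (Q.baseChange A)
  rw [iota_rho, ← cliffordBC_iota, ← cliffordBC_iota, iota_rho, map_mul, map_mul]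
  rfl

theorem form_baseChange (f : M →ₗ[R] M) (hf : ∀ x, Q (f x) = Q x) (x : A ⊗[R] M) :
    Q.baseChange A (f.baseChange A x) = Q.baseChange A x := by
  let _ : Invertible (2 : A) := (Invertible.map (algebraMap R A) 2).copy 2 (map_ofNat _ _).symm
  have hp : ∀ u v, QuadraticMap.polar Q (f u) (f v) = QuadraticMap.polar Q u v := by
    intro u v
    simp only [QuadraticMap.polar, ← map_add, hf]
  have hb : ∀ x y, QuadraticMap.polar (Q.baseChange A) (f.baseChange A x) (f.baseChange A y) =
      QuadraticMap.polar (Q.baseChange A) x y := by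
    intro x y
    simp only [← QuadraticMap.polarBilin_apply_apply, QuadraticForm.polarBilin_baseChange]
    induction x using TensorProduct.induction_on with
    | zero => simp
    | add x₁ x₂ h₁ h₂ => simp only [map_add, LinearMap.add_apply, h₁, h₂]
    | tmul a u =>
      induction y using TensorProduct.induction_on with
      | zero => simp
      | add y₁ y₂ h₁ h₂ => simp only [map_add, h₁, h₂]
      | tmul b v => simp [hp]
  have h := hb x x
  rw [QuadraticMap.polar_self, QuadraticMap.polar_self] at h
  simpa using congrArg (fun t => ⅟(2 : A) * t) h

end BaseChange

/-! ### Topologies on finite modules over a topological ring -/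

section ModTop

variable {R : Type*} [CommRing R] [TopologicalSpace R]

/-- The canonical topology on the Clifford algebra. -/
instance {M : Type*} [AddCommGroup M] [Module R M] (Q : QuadraticForm R M) :
    TopologicalSpace (CliffordAlgebra Q) := moduleTopology R (CliffordAlgebra Q)

/-- The canonical topology on an extension of scalars. -/
instance {F M : Type*} [CommRing F] [Algebra F R] [AddCommGroup M] [Module F M] :
    TopologicalSpace (R ⊗[F] M) := moduleTopology R (R ⊗[F] M)

end ModTop

/-! ### Oriented negative planes -/

section Planes

variable {k E : Type*} [Field k] [LinearOrder k] [IsStrictOrderedRing k] [AddCommGroup E]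
  [Module k E]

/-- Ordered bases of negative definite planes. -/
def NegFrame (q : QuadraticForm k E) : Type _ :=
  {v : Fin 2 → E // ∀ c : Fin 2 → k, c ≠ 0 → q (∑ i, c i • v i) < 0}

/-- Two ordered bases define the same oriented plane if they differ by a matrix of positive
determinant. -/
instance negFrameSetoid (q : QuadraticForm k E) : Setoid (NegFrame q) where
  r v w := ∃ A : Matrix (Fin 2) (Fin 2) k, 0 < A.det ∧ ∀ i, w.1 i = ∑ j, A i j • v.1 j
  iseqv :=
    { refl := fun _ => ⟨1, by simp, fun i => by simp [Matrix.one_apply]⟩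
      symm := by
        rintro v w ⟨A, hA, h⟩
        refine ⟨A⁻¹, by rw [Matrix.det_nonsing_inv]; simpa using hA, fun i => ?_⟩
        have hu : A⁻¹ * A = 1 := Matrix.nonsing_inv_mul A (isUnit_iff_ne_zero.mpr hA.ne')
        simp only [h, Finset.smul_sum, smul_smul]
        rw [Finset.sum_comm]
        simp only [← Finset.sum_smul, ← Matrix.mul_apply, hu, Matrix.one_apply, ite_smul,
          one_smul, zero_smul, Finset.sum_ite_eq, Finset.mem_univ, if_true]
      trans := by
        rintro u v w ⟨A, hA, h⟩ ⟨B, hB, h'⟩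
        refine ⟨B * A, by rw [Matrix.det_mul]; exact mul_pos hB hA, fun i => ?_⟩
        simp only [h', h, Finset.smul_sum, smul_smul]
        rw [Finset.sum_comm]
        simp only [← Finset.sum_smul, ← Matrix.mul_apply] }

/-- The space of oriented negative definite planes of a real quadratic space. -/
def OrientedNegPlane (q : QuadraticForm k E) : Type _ := Quotient (negFrameSetoid q)

instance [TopologicalSpace E] (q : QuadraticForm k E) : TopologicalSpace (NegFrame q) :=
  inferInstanceAs (TopologicalSpace {v : Fin 2 → E // _})

instance [TopologicalSpace E] (q : QuadraticForm k E) : TopologicalSpace (OrientedNegPlane q) :=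
  inferInstanceAs (TopologicalSpace (Quotient (negFrameSetoid q)))

/-- The image of an ordered basis under an isometry. -/
def NegFrame.map {q : QuadraticForm k E} (f : E →ₗ[k] E) (hf : ∀ x, q (f x) = q x)
    (v : NegFrame q) : NegFrame q :=
  ⟨fun i => f (v.1 i), fun c hc => by
    have : ∑ i, c i • f (v.1 i) = f (∑ i, c i • v.1 i) := by simp
    rw [this, hf]
    exact v.2 c hc⟩

/-- The image of an oriented plane under an isometry. -/
def OrientedNegPlane.map {q : QuadraticForm k E} (f : E →ₗ[k] E) (hf : ∀ x, q (f x) = q x) :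
    OrientedNegPlane q → OrientedNegPlane q :=
  Quotient.map (NegFrame.map f hf) (by
    rintro v w ⟨A, hA, h⟩
    exact ⟨A, hA, fun i => by simp [NegFrame.map, h]⟩)

/-- The oriented plane `z` is orthogonal to the set `s`. -/
def OrientedNegPlane.Perp {q : QuadraticForm k E} (z : OrientedNegPlane q) (s : Set E) : Prop :=
  ∃ v : NegFrame q, Quotient.mk (negFrameSetoid q) v = z ∧
    ∀ i, ∀ w ∈ s, QuadraticMap.polar q (v.1 i) w = 0

end Planes

/-! ### The symmetric space -/

section Field

variable {F : Type*} [Field F]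

/-- The field `ℝ`, regarded as an `F`-algebra through the embedding `σ`. -/
def RealAt (_σ : F →+* ℝ) : Type := ℝ

instance (σ : F →+* ℝ) : Field (RealAt σ) := inferInstanceAs (Field ℝ)
instance (σ : F →+* ℝ) : LinearOrder (RealAt σ) := inferInstanceAs (LinearOrder ℝ)
instance (σ : F →+* ℝ) : IsStrictOrderedRing (RealAt σ) :=
  inferInstanceAs (IsStrictOrderedRing ℝ)
instance (σ : F →+* ℝ) : TopologicalSpace (RealAt σ) := inferInstanceAs (TopologicalSpace ℝ)
instance (σ : F →+* ℝ) : IsTopologicalRing (RealAt σ) := inferInstanceAs (IsTopologicalRing ℝ)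
instance (σ : F →+* ℝ) : Algebra F (RealAt σ) := RingHom.toAlgebra (S := ℝ) σ

variable [CharZero F] {V : Type*} [AddCommGroup V] [Module F V] (Q : QuadraticForm F V)

/-- The real quadratic space `V ⊗_{F,σ} ℝ`. -/
abbrev realForm (σ : F →+* ℝ) : QuadraticForm (RealAt σ) (RealAt σ ⊗[F] V) :=
  Q.baseChange (RealAt σ)

/-- The space `D = ∏_{σ ∈ Σ₊} D^{(σ)}`, where `D^{(σ)}` is the space of oriented negative planes in
`V ⊗_{F,σ} ℝ`. -/
abbrev SymmSpace (Sp : Set (F →+* ℝ)) : Type _ :=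
  ∀ σ : Sp, OrientedNegPlane (realForm Q σ.1)

/-- The action of `G(ℚ) = GSpin(V)` on `D`. -/
instance (Sp : Set (F →+* ℝ)) : MulAction (GSpin Q) (SymmSpace Q Sp) where
  smul γ z := fun σ => (z σ).map ((rho Q γ : V →ₗ[F] V).baseChange (RealAt σ.1))
    (form_baseChange Q (RealAt σ.1) _ (form_rho Q γ))
  one_smul z := by
    funext σ
    change OrientedNegPlane.map _ _ (z σ) = z σ
    induction z σ using Quotient.inductionOn with
    | _ v =>
      refine congrArg (Quotient.mk _) (Subtype.ext (funext fun i => ?_))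
      change (LinearMap.baseChange (RealAt σ.1) ((rho Q 1 : V ≃ₗ[F] V) : V →ₗ[F] V)) (v.1 i) = v.1 i
      rw [map_one]
      change (LinearMap.baseChange (RealAt σ.1) (LinearMap.id : V →ₗ[F] V)) (v.1 i) = v.1 i
      rw [LinearMap.baseChange_id]
      rfl
  mul_smul a b z := by
    funext σ
    change OrientedNegPlane.map _ _ (z σ) =
      OrientedNegPlane.map _ _ (OrientedNegPlane.map _ _ (z σ))
    induction z σ using Quotient.inductionOn with
    | _ v =>
      refine congrArg (Quotient.mk _) (Subtype.ext (funext fun i => ?_))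
      change (LinearMap.baseChange (RealAt σ.1) ((rho Q (a * b) : V ≃ₗ[F] V) : V →ₗ[F] V)) (v.1 i)
        = (LinearMap.baseChange (RealAt σ.1) ((rho Q a : V ≃ₗ[F] V) : V →ₗ[F] V))
          ((LinearMap.baseChange (RealAt σ.1) ((rho Q b : V ≃ₗ[F] V) : V →ₗ[F] V)) (v.1 i))
      rw [map_mul, ← LinearMap.comp_apply, ← LinearMap.baseChange_comp]
      rfl

/-- `D_W`: the points of `D` all of whose components lie in `W^⊥`. -/
def symmSub (Sp : Set (F →+* ℝ)) (W : Submodule F V) : Set (SymmSpace Q Sp) :=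
  {z | ∀ σ : Sp, (z σ).Perp ((fun w : V => (1 : RealAt σ.1) ⊗ₜ[F] w) '' (W : Set V))}

/-- `D_W^+ = D_W ∩ D^+`, where `D^+` is the connected component of the base point `z₀`. -/
def symmSubPlus {Sp : Set (F →+* ℝ)} (z₀ : SymmSpace Q Sp) (W : Submodule F V) :
    Set (SymmSpace Q Sp) :=
  symmSub Q Sp W ∩ connectedComponent z₀

/-- `G(ℚ)_+`: the elements of `G(ℚ)` whose spinor norm is totally positive. -/
def Gplus : Subgroup (GSpin Q) where
  carrier := {γ | ∃ a : F, (∀ σ : F →+* ℝ, 0 < σ a) ∧ a ≠ 0 ∧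
    CliffordAlgebra.reverse ((γ : (CliffordAlgebra Q)ˣ) : CliffordAlgebra Q) *
      ((γ : (CliffordAlgebra Q)ˣ) : CliffordAlgebra Q) = algebraMap F (CliffordAlgebra Q) a}
  one_mem' := ⟨1, by simp⟩
  mul_mem' := by
    rintro x y ⟨a, ha, ha0, hxa⟩ ⟨b, hb, hb0, hyb⟩
    refine ⟨a * b, fun σ => by rw [map_mul]; exact mul_pos (ha σ) (hb σ), mul_ne_zero ha0 hb0, ?_⟩
    have h : ∀ c d e f : CliffordAlgebra Q, d * e = algebraMap F _ a →
        c * f = algebraMap F _ b → c * d * (e * f) = algebraMap F _ (a * b) := by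
      intro c d e f h1 h2
      calc c * d * (e * f) = c * (d * e) * f := by simp only [mul_assoc]
        _ = _ := by rw [h1, ← Algebra.commutes, mul_assoc, h2, map_mul]
    rw [Subgroup.coe_mul, Units.val_mul, CliffordAlgebra.reverse.map_mul]
    exact h _ _ _ _ hxa hyb
  inv_mem' := by
    rintro x ⟨a, ha, ha0, hxa⟩
    refine ⟨a⁻¹, fun σ => by rw [map_inv₀]; exact inv_pos.mpr (ha σ), inv_ne_zero ha0, ?_⟩
    set u : (CliffordAlgebra Q)ˣ := (x : (CliffordAlgebra Q)ˣ) with hu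
    have h1 : CliffordAlgebra.reverse (u : CliffordAlgebra Q) =
        algebraMap F _ a * ((u⁻¹ : (CliffordAlgebra Q)ˣ) : CliffordAlgebra Q) := by
      rw [← hxa, mul_assoc, Units.mul_inv, mul_one]
    have h2 : CliffordAlgebra.reverse ((u⁻¹ : (CliffordAlgebra Q)ˣ) : CliffordAlgebra Q) *
        CliffordAlgebra.reverse (u : CliffordAlgebra Q) = 1 := by
      rw [← CliffordAlgebra.reverse.map_mul, Units.mul_inv, CliffordAlgebra.reverse.map_one]
    rw [h1, ← mul_assoc, ← Algebra.commutes, mul_assoc] at h2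
    rw [Subgroup.coe_inv, ← hu]
    calc _ = algebraMap F _ a⁻¹ * (algebraMap F _ a *
          (CliffordAlgebra.reverse ((u⁻¹ : (CliffordAlgebra Q)ˣ) : CliffordAlgebra Q) *
          ((u⁻¹ : (CliffordAlgebra Q)ˣ) : CliffordAlgebra Q))) := by
            rw [← mul_assoc, ← map_mul, inv_mul_cancel₀ ha0, map_one, one_mul]
      _ = _ := by rw [h2, mul_one]

/-- The hyperboloid `{x ∈ M^n : Q(x) = T}`, where `Q(x) = ½((x_i, x_j))_{i,j}` and
`(x, y) = Q(x + y) - Q(x) - Q(y)`. -/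
def hyperboloid {R M : Type*} [CommRing R] [AddCommGroup M] [Module R M] (q : QuadraticForm R M)
    {n : ℕ} (T : Matrix (Fin n) (Fin n) R) : Set (Fin n → M) :=
  {x | ∀ i j, QuadraticMap.polar q (x i) (x j) = 2 * T i j}

/-- A group of automorphisms of `V` is neat if, for each of its elements, the group generated by
the eigenvalues of that element in an algebraic closure is torsion free. -/
def IsNeat [FiniteDimensional F V] (Γ : Subgroup (V ≃ₗ[F] V)) : Prop :=
  ∀ γ ∈ Γ, ∀ u ∈ Subgroup.closure {u : (AlgebraicClosure F)ˣ |
      ((LinearMap.charpoly (γ : V →ₗ[F] V)).map (algebraMap F (AlgebraicClosure F))).IsRoot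
        (u : AlgebraicClosure F)},
    ∀ k : ℕ, 0 < k → u ^ k = 1 → u = 1

end Field

/-! ### Cycles -/

section Cycles

/-- Formal `ℂ`-linear combinations of subvarieties of `S`, as multiplicity functions: a cycle is
given by the multiplicity of every (irreducible closed) subset of `S`. -/
abbrev Cycle (S : Type*) : Type _ := Set S → ℂ

open scoped Classical in
/-- The cycle with the single component `Y`, of multiplicity one. -/
def primeCycle {S : Type*} (Y : Set S) : Cycle S := fun Y' => if Y' = Y then 1 else 0

/-- Every subset has non-zero multiplicity in only finitely many members of the family. -/
def LocFinite {S I : Type*} (Z : I → Cycle S) : Prop := ∀ Y, {i | Z i Y ≠ 0}.Finite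

/-- The sum of a family of cycles (meaningful if the family is `LocFinite`). -/
def cycleSum {S I : Type*} (Z : I → Cycle S) : Cycle S := fun Y => ∑ᶠ i, Z i Y

variable {X S : Type*} [TopologicalSpace X] [TopologicalSpace S]

/-- The degree of `C → f(C)`: the number of points in the fibres over a dense open part
of `f(C)`. (At most one number `d` has the stated property when `C` is non-empty.) -/
def genericDegree (f : X → S) (C : Set X) : ℕ :=
  sSup {d | ∃ U : Set S, IsOpen U ∧ f '' C ⊆ closure (f '' C ∩ U) ∧
    ∀ y ∈ f '' C ∩ U, Nat.card {p : X // p ∈ C ∧ f p = y} = d}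

/-- The contribution `deg(C → f(C)) · f(C)` of the connected component `C` of `X` to the
push-forward of the fundamental cycle of `X`. -/
def componentCycle (f : X → S) (C : ConnectedComponents X) : Cycle S :=
  (genericDegree f (ConnectedComponents.mk ⁻¹' {C}) : ℂ) •
    primeCycle (f '' (ConnectedComponents.mk ⁻¹' {C}))

/-- The push-forward of the fundamental cycle of `X` under `f : X → S`. -/
def pushforward (f : X → S) : Cycle S := cycleSum (componentCycle f)

end Cycles

/-! ### The Shimura variety and its special cycles -/

section Shimura

variable {F : Type*} [Field F] [NumberField F]

/-- The finite adeles of `F`. -/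
abbrev Af (F : Type*) [Field F] [NumberField F] : Type _ :=
  IsDedekindDomain.FiniteAdeleRing (𝓞 F) F

instance : Invertible (2 : Af F) :=
  (Invertible.map (algebraMap F (Af F)) 2).copy 2 (map_ofNat _ _).symm

variable {V : Type*} [AddCommGroup V] [Module F V] (Q : QuadraticForm F V)

/-- The quadratic space `V(𝔸_f)`. -/
abbrev adelicForm : QuadraticForm (Af F) (Af F ⊗[F] V) := Q.baseChange (Af F)

/-- The group `G(𝔸_f)` for `G = R_{F/ℚ} GSpin(V)`. -/
abbrev GAf : Type _ := GSpin (adelicForm Q)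

/-- The inclusion `G(ℚ) → G(𝔸_f)`. -/
abbrev toGAf : GSpin Q →* GAf Q := gspinBC Q (Af F)

/-- The diagonal action of `g ∈ G(𝔸_f)` on `V(𝔸_f)^n`. -/
def actA {n : ℕ} (g : GAf Q) (x : Fin n → Af F ⊗[F] V) : Fin n → Af F ⊗[F] V :=
  fun i => rho (adelicForm Q) g (x i)

/-- The inclusion `V(F)^n → V(𝔸_f)^n`. -/
def toVAf {n : ℕ} (x : Fin n → V) : Fin n → Af F ⊗[F] V := fun i => 1 ⊗ₜ x i

variable (K : Subgroup (GAf Q))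

/-- `Γ'_g = G(ℚ)_+ ∩ g K g⁻¹`. -/
def GammaPrime (g : GAf Q) : Subgroup (GSpin Q) :=
  Gplus Q ⊓ K.comap ((MulAut.conj g⁻¹).toMonoidHom.comp (toGAf Q))

/-- `Γ_g`, the image of `Γ'_g` in `SO(V)`. -/
def Gamma (g : GAf Q) : Subgroup (V ≃ₗ[F] V) := (GammaPrime Q K g).map (rho Q)

variable (Sp : Set (F →+* ℝ))

/-- `(z, g) ∼ (γ z, γ g k)` for `γ ∈ G(ℚ)` and `k ∈ K`. -/
def shimuraSetoid : Setoid (SymmSpace Q Sp × GAf Q) where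
  r p q := ∃ γ : GSpin Q, ∃ k ∈ K, q.1 = γ • p.1 ∧ q.2 = toGAf Q γ * p.2 * k
  iseqv :=
    { refl := fun p => ⟨1, 1, K.one_mem, by simp⟩
      symm := by
        rintro p q ⟨γ, k, hk, h1, h2⟩
        exact ⟨γ⁻¹, k⁻¹, K.inv_mem hk, by rw [h1, inv_smul_smul], by rw [h2, map_inv]; group⟩
      trans := by
        rintro p q r ⟨γ, k, hk, h1, h2⟩ ⟨γ', k', hk', h1', h2'⟩
        exact ⟨γ' * γ, k * k', K.mul_mem hk hk', by rw [h1', h1, mul_smul],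
          by rw [h2', h2, map_mul]; group⟩ }

/-- `S_K = G(ℚ) \ D × G(𝔸_f) / K`. -/
def ShimuraVar : Type _ := Quotient (shimuraSetoid Q K Sp)

instance : TopologicalSpace (ShimuraVar Q K Sp) :=
  inferInstanceAs (TopologicalSpace (Quotient (shimuraSetoid Q K Sp)))

variable {Sp}

/-- The point `[z, g]` of `S_K`. -/
def pt (z : SymmSpace Q Sp) (g : GAf Q) : ShimuraVar Q K Sp :=
  Quotient.mk (shimuraSetoid Q K Sp) (z, g)

/-- The connected cycle `Z(W)_{Γ_g}`, the image of `D_W^+` in `Γ_g \ D^+`, where `Γ_g \ D^+` is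
embedded as a connected component of `S_K` by `z ↦ [z, g]`. -/
def connCycle (z₀ : SymmSpace Q Sp) (W : Submodule F V) (g : GAf Q) : Set (ShimuraVar Q K Sp) :=
  (fun z => pt Q K z g) '' symmSubPlus Q z₀ W

/-- Orbits of `Γ_g` in the hyperboloid `{x ∈ V(F)^n : Q(x) = T}`. -/
def orbitSetoid {n : ℕ} (T : Matrix (Fin n) (Fin n) F) (g : GAf Q) :
    Setoid (hyperboloid Q T) where
  r x y := ∃ γ ∈ Gamma Q K g, ∀ i, y.1 i = γ (x.1 i)
  iseqv :=
    { refl := fun x => ⟨1, one_mem _, fun i => rfl⟩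
      symm := by
        rintro x y ⟨γ, hγ, h⟩
        exact ⟨γ⁻¹, inv_mem hγ, fun i => by rw [h i]; simp⟩
      trans := by
        rintro x y z ⟨γ, hγ, h⟩ ⟨γ', hγ', h'⟩
        exact ⟨γ' * γ, mul_mem hγ' hγ, fun i => by rw [h' i, h i]; rfl⟩ }

/-- The term `φ(g_j⁻¹ x) Z(W(x))_{Γ_{g_j}}` for the class of `x` modulo `Γ_{g_j}`, with `W(x)` the
span of the components of `x`. -/
def wtTerm {J : Type*} (z₀ : SymmSpace Q Sp) {n : ℕ} (T : Matrix (Fin n) (Fin n) F)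
    (φ : (Fin n → Af F ⊗[F] V) → ℂ) (g : J → GAf Q)
    (p : Σ j : J, Quotient (orbitSetoid Q K T (g j))) : Cycle (ShimuraVar Q K Sp) :=
  φ (actA Q (g p.1)⁻¹ (toVAf p.2.out.1)) •
    primeCycle (connCycle Q K z₀ (Submodule.span F (Set.range p.2.out.1)) (g p.1))

/-- The weighted cycle `Z(T, φ, K)`, as a sum of connected cycles over the representatives `g_j`
and over the orbits of `Γ_{g_j}` in the hyperboloid. -/
def wtCycle {J : Type*} (z₀ : SymmSpace Q Sp) {n : ℕ} (T : Matrix (Fin n) (Fin n) F)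
    (φ : (Fin n → Af F ⊗[F] V) → ℂ) (g : J → GAf Q) : Cycle (ShimuraVar Q K Sp) :=
  cycleSum (wtTerm Q K z₀ T φ g)

variable (Sp)

/-- `H(ℚ)`, for `H` the pointwise stabilizer of `W` in `G`. -/
abbrev HQ (W : Submodule F V) : Subgroup (GSpin Q) := pointwiseStabilizer Q (W : Set V)

/-- `H(𝔸_f)`. -/
abbrev HAf (W : Submodule F V) : Subgroup (GAf Q) :=
  pointwiseStabilizer (adelicForm Q) ((fun w : V => (1 : Af F) ⊗ₜ[F] w) '' (W : Set V))

/-- `(z, h) ∼ (η z, η h k)` on `D_W × H(𝔸_f)`, for `η ∈ H(ℚ)` and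
`k ∈ K_{H,g} = H(𝔸_f) ∩ g K g⁻¹`. -/
def natSetoid (W : Submodule F V) (g : GAf Q) : Setoid (symmSub Q Sp W × HAf Q W) where
  r p q := ∃ η ∈ HQ Q W, ∃ k ∈ HAf Q W, g⁻¹ * k * g ∈ K ∧
    q.1.1 = η • p.1.1 ∧ (q.2 : GAf Q) = toGAf Q η * p.2 * k
  iseqv :=
    { refl := fun p => ⟨1, one_mem _, 1, one_mem _, by simp [K.one_mem], by simp⟩
      symm := by
        rintro p q ⟨η, hη, k, hk, hk', h1, h2⟩
        refine ⟨η⁻¹, inv_mem hη, k⁻¹, inv_mem hk, ?_, by rw [h1, inv_smul_smul],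
          by rw [h2, map_inv]; group⟩
        have := K.inv_mem hk'
        simpa [mul_assoc] using this
      trans := by
        rintro p q r ⟨η, hη, k, hk, hk', h1, h2⟩ ⟨θ, hθ, l, hl, hl', h1', h2'⟩
        refine ⟨θ * η, mul_mem hθ hη, k * l, mul_mem hk hl, ?_, by rw [h1', h1, mul_smul],
          by rw [h2', h2, map_mul]; group⟩
        have := K.mul_mem hk' hl'
        simpa [mul_assoc] using this }

/-- `H(ℚ) \ D_W × H(𝔸_f) / K_{H,g}`. -/
def NatSource (W : Submodule F V) (g : GAf Q) : Type _ := Quotient (natSetoid Q K Sp W g)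

instance (W : Submodule F V) (g : GAf Q) : TopologicalSpace (NatSource Q K Sp W g) :=
  inferInstanceAs (TopologicalSpace (Quotient (natSetoid Q K Sp W g)))

/-- The map `[z, h] ↦ [z, h g]` to `S_K`. -/
def natMap (W : Submodule F V) (g : GAf Q) : NatSource Q K Sp W g → ShimuraVar Q K Sp :=
  Quotient.lift (fun p : symmSub Q Sp W × HAf Q W => pt Q K p.1.1 ((p.2 : GAf Q) * g)) (by
    rintro p q ⟨η, _, k, _, hk', h1, h2⟩
    refine Quotient.sound ⟨η, g⁻¹ * k * g, hk', h1, ?_⟩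
    change (q.2 : GAf Q) * g = _
    rw [h2]
    group)

/-- The natural cycle `Z(W, g, K)^♮`. -/
def natCycle (W : Submodule F V) (g : GAf Q) : Cycle (ShimuraVar Q K Sp) :=
  pushforward (natMap Q K Sp W g)

/-- The term `φ(ξ⁻¹ x₀) Z(W(x₀), ξ, K)^♮`. -/
def natTerm {n : ℕ} (φ : (Fin n → Af F ⊗[F] V) → ℂ) (x₀ : Fin n → V) (ξ : GAf Q) :
    Cycle (ShimuraVar Q K Sp) :=
  φ (actA Q ξ⁻¹ (toVAf x₀)) • natCycle Q K Sp (Submodule.span F (Set.range x₀)) ξ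

/-- The weighted sum of natural cycles `Z(T, φ, K)^♮ = ∑_r φ(ξ_r⁻¹ x₀) Z(W(x₀), ξ_r, K)^♮`. -/
def natWtCycle {I : Type*} {n : ℕ} (φ : (Fin n → Af F ⊗[F] V) → ℂ) (x₀ : Fin n → V)
    (ξ : I → GAf Q) : Cycle (ShimuraVar Q K Sp) :=
  cycleSum fun r => natTerm Q K Sp φ x₀ (ξ r)

/-- `G(𝔸_f)` is the disjoint union of the sets `G(ℚ)_+ g_j K`. -/
def IsComponentReps {J : Type*} (g : J → GAf Q) : Prop :=
  ∀ a : GAf Q, ∃! j, ∃ γ ∈ Gplus Q, ∃ k ∈ K, a = toGAf Q γ * g j * k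

/-- `supp(φ) ∩ {x ∈ V(𝔸_f)^n : Q(x) = T}` is the disjoint union of the sets `K ξ_r⁻¹ x₀`. -/
def IsOrbitReps {I : Type*} {n : ℕ} (T : Matrix (Fin n) (Fin n) F)
    (φ : (Fin n → Af F ⊗[F] V) → ℂ) (x₀ : Fin n → V) (ξ : I → GAf Q) : Prop :=
  Function.support φ ∩ hyperboloid (adelicForm Q) (T.map (algebraMap F (Af F))) =
      ⋃ r, {x | ∃ k ∈ K, x = actA Q (k * (ξ r)⁻¹) (toVAf x₀)} ∧
    Pairwise fun r s => Disjoint {x | ∃ k ∈ K, x = actA Q (k * (ξ r)⁻¹) (toVAf x₀)}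
      {x | ∃ k ∈ K, x = actA Q (k * (ξ s)⁻¹) (toVAf x₀)}

end Shimura

end

end OrthShimura

open OrthShimura

/-! Both sides are sums over the same connected cycles. Write `H` for the pointwise stabilizer of
`W(x₀)`. Take a connected component `C` of `H(ℚ) \ D_W × H(𝔸_f) / K_{H,ξ_r}` and a point `[z, h]` of
it. Some `γ ∈ G(ℚ)` moves `z` into `D^+` and satisfies `γ h ξ_r ∈ g_j K` for exactly one `j`. Then
`x = γ x₀` is a tuple with Gram matrix `2T`, well defined modulo `Γ_{g_j}`, its weight `φ(g_j⁻¹ x)`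
equals `φ(ξ_r⁻¹ x₀)`, and translation by `γ` shows that the image of `C` is the connected cycle of
`W(x)`. This is the relation `CompRel`. It defines an injective map from the pairs `(r, C)` to the
pairs `(j, x mod Γ_{g_j})` (`CompRel.unique`, `CompRel.component_unique`, with disjointness of the
`K ξ_r⁻¹ x₀` for different `r`). Its range contains every pair of non-zero weight
(`exists_compRel_of_ne_zero`): Witt's theorem gives `x = γ x₀`, and `g_j⁻¹ x` lies in some `K ξ_r⁻¹
x₀`.

It remains to see that the natural map has degree one on each component (`genericDegree_natMap`) and
that the sums are finite. Both rest on one finiteness statement: near a point `z` of `D`, only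
finitely many tuples with Gram matrix `2T` lie in a fixed compact adelic set and are orthogonal to a
point near `z`. Indeed the form is positive on the orthogonal complement of `z`, which bounds the
real coordinates, and compactness bounds the denominators. Consequently, over a dense open part of
the image, all tuples of non-zero weight orthogonal to `z` span the same space `W`. Two points of
`C` with the same image there differ by an element of some `Γ_b` that preserves `W` and permutes a
finite set of tuples containing `x₀`. A power of it fixes `x₀`, so by neatness it fixes `x₀` itself,
and the two points agree.

The real input is that each factor of `D` has two sides, told apart by the sign of a Gram
determinant between frames, and that a reflection in `a` preserves the side exactly when `q(a) > 0`
(`NegIndexTwo.det_gram_refl`). Since every element of `GSpin(V)` is a scalar times a product of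
anisotropic vectors (`GSpin_structure`), `G(ℚ)_+` is the stabilizer of `D^+` (`mem_Gplus_iff`). Weak
approximation at the real places makes `G(ℚ)` transitive on the components of `D`
(`exists_GSpin_sameComp`), and `D_W` meets each of them in a connected set. -/

namespace OrthShimura

noncomputable section

/-! ### Elements of the Clifford algebra killed by all contractions. -/

section Contraction

variable {F V : Type*} [Field F] [CharZero F] [AddCommGroup V] [Module F V]

open scoped CliffordAlgebra in
/-- The Euler operator `∑ bᵢ ∧ (bᵢ* ⌋ x)` of the exterior algebra. -/
def eulerOp {κ : Type*} [Fintype κ] (b : Module.Basis κ F V) :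
    ExteriorAlgebra F V →ₗ[F] ExteriorAlgebra F V :=
  ∑ i, (LinearMap.mulLeft F (ExteriorAlgebra.ι F (b i))).comp
    (CliffordAlgebra.contractLeft (b.coord i))

omit [CharZero F] in
-- The sign in the antiderivation rule for contractions cancels against the sign from moving `bᵢ`
-- past `v`, and `∑ bᵢ*(v) bᵢ = v`. So the operator counts degree.
theorem eulerOp_ι_mul {κ : Type*} [Fintype κ] (b : Module.Basis κ F V) (v : V)
    (x : ExteriorAlgebra F V) :
    eulerOp b (ExteriorAlgebra.ι F v * x) =
      ExteriorAlgebra.ι F v * x + ExteriorAlgebra.ι F v * eulerOp b x := by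
  have hanti (u w : V) (y : ExteriorAlgebra F V) : ExteriorAlgebra.ι F u *
      (ExteriorAlgebra.ι F w * y) = -(ExteriorAlgebra.ι F w * (ExteriorAlgebra.ι F u * y)) := by
    have h := ExteriorAlgebra.ι_add_mul_swap (R := F) u w
    rw [← mul_assoc, ← mul_assoc, eq_neg_iff_add_eq_zero, ← add_mul, h, zero_mul]
  have hc (i : κ) : CliffordAlgebra.contractLeft (b.coord i) (ExteriorAlgebra.ι F v * x) =
      b.coord i v • x - ExteriorAlgebra.ι F v * CliffordAlgebra.contractLeft (b.coord i) x :=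
    CliffordAlgebra.contractLeft_ι_mul _ _ _
  have hv : ExteriorAlgebra.ι F v = ∑ i, b.coord i v • ExteriorAlgebra.ι F (b i) := by
    conv_lhs => rw [← b.sum_repr v]
    rw [map_sum]
    simp only [map_smul, Module.Basis.coord_apply]
  simp only [eulerOp, LinearMap.sum_apply, LinearMap.comp_apply, hc, map_sub, map_smul,
    LinearMap.mulLeft_apply]
  rw [Finset.mul_sum, Finset.sum_congr rfl fun i _ => by rw [hanti, sub_neg_eq_add],
    Finset.sum_add_distrib]
  congr 1
  conv_rhs => rw [hv]
  rw [Finset.sum_mul]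
  simp

theorem eulerOp_of_mem {κ : Type*} [Fintype κ] (b : Module.Basis κ F V) (k : ℕ)
    (x : ExteriorAlgebra F V) (hx : x ∈ ⋀[F]^k V) : eulerOp b x = (k : F) • x := by
  induction hx using Submodule.pow_induction_on_left' with
  | algebraMap r =>
    have (i : κ) : CliffordAlgebra.contractLeft (b.coord i)
        (algebraMap F (ExteriorAlgebra F V) r) = 0 :=
      CliffordAlgebra.contractLeft_algebraMap _ _ _
    simp [eulerOp, this]
  | add x y i hx hy ihx ihy => rw [map_add, ihx, ihy, smul_add]
  | mem_mul m hm i x hx ih =>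
    obtain ⟨v, rfl⟩ := hm
    rw [eulerOp_ι_mul, ih]
    push_cast
    rw [add_smul, one_smul, mul_smul_comm, add_comm]

/-- On the degree `k` component the operator is multiplication by `k`, which is invertible for `k >
0` in characteristic zero. Only degree `0` survives. -/
theorem exterior_scalar_of_eulerOp {κ : Type*} [Fintype κ] (b : Module.Basis κ F V)
    (x : ExteriorAlgebra F V) (hx : eulerOp b x = 0) :
    ∃ c, x = algebraMap F (ExteriorAlgebra F V) c := by
  classical
  have key (y : ExteriorAlgebra F V) (k : ℕ) :
      ((DirectSum.decompose (fun i : ℕ => ⋀[F]^i V) (eulerOp b y) k : ExteriorAlgebra F V)) =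
        (k : F) • (DirectSum.decompose (fun i : ℕ => ⋀[F]^i V) y k : ExteriorAlgebra F V) := by
    induction y using DirectSum.Decomposition.inductionOn (fun i : ℕ => ⋀[F]^i V) with
    | zero => simp
    | @homogeneous i m =>
      rw [eulerOp_of_mem b i m m.2]
      by_cases h : i = k
      · subst h
        rw [DirectSum.decompose_of_mem_same (fun i : ℕ => ⋀[F]^i V) (Submodule.smul_mem _ _ m.2),
          DirectSum.decompose_of_mem_same (fun i : ℕ => ⋀[F]^i V) m.2]
      · rw [DirectSum.decompose_of_mem_ne (fun i : ℕ => ⋀[F]^i V) (Submodule.smul_mem _ _ m.2) h,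
          DirectSum.decompose_of_mem_ne (fun i : ℕ => ⋀[F]^i V) m.2 h, smul_zero]
    | add m m' h h' => simp [h, h', smul_add]
  have h0 (k : ℕ) (hk : k ≠ 0) :
      (DirectSum.decompose (fun i : ℕ => ⋀[F]^i V) x k : ExteriorAlgebra F V) = 0 := by
    have := key x k
    rw [hx] at this
    simpa [hk] using this.symm
  have hx0 : x ∈ ⋀[F]^0 V := by
    rw [← DirectSum.sum_support_decompose (fun i : ℕ => ⋀[F]^i V) x]
    refine sum_mem fun i hi => ?_
    rcases eq_or_ne i 0 with rfl | h
    · exact SetLike.coe_mem _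
    · rw [h0 i h]
      exact zero_mem _
  obtain ⟨c, hc⟩ := Submodule.mem_one.mp ((pow_zero (LinearMap.range
    (ExteriorAlgebra.ι F (M := V)))).le hx0)
  exact ⟨c, hc.symm⟩

/-- The linear isomorphism with the exterior algebra commutes with contractions, so the question is
reduced to the Euler operator there. -/
theorem clifford_scalar_of_contractLeft [FiniteDimensional F V] (Q : QuadraticForm F V)
    (u : CliffordAlgebra Q)
    (hu : ∀ d : Module.Dual F V, CliffordAlgebra.contractLeft d u = 0) :
    ∃ c, u = algebraMap F (CliffordAlgebra Q) c := by
  set b := Module.finBasis F V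
  have h : eulerOp b (CliffordAlgebra.equivExterior Q u) = 0 := by
    simp only [eulerOp, LinearMap.sum_apply, LinearMap.comp_apply]
    refine Finset.sum_eq_zero fun i _ => ?_
    have : CliffordAlgebra.contractLeft (b.coord i) (CliffordAlgebra.equivExterior Q u) = 0 := by
      simp only [CliffordAlgebra.equivExterior, CliffordAlgebra.changeFormEquiv_apply]
      rw [← CliffordAlgebra.changeForm_contractLeft, hu, map_zero]
    rw [this, map_zero]
  obtain ⟨c, hc⟩ := exterior_scalar_of_eulerOp b _ h
  refine ⟨c, (CliffordAlgebra.equivExterior Q).injective ?_⟩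
  rw [hc]
  simp only [CliffordAlgebra.equivExterior, CliffordAlgebra.changeFormEquiv_apply,
    CliffordAlgebra.changeForm_algebraMap]

omit [CharZero F] in
-- Both sides are twisted derivations in `u` that agree on vectors. This turns commutation with
-- vectors into a statement on contractions.
theorem contractLeft_polar (Q : QuadraticForm F V) (x : V) (u : CliffordAlgebra Q) :
    CliffordAlgebra.contractLeft (Q.polarBilin x) u =
      ι Q x * u - CliffordAlgebra.involute u * ι Q x := by
  induction u using CliffordAlgebra.left_induction with
  | algebraMap r => simp [CliffordAlgebra.contractLeft_algebraMap, Algebra.commutes]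
  | add a b ha hb => rw [map_add, ha, hb, map_add, mul_add, add_mul]; abel
  | ι_mul b a hb =>
    rw [CliffordAlgebra.contractLeft_ι_mul, hb, map_mul, CliffordAlgebra.involute_ι]
    have h := CliffordAlgebra.ι_mul_ι_add_swap (Q := Q) x a
    rw [QuadraticMap.polarBilin_apply_apply, Algebra.smul_def, ← h]
    noncomm_ring

/-- By non-degeneracy every linear functional is the pairing with some vector, so all contractions
of `u` vanish. This plays the role of a computation of the centre. -/
theorem clifford_scalar_of_twisted_comm [FiniteDimensional F V] (Q : QuadraticForm F V)
    (hQ : ∀ x, (∀ y, QuadraticMap.polar Q x y = 0) → x = 0) (u : CliffordAlgebra Q)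
    (hu : ∀ x, ι Q x * u = CliffordAlgebra.involute u * ι Q x) :
    ∃ c, u = algebraMap F (CliffordAlgebra Q) c := by
  refine clifford_scalar_of_contractLeft Q u fun d => ?_
  have hinj : Function.Injective Q.polarBilin := by
    rw [injective_iff_map_eq_zero]
    intro x hx
    exact hQ x fun y => by simpa using LinearMap.congr_fun hx y
  obtain ⟨x, rfl⟩ := (LinearMap.injective_iff_surjective_of_finrank_eq_finrank
    (Subspace.dual_finrank_eq (K := F) (V := V)).symm).mp hinj d
  rw [contractLeft_polar, hu, sub_self]

end Contraction


/-! ### Reflections, Witt's theorem and generation of the orthogonal group. -/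

section Reflections

variable {F V : Type*} [Field F] [AddCommGroup V] [Module F V] (Q : QuadraticForm F V)

/-- The reflection in the hyperplane orthogonal to the anisotropic vector `v`. -/
def refl (v : V) : V →ₗ[F] V := LinearMap.id - ((Q v)⁻¹ • Q.polarBilin v).smulRight v

theorem refl_apply (v x : V) : refl Q v x = x - ((Q v)⁻¹ * QuadraticMap.polar Q v x) • v := by
  simp [refl]

theorem polar_self_eq (x : V) : QuadraticMap.polar Q x x = 2 * Q x := by
  rw [QuadraticMap.polar_self, two_nsmul, two_mul]

theorem form_add (x y : V) : Q (x + y) = Q x + Q y + QuadraticMap.polar Q x y :=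
  QuadraticMap.map_add Q x y

theorem form_refl {v : V} (hv : Q v ≠ 0) (x : V) : Q (refl Q v x) = Q x := by
  rw [refl_apply, sub_eq_add_neg, ← neg_smul, form_add, QuadraticMap.map_smul,
    QuadraticMap.polar_smul_right, QuadraticMap.polar_comm Q x v]
  simp only [smul_eq_mul]
  field_simp
  ring

theorem refl_of_polar_eq_zero {v x : V} (h : QuadraticMap.polar Q v x = 0) : refl Q v x = x := by
  simp [refl_apply, h]

theorem refl_refl {v : V} (hv : Q v ≠ 0) (x : V) : refl Q v (refl Q v x) = x := by
  simp only [refl_apply, QuadraticMap.polar_sub_right, QuadraticMap.polar_smul_right,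
    polar_self_eq, smul_eq_mul, sub_sub, ← add_smul]
  have : (Q v)⁻¹ * QuadraticMap.polar Q v x + (Q v)⁻¹ * (QuadraticMap.polar Q v x -
      (Q v)⁻¹ * QuadraticMap.polar Q v x * (2 * Q v)) = 0 := by
    field_simp
    ring
  rw [this, zero_smul, sub_zero]

theorem refl_self {v : V} (hv : Q v ≠ 0) : refl Q v v = -v := by
  have : (Q v)⁻¹ * (2 * Q v) = 2 := by field_simp
  rw [refl_apply, polar_self_eq, this, two_smul]
  abel

theorem refl_sub {x y : V} (h : Q x = Q y) (hv : Q (x - y) ≠ 0) : refl Q (x - y) x = y := by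
  have h1 : QuadraticMap.polar Q (x - y) x = Q (x - y) := by
    have h2 := form_add Q x (-y)
    rw [← sub_eq_add_neg, QuadraticMap.map_neg, QuadraticMap.polar_neg_right] at h2
    rw [QuadraticMap.polar_sub_left, polar_self_eq, h2, QuadraticMap.polar_comm Q y x, h]
    ring
  rw [refl_apply, h1, inv_mul_cancel₀ hv, one_smul, sub_sub_cancel]

/-- The product of the reflections in the vectors of a list. -/
def reflProd (l : List V) : V →ₗ[F] V := (l.map (fun v => (refl Q v : Module.End F V))).prod

theorem reflProd_nil (x : V) : reflProd Q [] x = x := rfl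

theorem reflProd_cons (v : V) (l : List V) (x : V) :
    reflProd Q (v :: l) x = refl Q v (reflProd Q l x) := by
  simp [reflProd]

theorem form_reflProd {l : List V} (hl : ∀ v ∈ l, Q v ≠ 0) (x : V) :
    Q (reflProd Q l x) = Q x := by
  induction l with
  | nil => rfl
  | cons v l ih =>
    rw [reflProd_cons, form_refl Q (hl v List.mem_cons_self), ih fun w hw =>
      hl w (List.mem_cons_of_mem _ hw)]

theorem polar_of_form_eq {f : V →ₗ[F] V} (hf : ∀ x, Q (f x) = Q x) (x y : V) :
    QuadraticMap.polar Q (f x) (f y) = QuadraticMap.polar Q x y := by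
  simp only [QuadraticMap.polar, ← map_add, hf]

theorem reflProd_surjective {l : List V} (hl : ∀ v ∈ l, Q v ≠ 0) :
    Function.Surjective (reflProd Q l) := by
  induction l with
  | nil => exact fun x => ⟨x, rfl⟩
  | cons v l ih =>
    intro y
    obtain ⟨x, hx⟩ := ih (fun w hw => hl w (List.mem_cons_of_mem _ hw)) (refl Q v y)
    exact ⟨x, by rw [reflProd_cons, hx, refl_refl Q (hl v List.mem_cons_self)]⟩

variable [NeZero (2 : F)]

/-- Witt's theorem for a vector: two vectors of the same non-zero length are exchanged by at most
two reflections, in vectors orthogonal to everything orthogonal to both. -/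
theorem exists_reflProd_vector {x y : V} (h : Q x = Q y) (hy : Q y ≠ 0) :
    ∃ l : List V, (∀ v ∈ l, Q v ≠ 0) ∧ reflProd Q l x = y ∧
      ∀ z, QuadraticMap.polar Q z x = 0 → QuadraticMap.polar Q z y = 0 → reflProd Q l z = z := by
  by_cases hv : Q (x - y) = 0
  -- By the parallelogram law `Q(x+y) + Q(x-y) = 4 Q(y) ≠ 0`, so the two values cannot both vanish.
  · have hv' : Q (x + y) ≠ 0 := by
      intro h0
      rw [form_add] at h0
      rw [sub_eq_add_neg, form_add, QuadraticMap.map_neg,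
        QuadraticMap.polar_neg_right] at hv
      have : (2 : F) * (2 * Q y) = 0 := by linear_combination h0 + hv - 2 * h
      simp [NeZero.ne (2 : F), hy] at this
    have hv'' : Q (x - -y) ≠ 0 := by rwa [sub_neg_eq_add]
    -- The reflection in `x + y` sends `x` to `-y`, and the reflection in `y` then restores the
    -- sign.
    refine ⟨[y, x - -y], by simp [hy, hv'], ?_, fun z hz hz' => ?_⟩
    · rw [reflProd_cons, reflProd_cons, reflProd_nil,
        refl_sub Q (by rw [QuadraticMap.map_neg, h]) hv'', map_neg, refl_self Q hy, neg_neg]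
    · rw [reflProd_cons, reflProd_cons, reflProd_nil, refl_of_polar_eq_zero Q (x := z),
        refl_of_polar_eq_zero]
      · rwa [QuadraticMap.polar_comm]
      · rw [QuadraticMap.polar_comm, sub_neg_eq_add, QuadraticMap.polar_add_right, hz, hz', add_zero]
  · refine ⟨[x - y], by simpa using hv, ?_, fun z hz hz' => ?_⟩
    · rw [reflProd_cons, reflProd_nil, refl_sub Q h hv]
    · rw [reflProd_cons, reflProd_nil, refl_of_polar_eq_zero]
      rw [QuadraticMap.polar_comm, QuadraticMap.polar_sub_right, hz, hz', sub_zero]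

omit [NeZero (2 : F)] in
theorem reflProd_append (l l' : List V) (x : V) :
    reflProd Q (l ++ l') x = reflProd Q l (reflProd Q l' x) := by
  simp [reflProd]

/-- Witt's theorem for orthogonal tuples of anisotropic vectors. -/
theorem exists_reflProd_orthogonal {k : ℕ} (e e' : Fin k → V)
    (he : Pairwise fun i j => QuadraticMap.polar Q (e i) (e j) = 0)
    (he' : Pairwise fun i j => QuadraticMap.polar Q (e' i) (e' j) = 0)
    (h0 : ∀ i, Q (e' i) ≠ 0) (h : ∀ i, Q (e i) = Q (e' i)) :
    ∃ l : List V, (∀ v ∈ l, Q v ≠ 0) ∧ ∀ i, reflProd Q l (e i) = e' i := by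
  induction k with
  | zero => exact ⟨[], by simp, fun i => i.elim0⟩
  | succ k ih =>
    obtain ⟨l, hl, hle⟩ := ih (e ∘ Fin.castSucc) (e' ∘ Fin.castSucc)
      (fun i j hij => he (by simpa using hij)) (fun i j hij => he' (by simpa using hij))
      (fun i => h0 _) (fun i => h _)
    obtain ⟨l', hl', hx, hz⟩ := exists_reflProd_vector Q (x := reflProd Q l (e (Fin.last k)))
      (y := e' (Fin.last k)) (by rw [form_reflProd Q hl, h]) (h0 _)
    refine ⟨l' ++ l, fun v hv => ?_, fun i => ?_⟩
    · rcases List.mem_append.mp hv with hv | hv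
      exacts [hl' v hv, hl v hv]
    · rw [reflProd_append]
      induction i using Fin.lastCases with
      | last => exact hx
      | cast i =>
        have hi : reflProd Q l (e i.castSucc) = e' i.castSucc := hle i
        rw [hi]
        -- The vectors matched so far are orthogonal both to the current image of the last vector
        -- and to its target, so the correction does not disturb them.
        refine hz _ ?_ (he' (Fin.castSucc_lt_last i).ne)
        rw [← hi, polar_of_form_eq Q (form_reflProd Q hl)]
        exact he (Fin.castSucc_lt_last i).ne

/-- A weak form of the Cartan–Dieudonné theorem. -/
theorem exists_reflProd_eq [FiniteDimensional F V] [Invertible (2 : F)]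
    (hQ : ∀ x, (∀ y, QuadraticMap.polar Q x y = 0) → x = 0) (f : V →ₗ[F] V)
    (hf : ∀ x, Q (f x) = Q x) : ∃ l : List V, (∀ v ∈ l, Q v ≠ 0) ∧ reflProd Q l = f := by
  obtain ⟨b, hb⟩ := LinearMap.BilinForm.exists_orthogonal_basis
    (B := Q.polarBilin) ⟨fun x y => QuadraticMap.polar_comm Q x y⟩
  have hb' : Pairwise fun i j => QuadraticMap.polar Q (b i) (b j) = 0 := fun i j hij => hb hij
  -- An isotropic member of an orthogonal basis would be orthogonal to the whole basis, hence in the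
  -- radical.
  have hb0 (i) : Q (b i) ≠ 0 := by
    intro h0
    refine b.ne_zero i (hQ _ fun y => ?_)
    have : Q.polarBilin (b i) = 0 := b.ext fun j => by
      rcases eq_or_ne i j with rfl | hij
      · simp [h0]
      · simpa using hb' hij
    simpa using LinearMap.congr_fun this y
  obtain ⟨l, hl, hle⟩ := exists_reflProd_orthogonal Q b (f ∘ b) hb'
    (fun i j hij => by simp only [Function.comp, polar_of_form_eq Q hf]; exact hb' hij)
    (fun i => by simp only [Function.comp, hf]; exact hb0 i)
    (fun i => by simp only [Function.comp, hf])
  exact ⟨l, hl, b.ext hle⟩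

end Reflections


/-! ### Products of anisotropic vectors in the Clifford algebra. -/

section VectorProducts

variable {F V : Type*} [Field F] [AddCommGroup V] [Module F V] (Q : QuadraticForm F V)

/-- The product in the Clifford algebra of the vectors of a list. -/
def vecProd (l : List V) : CliffordAlgebra Q := (l.map (ι Q)).prod

/-- The product of the values of the form at the vectors of a list. -/
def formProd (l : List V) : F := (l.map Q).prod

theorem formProd_ne_zero {l : List V} (hl : ∀ v ∈ l, Q v ≠ 0) : formProd Q l ≠ 0 := by
  refine List.prod_ne_zero fun h => ?_
  obtain ⟨v, hv, h0⟩ := List.mem_map.mp h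
  exact hl v hv h0

theorem reverse_mul_vecProd (l : List V) : CliffordAlgebra.reverse (vecProd Q l) * vecProd Q l =
    algebraMap F (CliffordAlgebra Q) (formProd Q l) := by
  induction l with
  | nil => simp [vecProd, formProd]
  | cons v l ih =>
    have h1 : vecProd Q (v :: l) = ι Q v * vecProd Q l := by simp [vecProd]
    have h2 : formProd Q (v :: l) = Q v * formProd Q l := by simp [formProd]
    rw [h1, h2, CliffordAlgebra.reverse.map_mul, CliffordAlgebra.reverse_ι, mul_assoc,
      ← mul_assoc (ι Q v), CliffordAlgebra.ι_sq_scalar, ← mul_assoc, ← Algebra.commutes, mul_assoc,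
      ih, map_mul]

theorem vecProd_mul_reverse (l : List V) : vecProd Q l * CliffordAlgebra.reverse (vecProd Q l) =
    algebraMap F (CliffordAlgebra Q) (formProd Q l) := by
  induction l with
  | nil => simp [vecProd, formProd]
  | cons v l ih =>
    have h1 : vecProd Q (v :: l) = ι Q v * vecProd Q l := by simp [vecProd]
    have h2 : formProd Q (v :: l) = Q v * formProd Q l := by simp [formProd]
    rw [h1, h2, CliffordAlgebra.reverse.map_mul, CliffordAlgebra.reverse_ι, mul_assoc,
      ← mul_assoc (vecProd Q l), ih, ← mul_assoc, ← Algebra.commutes, mul_assoc,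
      CliffordAlgebra.ι_sq_scalar, ← map_mul, mul_comm]

theorem ι_mul_ι_eq_refl {v : V} (hv : Q v ≠ 0) (x : V) :
    ι Q v * ι Q x = -(ι Q (refl Q v x) * ι Q v) := by
  rw [refl_apply, map_sub, map_smul, sub_mul, smul_mul_assoc, CliffordAlgebra.ι_sq_scalar,
    Algebra.smul_def, ← map_mul (algebraMap F (CliffordAlgebra Q))]
  have : (Q v)⁻¹ * QuadraticMap.polar Q v x * Q v = QuadraticMap.polar Q v x := by field_simp
  rw [this, ← CliffordAlgebra.ι_mul_ι_add_swap]
  abel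

/-- Each factor passes a vector at the cost of a sign and a reflection. For an even number of
factors the signs cancel, so conjugation is the product of the reflections. -/
theorem vecProd_mul_ι {l : List V} (hl : ∀ v ∈ l, Q v ≠ 0) (x : V) :
    vecProd Q l * ι Q x = (-1 : F) ^ l.length • (ι Q (reflProd Q l x) * vecProd Q l) := by
  induction l with
  | nil => simp [vecProd, reflProd_nil]
  | cons v l ih =>
    have h1 : vecProd Q (v :: l) = ι Q v * vecProd Q l := by simp [vecProd]
    rw [h1, mul_assoc, ih fun w hw => hl w (List.mem_cons_of_mem _ hw), mul_smul_comm, ← mul_assoc,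
      ι_mul_ι_eq_refl Q (hl v List.mem_cons_self), reflProd_cons, List.length_cons, pow_succ,
      mul_neg_one, neg_smul, neg_mul, smul_neg, mul_assoc]

theorem vecProd_mem_evenOdd (l : List V) :
    vecProd Q l ∈ CliffordAlgebra.evenOdd Q (l.length : ZMod 2) := by
  induction l with
  | nil => simpa [vecProd] using Submodule.one_le.mp (CliffordAlgebra.one_le_evenOdd_zero Q)
  | cons v l ih =>
    have h1 : vecProd Q (v :: l) = ι Q v * vecProd Q l := by simp [vecProd]
    rw [h1, List.length_cons, Nat.cast_add, Nat.cast_one, add_comm]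
    exact CliffordAlgebra.evenOdd_mul_le Q 1 _
      (Submodule.mul_mem_mul (CliffordAlgebra.ι_mem_evenOdd_one Q v) ih)

/-- The product of anisotropic vectors as a unit of the Clifford algebra. -/
def vecUnit (l : List V) (hl : ∀ v ∈ l, Q v ≠ 0) : (CliffordAlgebra Q)ˣ where
  val := vecProd Q l
  inv := (formProd Q l)⁻¹ • CliffordAlgebra.reverse (vecProd Q l)
  val_inv := by
    rw [mul_smul_comm, vecProd_mul_reverse, Algebra.smul_def, ← map_mul,
      inv_mul_cancel₀ (formProd_ne_zero Q hl), map_one]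
  inv_val := by
    rw [smul_mul_assoc, reverse_mul_vecProd, Algebra.smul_def, ← map_mul,
      inv_mul_cancel₀ (formProd_ne_zero Q hl), map_one]

theorem vecUnit_mem_GSpin (l : List V) (hl : ∀ v ∈ l, Q v ≠ 0) (he : Even l.length) :
    vecUnit Q l hl ∈ GSpin Q := by
  have h0 : (l.length : ZMod 2) = 0 := (ZMod.natCast_eq_zero_iff_even).mpr he
  have hmem := vecProd_mem_evenOdd Q l
  rw [h0] at hmem
  have hconj (x : V) : vecProd Q l * ι Q x = ι Q (reflProd Q l x) * vecProd Q l := by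
    rw [vecProd_mul_ι Q hl, he.neg_one_pow, one_smul]
  refine ⟨hmem, Submodule.smul_mem _ _
    ((CliffordAlgebra.reverse_mem_evenOdd_iff Q).mpr hmem), fun v => ⟨reflProd Q l v, ?_⟩,
    fun v => ?_⟩
  · rw [Units.mul_inv_eq_iff_eq_mul]
    exact hconj v
  · obtain ⟨x, hx⟩ := reflProd_surjective Q hl v
    refine ⟨x, ?_⟩
    rw [mul_assoc, Units.inv_mul_eq_iff_eq_mul, ← hx]
    exact (hconj x).symm

theorem rho_mul_ι [Invertible (2 : F)] (γ : GSpin Q) (x : V) :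
    ((γ : (CliffordAlgebra Q)ˣ) : CliffordAlgebra Q) * ι Q x =
      ι Q (rho Q γ x) * ((γ : (CliffordAlgebra Q)ˣ) : CliffordAlgebra Q) := by
  rw [iota_rho, mul_assoc, mul_assoc, Units.inv_mul, mul_one]

/-- Every product of an even number of reflections lifts to `GSpin`. -/
theorem exists_GSpin_of_reflProd [Invertible (2 : F)] (l : List V) (hl : ∀ v ∈ l, Q v ≠ 0)
    (he : Even l.length) :
    ∃ γ : GSpin Q, ((γ : (CliffordAlgebra Q)ˣ) : CliffordAlgebra Q) = vecProd Q l ∧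
      ∀ x, rho Q γ x = reflProd Q l x := by
  refine ⟨⟨vecUnit Q l hl, vecUnit_mem_GSpin Q l hl he⟩, rfl, fun x => iota_injective Q ?_⟩
  rw [iota_rho, Units.mul_inv_eq_iff_eq_mul]
  change vecProd Q l * _ = _ * vecProd Q l
  rw [vecProd_mul_ι Q hl, he.neg_one_pow, one_smul]

end VectorProducts

/-! ### The structure of `GSpin` and the spinor norm. -/

section Structure

variable {F V : Type*} [Field F] [CharZero F] [AddCommGroup V] [Module F V]
  [FiniteDimensional F V] (Q : QuadraticForm F V)

/-- Every element of `GSpin` is a scalar multiple of a product of an even number of vectors. -/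
theorem GSpin_structure (hQ : ∀ x, (∀ y, QuadraticMap.polar Q x y = 0) → x = 0) (γ : GSpin Q) :
    ∃ l : List V, (∀ v ∈ l, Q v ≠ 0) ∧ (∀ x, rho Q γ x = reflProd Q l x) ∧
      ∃ c : F, c ≠ 0 ∧
        ((γ : (CliffordAlgebra Q)ˣ) : CliffordAlgebra Q) = c • vecProd Q l := by
  obtain ⟨l, hl, hle⟩ := exists_reflProd_eq Q hQ (rho Q γ : V →ₗ[F] V) (form_rho Q γ)
  have hx (x : V) : rho Q γ x = reflProd Q l x := by rw [hle]; rfl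
  set g : (CliffordAlgebra Q)ˣ := (γ : (CliffordAlgebra Q)ˣ) with hg
  -- Conjugation by `g` and the chosen reflections have the same effect on `V`, so `u` commutes with
  -- vectors up to the sign `(-1)^length`. Since `g` is even, `u` has the parity of the length, and
  -- the sign is the one of the grading involution. Hence `u` is a scalar, whatever the parity.
  set u : (CliffordAlgebra Q)ˣ := g⁻¹ * vecUnit Q l hl with hu
  have hval : ((u : (CliffordAlgebra Q)ˣ) : CliffordAlgebra Q) =
    ((g⁻¹ : (CliffordAlgebra Q)ˣ) : CliffordAlgebra Q) * vecProd Q l := rfl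
  have hcomm (x : V) : (u : CliffordAlgebra Q) * ι Q x =
      (-1 : F) ^ l.length • (ι Q x * (u : CliffordAlgebra Q)) := by
    have h1 : ((g⁻¹ : (CliffordAlgebra Q)ˣ) : CliffordAlgebra Q) * ι Q (rho Q γ x) =
        ι Q x * ((g⁻¹ : (CliffordAlgebra Q)ˣ) : CliffordAlgebra Q) := by
      rw [Units.inv_mul_eq_iff_eq_mul, ← mul_assoc, rho_mul_ι, mul_assoc, Units.mul_inv, mul_one]
    rw [hval, mul_assoc, vecProd_mul_ι Q hl, mul_smul_comm, ← mul_assoc, ← hx, h1, mul_assoc]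
  have hpar : (u : CliffordAlgebra Q) ∈ CliffordAlgebra.evenOdd Q (l.length : ZMod 2) := by
    rw [hval]
    have := CliffordAlgebra.evenOdd_mul_le Q 0 (l.length : ZMod 2)
      (Submodule.mul_mem_mul γ.2.2.1 (vecProd_mem_evenOdd Q l))
    rwa [zero_add] at this
  have hinv : CliffordAlgebra.involute (u : CliffordAlgebra Q) =
      (-1 : F) ^ l.length • (u : CliffordAlgebra Q) := by
    rcases Nat.even_or_odd l.length with he | ho
    · rw [(ZMod.natCast_eq_zero_iff_even).mpr he] at hpar
      rw [CliffordAlgebra.involute_eq_of_mem_even hpar, he.neg_one_pow, one_smul]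
    · rw [(ZMod.natCast_eq_one_iff_odd).mpr ho] at hpar
      rw [CliffordAlgebra.involute_eq_of_mem_odd hpar, ho.neg_one_pow, neg_one_smul]
  obtain ⟨c, hc⟩ := clifford_scalar_of_twisted_comm Q hQ (u : CliffordAlgebra Q) fun x => by
    rw [hinv, smul_mul_assoc, hcomm, smul_smul, ← mul_pow, neg_one_mul, neg_neg, one_pow, one_smul]
  have hc0 : c ≠ 0 := by
    rintro rfl
    have : Nontrivial (CliffordAlgebra Q) := (algebraMap_clifford_injective Q).nontrivial
    rw [map_zero] at hc
    exact u.ne_zero hc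
  have hP : vecProd Q l = (g : CliffordAlgebra Q) * algebraMap F _ c := by
    rw [← hc, hval, ← mul_assoc, Units.mul_inv, one_mul]
  refine ⟨l, hl, hx, c⁻¹, inv_ne_zero hc0, ?_⟩
  rw [hP, ← Algebra.commutes, ← Algebra.smul_def, smul_smul, inv_mul_cancel₀ hc0, one_smul]

/-- Up to a square, the spinor norm is the product of the values of `Q` at the reflecting vectors.
Its signs at the real places can therefore be read off from `l`. -/
theorem reverse_mul_GSpin (hQ : ∀ x, (∀ y, QuadraticMap.polar Q x y = 0) → x = 0) (γ : GSpin Q) :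
    ∃ l : List V, (∀ v ∈ l, Q v ≠ 0) ∧ (∀ x, rho Q γ x = reflProd Q l x) ∧
      ∃ c : F, c ≠ 0 ∧ CliffordAlgebra.reverse ((γ : (CliffordAlgebra Q)ˣ) : CliffordAlgebra Q) *
        ((γ : (CliffordAlgebra Q)ˣ) : CliffordAlgebra Q) =
          algebraMap F (CliffordAlgebra Q) (c ^ 2 * formProd Q l) := by
  obtain ⟨l, hl, hx, c, hc, h⟩ := GSpin_structure Q hQ γ
  refine ⟨l, hl, hx, c, hc, ?_⟩
  rw [h, map_smul, smul_mul_smul_comm, reverse_mul_vecProd, Algebra.smul_def, ← map_mul, sq]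

end Structure

/-! ### Orthogonal families and projections. -/

section Hyperboloid

variable {F V : Type*} [Field F] [AddCommGroup V] [Module F V] (Q : QuadraticForm F V)

/-- An orthogonal family of anisotropic vectors. -/
structure OrthFamily {k : ℕ} (e : Fin k → V) : Prop where
  ortho : Pairwise fun i j => QuadraticMap.polar Q (e i) (e j) = 0
  ne_zero : ∀ i, Q (e i) ≠ 0

/-- The orthogonal projection to the span of an orthogonal family. -/
def orthProj {k : ℕ} (e : Fin k → V) : V →ₗ[F] V :=
  ∑ i, ((2 * Q (e i))⁻¹ • Q.polarBilin (e i)).smulRight (e i)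

variable {Q}

theorem orthProj_apply {k : ℕ} (e : Fin k → V) (x : V) : orthProj Q e x =
    ∑ i, ((2 * Q (e i))⁻¹ * QuadraticMap.polar Q (e i) x) • e i := by
  simp [orthProj]

theorem orthProj_mem {k : ℕ} (e : Fin k → V) (x : V) :
    orthProj Q e x ∈ Submodule.span F (Set.range e) := by
  rw [orthProj_apply]
  exact sum_mem fun i _ => Submodule.smul_mem _ _ (Submodule.subset_span ⟨i, rfl⟩)

theorem OrthFamily.polar_orthProj [NeZero (2 : F)] {k : ℕ} {e : Fin k → V} (he : OrthFamily Q e)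
    (i : Fin k) (x : V) :
    QuadraticMap.polar Q (e i) (orthProj Q e x) = QuadraticMap.polar Q (e i) x := by
  rw [orthProj_apply, ← QuadraticMap.polarBilin_apply_apply, map_sum, Finset.sum_eq_single i]
  · have := he.ne_zero i
    have := NeZero.ne (2 : F)
    simp only [map_smul, QuadraticMap.polarBilin_apply_apply, polar_self_eq, smul_eq_mul]
    field_simp
  · intro j _ hj
    simp [he.ortho hj.symm]
  · simp

theorem polar_eq_zero_of_mem_span {s : Set V} {x y : V}
    (h : ∀ w ∈ s, QuadraticMap.polar Q x w = 0) (hy : y ∈ Submodule.span F s) :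
    QuadraticMap.polar Q x y = 0 := by
  induction hy using Submodule.span_induction with
  | mem w hw => exact h w hw
  | zero => exact QuadraticMap.polar_zero_right Q x
  | add a b _ _ ha hb => rw [QuadraticMap.polar_add_right, ha, hb, add_zero]
  | smul c a _ ha => rw [QuadraticMap.polar_smul_right, ha, smul_zero]

theorem OrthFamily.polar_sub_orthProj [NeZero (2 : F)] {k : ℕ} {e : Fin k → V}
    (he : OrthFamily Q e) (x : V) {w : V} (hw : w ∈ Submodule.span F (Set.range e)) :
    QuadraticMap.polar Q (x - orthProj Q e x) w = 0 := by
  refine polar_eq_zero_of_mem_span ?_ hw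
  rintro _ ⟨i, rfl⟩
  rw [QuadraticMap.polar_comm, QuadraticMap.polar_sub_right, he.polar_orthProj, sub_self]

theorem OrthFamily.exists_polar_ne_zero [NeZero (2 : F)] {k : ℕ} {e : Fin k → V}
    (he : OrthFamily Q e) (hQ : ∀ x, (∀ y, QuadraticMap.polar Q x y = 0) → x = 0)
    {u : V} (hu : u ∉ Submodule.span F (Set.range e)) :
    ∃ y, (∀ w ∈ Submodule.span F (Set.range e), QuadraticMap.polar Q y w = 0) ∧
      QuadraticMap.polar Q y u ≠ 0 := by
  by_contra! H
  refine hu ?_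
  -- The pairing of `u - Pu` with `y` equals that of `u` with `y - Py`, which vanishes by assumption
  -- because `y - Py` is orthogonal to the span.
  have h0 : u - orthProj Q e u = 0 := hQ _ fun y => by
    have h1 := H (y - orthProj Q e y) fun w hw => he.polar_sub_orthProj y hw
    have h2 := he.polar_sub_orthProj u (orthProj_mem (Q := Q) e y)
    have h3 := he.polar_sub_orthProj y (orthProj_mem (Q := Q) e u)
    rw [QuadraticMap.polar_comm, QuadraticMap.polar_sub_right] at h1 h2
    rw [QuadraticMap.polar_comm, QuadraticMap.polar_sub_right] at h3
    rw [QuadraticMap.polar_comm, QuadraticMap.polar_sub_right]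
    rw [QuadraticMap.polar_comm Q u y, QuadraticMap.polar_comm Q u] at h1
    rw [QuadraticMap.polar_comm Q (orthProj Q e u) y,
      QuadraticMap.polar_comm Q (orthProj Q e u) (orthProj Q e y)] at h3
    linear_combination h1 - h3 + h2
  rw [sub_eq_zero.mp h0]
  exact orthProj_mem e u

/-- If the orthogonal complement were totally isotropic, polarization would make it orthogonal to
itself, and then to every `u = Pu + (u - Pu)`, contrary to non-degeneracy. -/
theorem OrthFamily.exists_anisotropic [NeZero (2 : F)] {k : ℕ} {e : Fin k → V}
    (he : OrthFamily Q e) (hQ : ∀ x, (∀ y, QuadraticMap.polar Q x y = 0) → x = 0)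
    (hne : Submodule.span F (Set.range e) ≠ ⊤) :
    ∃ y, (∀ w ∈ Submodule.span F (Set.range e), QuadraticMap.polar Q y w = 0) ∧ Q y ≠ 0 := by
  obtain ⟨u, -, hu⟩ := SetLike.exists_of_lt hne.lt_top
  obtain ⟨y, hy, hyu⟩ := he.exists_polar_ne_zero hQ hu
  by_contra! H
  have hp : QuadraticMap.polar Q y (u - orthProj Q e u) = 0 := by
    have hw (w) (hw : w ∈ Submodule.span F (Set.range e)) := he.polar_sub_orthProj u hw
    rw [QuadraticMap.polar, H _ hy, H _ hw, H]
    · simp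
    · intro w hw'
      rw [QuadraticMap.polar_add_left, hy w hw', hw w hw', add_zero]
  rw [QuadraticMap.polar_sub_right, hy _ (orthProj_mem e u), sub_zero] at hp
  exact hyu hp

end Hyperboloid


/-! ### Tuples with a totally positive Gram matrix and the action of `GSpin(V)` on them. -/

section PositiveTuples

variable {F V : Type*} [Field F] [CharZero F] [AddCommGroup V] [Module F V]
  {Q : QuadraticForm F V} {n : ℕ} {T : Matrix (Fin n) (Fin n) F}

omit [CharZero F] in
theorem hyperboloid_symm_two {x : Fin n → V} (hx : x ∈ hyperboloid Q T) (i j : Fin n) :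
    2 * T i j = 2 * T j i := by
  rw [← hx, ← hx, QuadraticMap.polar_comm]

omit [CharZero F] in
theorem polar_linearCombination {x : Fin n → V} (hx : x ∈ hyperboloid Q T) (c d : Fin n → F) :
    QuadraticMap.polar Q (Fintype.linearCombination F x c) (Fintype.linearCombination F x d) =
      2 * (c ⬝ᵥ T.mulVec d) := by
  simp only [Fintype.linearCombination_apply, ← QuadraticMap.polarBilin_apply_apply, map_sum,
    map_smul, LinearMap.sum_apply, LinearMap.smul_apply]
  simp only [QuadraticMap.polarBilin_apply_apply, dotProduct, Matrix.mulVec, Finset.mul_sum,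
    smul_eq_mul]
  rw [Finset.sum_comm]
  refine Finset.sum_congr rfl fun i _ => Finset.sum_congr rfl fun j _ => ?_
  rw [hx i j]
  ring

omit [CharZero F] in
theorem map_dotProduct_mulVec_pos {σ : F →+* ℝ} (hT : (T.map σ).PosDef) {c : Fin n → F}
    (hc : c ≠ 0) : 0 < σ (c ⬝ᵥ T.mulVec c) := by
  have h0 : (σ ∘ c) ≠ 0 := fun h => hc (funext fun i => by simpa using congrFun h i)
  have h := hT.dotProduct_mulVec_pos h0
  have h1 : σ (c ⬝ᵥ T.mulVec c) = star (σ ∘ c) ⬝ᵥ (T.map σ).mulVec (σ ∘ c) := by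
    simp [dotProduct, Matrix.mulVec]
  rwa [h1]

/-- A base change that makes all tuples with Gram matrix `2 T` orthogonal. -/
theorem exists_orthogonalizing_basis [Nonempty (F →+* ℝ)]
    (hT : ∀ σ : F →+* ℝ, (T.map σ).PosDef) (hs : ∀ i j, T i j = T j i)
    (Q : QuadraticForm F V) :
    ∃ (b : Module.Basis (Fin n) F (Fin n → F)) (d : Fin n → F), (∀ σ : F →+* ℝ, ∀ j, 0 < σ (d j)) ∧
      ∀ x : Fin n → V, x ∈ hyperboloid Q T →
        OrthFamily Q (fun j => Fintype.linearCombination F x (b j)) ∧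
        ∀ j, Q (Fintype.linearCombination F x (b j)) = d j := by
  have hB : ∀ c d : Fin n → F, Matrix.toBilin' T c d = c ⬝ᵥ T.mulVec d := fun c d => by
    rw [Matrix.toBilin'_apply']
  -- The form `T` on `F^n` is diagonalized, not the individual tuples, so that one basis `b` works
  -- for all `x` at the same time and the resulting lengths agree.
  obtain ⟨b, hb⟩ := LinearMap.BilinForm.exists_orthogonal_basis (B := Matrix.toBilin' T)
    ⟨fun c d => by
      have hTt : T.transpose = T := Matrix.ext fun i j => hs j i
      rw [hB, hB, RingHom.id_apply, Matrix.dotProduct_mulVec, ← Matrix.mulVec_transpose, hTt,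
        dotProduct_comm]⟩
  have hfr : Module.finrank F (Fin n → F) = n := by simp
  set b' := b.reindex (finCongr hfr) with hb'
  have hd (σ : F →+* ℝ) (j) : 0 < σ (b' j ⬝ᵥ T.mulVec (b' j)) :=
    map_dotProduct_mulVec_pos (hT σ) (b'.ne_zero j)
  have hQ {x : Fin n → V} (hx : x ∈ hyperboloid Q T) (j) : Q (Fintype.linearCombination F x (b' j)) =
        b' j ⬝ᵥ T.mulVec (b' j) := by
    have h := polar_linearCombination hx (b' j) (b' j)
    rw [polar_self_eq] at h
    exact mul_left_cancel₀ two_ne_zero h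
  refine ⟨b', fun j => b' j ⬝ᵥ T.mulVec (b' j), hd, fun x hx => ⟨⟨fun i j hij => ?_, fun i h => ?_⟩,
    hQ hx⟩⟩
  · change QuadraticMap.polar Q (Fintype.linearCombination F x (b' i))
      (Fintype.linearCombination F x (b' j)) = 0
    rw [polar_linearCombination hx, ← hB]
    have hij' : (finCongr hfr).symm i ≠ (finCongr hfr).symm j := by simpa using hij
    have := hb hij'
    rw [hb', Module.Basis.reindex_apply, Module.Basis.reindex_apply]
    exact mul_eq_zero_of_right _ this
  · obtain ⟨σ⟩ := ‹Nonempty (F →+* ℝ)›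
    have h1 := hd σ i
    rw [← hQ hx, h, map_zero] at h1
    exact lt_irrefl _ h1

omit [CharZero F] in
theorem span_linearCombination_basis (b : Module.Basis (Fin n) F (Fin n → F)) (x : Fin n → V) :
    Submodule.span F (Set.range fun j => Fintype.linearCombination F x (b j)) =
      Submodule.span F (Set.range x) := by
  have : (Set.range fun j => Fintype.linearCombination F x (b j)) =
      Fintype.linearCombination F x '' Set.range b := by
    rw [← Set.range_comp]; rfl
  rw [this, Submodule.span_image, b.span_eq, Submodule.map_top, Fintype.range_linearCombination]

/-- Every totally positive tuple spans the same space as an orthogonal tuple. -/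
theorem exists_orthFamily_of_hyperboloid [Nonempty (F →+* ℝ)]
    (hT : ∀ σ : F →+* ℝ, (T.map σ).PosDef) {x : Fin n → V} (hx : x ∈ hyperboloid Q T) :
    ∃ e : Fin n → V, OrthFamily Q e ∧ (∀ σ : F →+* ℝ, ∀ j, 0 < σ (Q (e j))) ∧
      Submodule.span F (Set.range e) = Submodule.span F (Set.range x) := by
  obtain ⟨b, d, hd, h⟩ := exists_orthogonalizing_basis hT (fun i j =>
    mul_left_cancel₀ two_ne_zero (hyperboloid_symm_two hx i j)) Q
  obtain ⟨h1, h2⟩ := h x hx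
  exact ⟨_, h1, fun σ j => by rw [h2]; exact hd σ j, span_linearCombination_basis b x⟩

/-- `GSpin(V)` acts transitively on the tuples with Gram matrix `2 T`. -/
theorem exists_GSpin_hyperboloid [Nonempty (F →+* ℝ)] [FiniteDimensional F V]
    (hQ : ∀ x, (∀ y, QuadraticMap.polar Q x y = 0) → x = 0)
    (hT : ∀ σ : F →+* ℝ, (T.map σ).PosDef) (hn : n < Module.finrank F V)
    {x y : Fin n → V} (hx : x ∈ hyperboloid Q T) (hy : y ∈ hyperboloid Q T) :
    ∃ γ : GSpin Q, ∀ i, rho Q γ (x i) = y i := by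
  obtain ⟨b, d, hd, h⟩ := exists_orthogonalizing_basis hT (fun i j =>
    mul_left_cancel₀ two_ne_zero (hyperboloid_symm_two hx i j)) Q
  obtain ⟨h1, h2⟩ := h x hx
  obtain ⟨h3, h4⟩ := h y hy
  obtain ⟨l, hl, hle⟩ := exists_reflProd_orthogonal Q _ _ h1.ortho h3.ortho h3.ne_zero
    fun i => (h2 i).trans (h4 i).symm
  have key : reflProd Q l ∘ₗ Fintype.linearCombination F x = Fintype.linearCombination F y :=
    b.ext hle
  have hxy (i) : reflProd Q l (x i) = y i := by
    have := LinearMap.congr_fun key (Pi.single i 1)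
    simpa [Fintype.linearCombination_apply_single] using this
  rcases Nat.even_or_odd l.length with he | ho
  · obtain ⟨γ, -, hγ⟩ := exists_GSpin_of_reflProd Q l hl he
    exact ⟨γ, fun i => by rw [hγ, hxy]⟩
  -- An odd number of reflections is corrected by one more, in an anisotropic vector orthogonal to
  -- all `y i`. It exists because `n` vectors do not span `V`.
  · have hne : Submodule.span F (Set.range fun j => Fintype.linearCombination F y (b j)) ≠ ⊤ := by
      intro htop
      have := finrank_range_le_card (R := F) (fun j => Fintype.linearCombination F y (b j))
      rw [Set.finrank, htop, finrank_top, Fintype.card_fin] at this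
      omega
    obtain ⟨v, hv, hv0⟩ := h3.exists_anisotropic hQ hne
    obtain ⟨γ, -, hγ⟩ := exists_GSpin_of_reflProd Q (v :: l)
      (by
        intro w hw
        rcases List.mem_cons.mp hw with rfl | hw
        exacts [hv0, hl w hw])
      (by rw [List.length_cons]; exact ho.add_one)
    refine ⟨γ, fun i => ?_⟩
    rw [hγ, reflProd_cons, hxy, refl_of_polar_eq_zero]
    refine hv _ ?_
    rw [span_linearCombination_basis]
    exact Submodule.subset_span ⟨i, rfl⟩

end PositiveTuples


/-! ### Negative frames and their Gram determinants. -/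

section NegPlanes

variable {k E : Type*} [Field k] [LinearOrder k] [IsStrictOrderedRing k] [AddCommGroup E]
  [Module k E] (q : QuadraticForm k E)

/-- The matrix of products of two pairs of vectors. -/
def gram (v w : Fin 2 → E) : Matrix (Fin 2) (Fin 2) k :=
  Matrix.of fun i j => QuadraticMap.polar q (v i) (w j)

/-- The pair of linear combinations of a pair of vectors given by a matrix. -/
def matAct (A : Matrix (Fin 2) (Fin 2) k) (v : Fin 2 → E) : Fin 2 → E := fun i => ∑ j, A i j • v j

omit [LinearOrder k] [IsStrictOrderedRing k] in
theorem gram_matAct (A : Matrix (Fin 2) (Fin 2) k) (v w : Fin 2 → E) :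
    gram q (matAct A v) w = A * gram q v w := by
  ext i j
  simp [gram, matAct, Matrix.mul_apply, QuadraticMap.polar_add_left]

omit [LinearOrder k] [IsStrictOrderedRing k] in
theorem gram_transpose (v w : Fin 2 → E) : (gram q v w).transpose = gram q w v := by
  ext i j
  exact QuadraticMap.polar_comm q _ _

omit [LinearOrder k] [IsStrictOrderedRing k] in
theorem det_gram_comm (v w : Fin 2 → E) : (gram q v w).det = (gram q w v).det := by
  rw [← gram_transpose, Matrix.det_transpose]

omit [LinearOrder k] [IsStrictOrderedRing k] in
theorem gram_map (f : E →ₗ[k] E) (hf : ∀ x, q (f x) = q x) (v w : Fin 2 → E) :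
    gram q (fun i => f (v i)) (fun i => f (w i)) = gram q v w := by
  ext i j
  exact polar_of_form_eq q hf _ _

/-- `v` is a basis of a negative definite plane. -/
def IsNegFrame (v : Fin 2 → E) : Prop := ∀ c : Fin 2 → k, c ≠ 0 → q (∑ i, c i • v i) < 0

omit [LinearOrder k] [IsStrictOrderedRing k] in
theorem form_sum_two (c : Fin 2 → k) (v : Fin 2 → E) : q (∑ i, c i • v i) =
    c 0 ^ 2 * q (v 0) + c 1 ^ 2 * q (v 1) + c 0 * c 1 * QuadraticMap.polar q (v 0) (v 1) := by
  rw [Fin.sum_univ_two, form_add, QuadraticMap.map_smul, QuadraticMap.map_smul,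
    QuadraticMap.polar_smul_left, QuadraticMap.polar_smul_right]
  simp only [smul_eq_mul]
  ring

omit [LinearOrder k] [IsStrictOrderedRing k] in
theorem det_gram_self (v : Fin 2 → E) : (gram q v v).det =
    4 * q (v 0) * q (v 1) - QuadraticMap.polar q (v 0) (v 1) ^ 2 := by
  simp only [Matrix.det_fin_two, gram, Matrix.of_apply, polar_self_eq,
    QuadraticMap.polar_comm q (v 1) (v 0)]
  ring

theorem isNegFrame_iff (v : Fin 2 → E) : IsNegFrame q v ↔ q (v 0) < 0 ∧ 0 < (gram q v v).det := by
  rw [det_gram_self]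
  constructor
  · intro h
    have h0 : q (v 0) < 0 := by
      have := h ![1, 0] (fun h => by simpa using congrFun h 0)
      rw [form_sum_two] at this
      simpa using this
    refine ⟨h0, ?_⟩
    -- This combination is orthogonal to `v 0`, and its value is `q(v 0)` times the determinant.
    have h1 := h ![-QuadraticMap.polar q (v 0) (v 1), 2 * q (v 0)] (fun h => by
      have := congrFun h 1
      simp [h0.ne] at this)
    rw [form_sum_two] at h1
    simp only [Matrix.cons_val_zero, Matrix.cons_val_one] at h1
    by_contra hcon
    nlinarith [mul_nonneg_of_nonpos_of_nonpos h0.le (not_lt.mp hcon)]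
  · rintro ⟨h0, h1⟩ c hc
    rw [form_sum_two]
    by_contra! hcon
    have h2 := mul_nonpos_of_nonpos_of_nonneg h0.le hcon
    -- Completing the square: the left side is `4 q(v 0)` times the value of `q` at the combination.
    have h3 : (2 * c 0 * q (v 0) + c 1 * QuadraticMap.polar q (v 0) (v 1)) ^ 2 +
        c 1 ^ 2 * (4 * q (v 0) * q (v 1) - QuadraticMap.polar q (v 0) (v 1) ^ 2) ≤ 0 := by
      nlinarith
    have h4 : c 1 = 0 := by
      by_contra h
      have := mul_pos (pow_pos (abs_pos.mpr h) 2) h1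
      rw [sq_abs] at this
      nlinarith [sq_nonneg (2 * c 0 * q (v 0) + c 1 * QuadraticMap.polar q (v 0) (v 1))]
    rw [h4] at h3
    have h5 : c 0 = 0 := by
      have h6 : (2 * c 0 * q (v 0)) ^ 2 ≤ 0 := by nlinarith
      have h7 := pow_eq_zero_iff (two_ne_zero) |>.mp (le_antisymm h6 (sq_nonneg _))
      simpa [h0.ne] using h7
    exact hc (funext fun i => by fin_cases i <;> simp [h4, h5])

/-- The orthogonal complement of every negative definite plane is positive definite. -/
def NegIndexTwo : Prop := ∀ v, IsNegFrame q v → ∀ y, y ≠ 0 →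
  (∀ i, QuadraticMap.polar q (v i) y = 0) → 0 < q y

variable {q}

omit [LinearOrder k] [IsStrictOrderedRing k] in
theorem polar_sum_left {s : Fin 2 → E} {y : E} (c : Fin 2 → k) :
    QuadraticMap.polar q (∑ i, c i • s i) y = ∑ i, c i * QuadraticMap.polar q (s i) y := by
  simp [QuadraticMap.polar_add_left]

omit [IsStrictOrderedRing k] in
-- A degenerate Gram matrix gives a non-zero vector of the first plane orthogonal to the second,
-- which would be both negative and positive.
theorem NegIndexTwo.det_gram_ne_zero (hq : NegIndexTwo q) {v w : Fin 2 → E} (hv : IsNegFrame q v)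
    (hw : IsNegFrame q w) : (gram q v w).det ≠ 0 := by
  intro h
  obtain ⟨c, hc, hcv⟩ := Matrix.exists_vecMul_eq_zero_iff.mpr h
  have h1 := hv c hc
  refine lt_asymm h1 (hq w hw _ (fun h0 => ?_) fun j => ?_)
  · rw [h0, QuadraticMap.map_zero] at h1
    exact lt_irrefl _ h1
  · rw [QuadraticMap.polar_comm, polar_sum_left]
    exact congrFun hcv j

omit [LinearOrder k] [IsStrictOrderedRing k] in
theorem matAct_perp (A : Matrix (Fin 2) (Fin 2) k) {v : Fin 2 → E} {y : E}
    (h : ∀ i, QuadraticMap.polar q (v i) y = 0) (i : Fin 2) :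
    QuadraticMap.polar q (matAct A v i) y = 0 := by
  simp only [matAct, polar_sum_left, h, mul_zero, Finset.sum_const_zero]

omit [IsStrictOrderedRing k] in
theorem IsNegFrame.matAct {v : Fin 2 → E} (hv : IsNegFrame q v) {A : Matrix (Fin 2) (Fin 2) k}
    (hA : A.det ≠ 0) : IsNegFrame q (matAct A v) := by
  intro c hc
  have : ∑ i, c i • OrthShimura.matAct A v i = ∑ j, (Matrix.vecMul c A) j • v j := by
    simp only [OrthShimura.matAct, Finset.smul_sum, smul_smul, Matrix.vecMul, dotProduct,
      Finset.sum_smul]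
    exact Finset.sum_comm
  rw [this]
  refine hv _ fun h => hA ?_
  exact Matrix.exists_vecMul_eq_zero_iff.mp ⟨c, hc, h⟩

/-- A negative frame on the same side as `v` is equivalent to one whose projection to the plane of
`v` is `v`. -/
theorem NegIndexTwo.exists_adapted (hq : NegIndexTwo q) {v w : Fin 2 → E} (hv : IsNegFrame q v)
    (hw : IsNegFrame q w) (h : 0 < (gram q v w).det) :
    ∃ B : Matrix (Fin 2) (Fin 2) k, 0 < B.det ∧
      ∀ t : k, 0 ≤ t → t ≤ 1 → IsNegFrame q (fun i => v i + t • (matAct B w i - v i)) := by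
  have hM : IsUnit (gram q w v).det := by
    rw [det_gram_comm]
    exact isUnit_iff_ne_zero.mpr h.ne'
  -- The choice makes `Bw` and `v` have the same products with `v`, so that `Bw - v` is orthogonal
  -- to the plane of `v`.
  set B := gram q v v * (gram q w v)⁻¹ with hB
  have hBM : gram q (matAct B w) v = gram q v v := by
    rw [gram_matAct, hB, Matrix.mul_assoc, Matrix.nonsing_inv_mul _ hM, Matrix.mul_one]
  have hdet : 0 < B.det := by
    rw [hB, Matrix.det_mul, Matrix.det_nonsing_inv, Ring.inverse_eq_inv', det_gram_comm q w v]
    exact mul_pos ((isNegFrame_iff q v).mp hv).2 (inv_pos.mpr h)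
  refine ⟨B, hdet, fun t ht ht' c hc => ?_⟩
  set L : Fin 2 → E := fun i => matAct B w i - v i with hL
  have hLv (i j) : QuadraticMap.polar q (v j) (L i) = 0 := by
    have := congrFun (congrFun hBM i) j
    simp only [gram, Matrix.of_apply] at this
    rw [QuadraticMap.polar_comm, hL, QuadraticMap.polar_sub_left, this, sub_self]
  set x := ∑ i, c i • v i with hx
  set y := ∑ i, c i • L i with hy
  have hvy (i) : QuadraticMap.polar q (v i) y = 0 := by
    rw [QuadraticMap.polar_comm, hy, polar_sum_left]
    exact Finset.sum_eq_zero fun j _ => by rw [QuadraticMap.polar_comm, hLv, mul_zero]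
  have hxy : QuadraticMap.polar q x y = 0 := by
    rw [hx, polar_sum_left]
    exact Finset.sum_eq_zero fun j _ => by rw [hvy, mul_zero]
  -- By orthogonality the value along the segment is `q(x) + t² q(y)` with `q(y) ≥ 0`. It is largest
  -- at `t = 1`, where the frame is `Bw` and hence negative.
  have hsum (t : k) : q (∑ i, c i • (v i + t • L i)) = q x + t ^ 2 * q y := by
    have : ∑ i, c i • (v i + t • L i) = x + t • y := by
      simp only [hx, hy, smul_add, Finset.sum_add_distrib, Finset.smul_sum, smul_comm t]
    rw [this, form_add, QuadraticMap.map_smul, QuadraticMap.polar_smul_right, hxy]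
    simp only [smul_eq_mul]
    ring
  have hy0 : 0 ≤ q y := by
    rcases eq_or_ne y 0 with h0 | h0
    · rw [h0, QuadraticMap.map_zero]
    · exact (hq v hv y h0 hvy).le
  have h1 : q x + q y < 0 := by
    have h2 := (hw.matAct hdet.ne') c hc
    have h3 := hsum 1
    simp only [one_smul, hL, add_sub_cancel, one_pow, one_mul] at h3
    rwa [h3] at h2
  change q (∑ i, c i • (v i + t • L i)) < 0
  rw [hsum]
  nlinarith [mul_nonneg ht (sub_nonneg.mpr ht')]

/-- The sign of the effect of a reflection on the orientation of negative planes. -/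
theorem NegIndexTwo.det_gram_refl (hq : NegIndexTwo q) {v : Fin 2 → E} (hv : IsNegFrame q v)
    {a : E} (ha : q a ≠ 0) : 0 < (gram q v (fun i => refl q a (v i))).det * q a := by
  have hD := ((isNegFrame_iff q v).mp hv).2
  set p : Fin 2 → k := fun i => QuadraticMap.polar q (v i) a with hp
  set c : Fin 2 → k := Matrix.mulVec (gram q v v)⁻¹ p with hc
  have hcp : Matrix.mulVec (gram q v v) c = p := by
    rw [hc, Matrix.mulVec_mulVec, Matrix.mul_nonsing_inv _ (isUnit_iff_ne_zero.mpr hD.ne'),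
      Matrix.one_mulVec]
  -- The vector `x` is the orthogonal projection of `a` to the plane of `v`. The complement `a - x`
  -- contributes positively and `x` negatively.
  set x := ∑ i, c i • v i with hx
  have hxv (i) : QuadraticMap.polar q (v i) x = p i := by
    rw [QuadraticMap.polar_comm, hx, polar_sum_left, ← hcp]
    simp only [Matrix.mulVec, dotProduct, gram, Matrix.of_apply]
    exact Finset.sum_congr rfl fun j _ => by rw [QuadraticMap.polar_comm, mul_comm]
  have hperp (i) : QuadraticMap.polar q (v i) (a - x) = 0 := by
    rw [QuadraticMap.polar_sub_right, hxv, sub_self]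
  have h1 : 0 ≤ q (a - x) := by
    rcases eq_or_ne (a - x) 0 with h0 | h0
    · rw [h0, QuadraticMap.map_zero]
    · exact (hq v hv _ h0 hperp).le
  have h2 : q x ≤ 0 := by
    rcases eq_or_ne c 0 with h0 | h0
    · simp [hx, h0]
    · exact (hv c h0).le
  have hpx : QuadraticMap.polar q x (a - x) = 0 := by
    rw [hx, polar_sum_left]
    exact Finset.sum_eq_zero fun i _ => by rw [hperp, mul_zero]
  have h3 : q a = q x + q (a - x) := by
    rw [← add_zero (q x + q (a - x)), ← hpx, ← form_add, add_sub_cancel]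
  have h4 : 0 < q (a - x) - q x := by
    rcases h2.lt_or_eq with h | h
    · linarith
    · rcases h1.lt_or_eq with h' | h'
      · linarith
      · exact absurd (by rw [h3, h, ← h', add_zero]) ha
  -- The mixed Gram matrix is `G - q(a)⁻¹ p pᵀ`, a perturbation of rank one of `G = gram q v v`. Its
  -- determinant involves `pᵀ adj(G) p = 2 q(x) det G`, and `q(a) = q(x) + q(a - x)`.
  have h5 : (gram q v (fun i => refl q a (v i))).det * q a =
      (gram q v v).det * (q (a - x) - q x) := by
    have hG (i) : gram q v v i 0 * c 0 + gram q v v i 1 * c 1 = p i := by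
      rw [← hcp]; simp [Matrix.mulVec, dotProduct]
    have hqx : 2 * q x = c 0 * p 0 + c 1 * p 1 := by
      rw [← polar_self_eq]
      conv_lhs => rw [hx, polar_sum_left]
      simp [← hx, hxv]
    have hR (i j) : gram q v (fun i => refl q a (v i)) i j = gram q v v i j -
        (q a)⁻¹ * p j * p i := by
      simp only [gram, Matrix.of_apply, refl_apply, QuadraticMap.polar_sub_right,
        QuadraticMap.polar_smul_right, smul_eq_mul, hp]
      rw [QuadraticMap.polar_comm q a]
    have hs : gram q v v 1 0 = gram q v v 0 1 := by
      simp only [gram, Matrix.of_apply]; rw [QuadraticMap.polar_comm]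
    have e0 := hG 0
    have e1 := hG 1
    rw [hs] at e1
    have h6 : (gram q v (fun i => refl q a (v i))).det * q a = (gram q v v).det * q a -
        (gram q v v 0 0 * p 1 ^ 2 - 2 * gram q v v 0 1 * p 0 * p 1 +
          gram q v v 1 1 * p 0 ^ 2) := by
      simp only [Matrix.det_fin_two, hR, hs]
      field_simp
      ring
    rw [h6, h3, Matrix.det_fin_two, hs]
    have h7 : gram q v v 0 0 * p 1 ^ 2 - 2 * gram q v v 0 1 * p 0 * p 1 +
        gram q v v 1 1 * p 0 ^ 2 =
        (gram q v v 0 0 * gram q v v 1 1 - gram q v v 0 1 * gram q v v 0 1) * (2 * q x) := by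
      rw [hqx, ← e0, ← e1]
      ring
    rw [h7]
    ring
  rw [h5]
  exact mul_pos hD h4

end NegPlanes


set_option linter.unusedSectionVars false

/-! ### Continuity of quadratic forms and Gram determinants. -/

section Continuity

variable {k E : Type*} [Field k] [TopologicalSpace k] [IsTopologicalRing k] [AddCommGroup E]
  [Module k E] [TopologicalSpace E] [IsModuleTopology k E] [Module.Finite k E]
  (q : QuadraticForm k E)

theorem continuous_polar {X : Type*} [TopologicalSpace X] {f g : X → E} (hf : Continuous f)
    (hg : Continuous g) : Continuous fun x => QuadraticMap.polar q (f x) (g x) :=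
  (IsModuleTopology.continuous_bilinear_of_finite_left q.polarBilin).comp (hf.prodMk hg)

theorem continuous_form [NeZero (2 : k)] : Continuous q := by
  have h : Continuous fun x : E => (2 : k)⁻¹ * QuadraticMap.polar q x x :=
    continuous_const.mul (continuous_polar q continuous_id continuous_id)
  refine h.congr fun x => ?_
  rw [polar_self_eq, inv_mul_cancel_left₀ (NeZero.ne 2)]

theorem continuous_det_gram {X : Type*} [TopologicalSpace X] {f g : X → Fin 2 → E}
    (hf : Continuous f) (hg : Continuous g) : Continuous fun x => (gram q (f x) (g x)).det := by
  have h (i j : Fin 2) : Continuous fun x => QuadraticMap.polar q (f x i) (g x j) :=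
    continuous_polar q ((continuous_apply i).comp hf) ((continuous_apply j).comp hg)
  simp only [Matrix.det_fin_two, gram, Matrix.of_apply]
  exact ((h 0 0).mul (h 1 1)).sub ((h 0 1).mul (h 1 0))

end Continuity

/-! ### The intermediate value argument on the unit interval. -/

section Interval

variable {k : Type*} [Field k] [LinearOrder k] [IsStrictOrderedRing k] [TopologicalSpace k]
  [OrderTopology k] [PreconnectedSpace k]

/-- The interval is the continuous image of the whole ordered field under clamping, so
preconnectedness of the field suffices. -/
theorem isPreconnected_unitInterval : IsPreconnected (Set.Icc (0 : k) 1) := by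
  have h : Set.Icc (0 : k) 1 = Set.range fun x : k => max 0 (min x 1) := by
    ext x
    constructor
    · rintro ⟨h0, h1⟩
      exact ⟨x, by simp [h0, h1]⟩
    · rintro ⟨y, rfl⟩
      exact ⟨le_max_left _ _, max_le zero_le_one (min_le_right _ _)⟩
  rw [h]
  exact isPreconnected_range (continuous_const.max (continuous_id.min continuous_const))

theorem pos_of_continuous_ne_zero {f : k → k} (hf : Continuous f)
    (h : ∀ t, 0 ≤ t → t ≤ 1 → f t ≠ 0) (h0 : 0 < f 0) : 0 < f 1 := by
  by_contra! h1
  obtain ⟨t, ht, hft⟩ := isPreconnected_unitInterval.intermediate_value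
    (Set.right_mem_Icc.mpr zero_le_one) (Set.left_mem_Icc.mpr zero_le_one) hf.continuousOn
    ⟨h1, h0.le⟩
  exact h t ht.1 ht.2 hft

end Interval

/-! ### The two sides of the space of oriented negative planes. -/

section Sides

variable {k E : Type*} [Field k] [LinearOrder k] [IsStrictOrderedRing k] [AddCommGroup E]
  [Module k E] {q : QuadraticForm k E}

/-- The oriented plane spanned by a negative frame. -/
abbrev orPlane (v : NegFrame q) : OrientedNegPlane q := Quotient.mk (negFrameSetoid q) v

theorem orPlane_eq_iff {v w : NegFrame q} : orPlane v = orPlane w ↔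
    ∃ A : Matrix (Fin 2) (Fin 2) k, 0 < A.det ∧ w.1 = matAct A v.1 :=
  ⟨fun h => let ⟨A, hA, h'⟩ := Quotient.exact h; ⟨A, hA, funext h'⟩,
    fun ⟨A, hA, h⟩ => Quotient.sound ⟨A, hA, fun i => congrFun h i⟩⟩

theorem orPlane_matAct (v : NegFrame q) {A : Matrix (Fin 2) (Fin 2) k} (hA : 0 < A.det) :
    orPlane (⟨matAct A v.1, IsNegFrame.matAct v.2 hA.ne'⟩ : NegFrame q) = orPlane v :=
  (orPlane_eq_iff.mpr ⟨A, hA, rfl⟩).symm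

/-- Two oriented negative planes have compatible orientations. -/
def SameSide (z w : OrientedNegPlane q) : Prop :=
  ∃ v v' : NegFrame q, orPlane v = z ∧ orPlane v' = w ∧ 0 < (gram q v.1 v'.1).det

/-- A change of oriented bases multiplies the Gram determinant by two positive determinants. -/
theorem sameSide_mk {v w : NegFrame q} :
    SameSide (orPlane v) (orPlane w) ↔ 0 < (gram q v.1 w.1).det := by
  refine ⟨?_, fun h => ⟨v, w, rfl, rfl, h⟩⟩
  rintro ⟨v', w', hv, hw, h⟩
  obtain ⟨A, hA, hv⟩ := orPlane_eq_iff.mp hv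
  obtain ⟨B, hB, hw⟩ := orPlane_eq_iff.mp hw
  rw [hv, hw, gram_matAct, Matrix.det_mul, det_gram_comm, gram_matAct, Matrix.det_mul,
    det_gram_comm]
  positivity

theorem perp_mk {v : NegFrame q} {s : Set E} : OrientedNegPlane.Perp (orPlane v) s ↔
    ∀ i, ∀ w ∈ s, QuadraticMap.polar q (v.1 i) w = 0 := by
  refine ⟨?_, fun h => ⟨v, rfl, h⟩⟩
  rintro ⟨v', hv, h⟩ i w hw
  obtain ⟨A, hA, hv⟩ := orPlane_eq_iff.mp hv
  rw [hv]
  exact matAct_perp A (fun j => h j w hw) i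

theorem SameSide.refl (z : OrientedNegPlane q) : SameSide z z := by
  induction z using Quotient.inductionOn with
  | _ v => exact sameSide_mk.mpr ((isNegFrame_iff q _).mp v.2).2

theorem SameSide.symm {z w : OrientedNegPlane q} (h : SameSide z w) : SameSide w z := by
  obtain ⟨v, v', rfl, rfl, h⟩ := h
  exact sameSide_mk.mpr (by rwa [det_gram_comm])

theorem sameSide_map {f : E →ₗ[k] E} (hf : ∀ x, q (f x) = q x) {z w : OrientedNegPlane q} :
    SameSide (z.map f hf) (w.map f hf) ↔ SameSide z w := by
  induction z using Quotient.inductionOn with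
  | _ v =>
    induction w using Quotient.inductionOn with
    | _ w =>
      change SameSide (orPlane (v.map f hf)) (orPlane (w.map f hf)) ↔ _
      rw [sameSide_mk, sameSide_mk]
      exact Iff.of_eq (congrArg (fun A => 0 < Matrix.det A) (gram_map q f hf v.1 w.1))

theorem perp_map {f : E →ₗ[k] E} (hf : ∀ x, q (f x) = q x) {z : OrientedNegPlane q} {s t : Set E}
    (hs : ∀ y ∈ t, ∃ x ∈ s, f x = y) (hz : z.Perp s) : (z.map f hf).Perp t := by
  obtain ⟨v, rfl, h⟩ := hz
  refine ⟨v.map f hf, rfl, fun i y hy => ?_⟩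
  obtain ⟨x, hx, rfl⟩ := hs y hy
  exact (polar_of_form_eq q hf _ _).trans (h i x hx)

theorem NegIndexTwo.sameSide_refl (hq : NegIndexTwo q) {a : E} (ha : q a ≠ 0)
    (z : OrientedNegPlane q) :
    SameSide z (z.map (refl q a) (form_refl q ha)) ↔ 0 < q a := by
  induction z using Quotient.inductionOn with
  | _ v =>
    change SameSide (orPlane v) (orPlane (v.map _ _)) ↔ _
    rw [sameSide_mk]
    have h := hq.det_gram_refl v.2 ha
    exact ⟨fun h' => pos_of_mul_pos_right h h'.le, fun h' => pos_of_mul_pos_left h h'.le⟩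

/-- The image of a negative frame under the exchange of its members. -/
theorem NegIndexTwo.not_sameSide_mk (hq : NegIndexTwo q) {v w : NegFrame q} :
    ¬ SameSide (orPlane v) (orPlane w) ↔ (gram q v.1 w.1).det < 0 := by
  rw [sameSide_mk, not_lt]
  exact ⟨fun h => lt_of_le_of_ne h (hq.det_gram_ne_zero v.2 w.2), le_of_lt⟩

variable [TopologicalSpace k] [OrderTopology k] [TopologicalSpace E] [IsModuleTopology k E]
  [Module.Finite k E]

theorem continuous_negFrame_val : Continuous (fun v : NegFrame q => v.1) :=
  continuous_subtype_val

theorem continuous_orPlane : Continuous (orPlane : NegFrame q → OrientedNegPlane q) :=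
  continuous_quotient_mk'

theorem isOpen_orientedNegPlane {s : Set (OrientedNegPlane q)} :
    IsOpen s ↔ IsOpen {v : NegFrame q | orPlane v ∈ s} :=
  isOpen_coinduced

theorem continuous_det_gram_left (v : NegFrame q) :
    Continuous fun w : NegFrame q => (gram q v.1 w.1).det :=
  continuous_det_gram q continuous_const continuous_negFrame_val

theorem isOpen_sameSide (z : OrientedNegPlane q) : IsOpen {w | SameSide z w} := by
  induction z using Quotient.inductionOn with
  | _ v =>
    rw [isOpen_orientedNegPlane]
    simp only [Set.mem_ofPred_eq, sameSide_mk]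
    exact isOpen_lt continuous_const (continuous_det_gram_left v)

theorem NegIndexTwo.isOpen_not_sameSide (hq : NegIndexTwo q) (z : OrientedNegPlane q) :
    IsOpen {w | ¬ SameSide z w} := by
  induction z using Quotient.inductionOn with
  | _ v =>
    rw [isOpen_orientedNegPlane]
    simp only [Set.mem_ofPred_eq, hq.not_sameSide_mk]
    exact isOpen_lt (continuous_det_gram_left v) continuous_const

theorem continuous_path (v L : Fin 2 → E) : Continuous fun t : k => (fun i => v i + t • L i) := by
  have := IsModuleTopology.toContinuousAdd k E
  exact continuous_pi fun i => continuous_const.add (continuous_id.smul continuous_const)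

variable [PreconnectedSpace k]

/-- Moving from `w` to a frame of the oriented plane of `v` through negative frames, the determinant
with `u` never vanishes, so it keeps its sign. -/
theorem NegIndexTwo.det_gram_trans (hq : NegIndexTwo q) {v w u : Fin 2 → E} (hv : IsNegFrame q v)
    (hw : IsNegFrame q w) (hu : IsNegFrame q u) (h : 0 < (gram q v w).det)
    (h' : 0 < (gram q w u).det) : 0 < (gram q v u).det := by
  rw [det_gram_comm] at h
  obtain ⟨B, hB, hpath⟩ := hq.exists_adapted hw hv h
  have hcont : Continuous fun t : k =>
      (gram q (fun i => w i + t • (matAct B v i - w i)) u).det :=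
    continuous_det_gram q (continuous_path w _) continuous_const
  have h1 := pos_of_continuous_ne_zero hcont
    (fun t ht ht' => hq.det_gram_ne_zero (hpath t ht ht') hu) (by simpa using h')
  simp only [one_smul, add_sub_cancel, gram_matAct, Matrix.det_mul] at h1
  exact pos_of_mul_pos_right h1 hB.le

theorem NegIndexTwo.sameSide_trans (hq : NegIndexTwo q) {z w u : OrientedNegPlane q}
    (h : SameSide z w) (h' : SameSide w u) : SameSide z u := by
  obtain ⟨v, v', rfl, rfl, h⟩ := h
  induction u using Quotient.inductionOn with
  | _ u =>
    exact sameSide_mk.mpr (hq.det_gram_trans v.2 v'.2 u.2 h (sameSide_mk.mp h'))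

/-- There are only two sides: exchanging the members of the frame of `w` reverses both signs and
reduces the claim to transitivity. -/
theorem NegIndexTwo.sameSide_of_not (hq : NegIndexTwo q) {z w u : OrientedNegPlane q}
    (h : ¬ SameSide z w) (h' : ¬ SameSide w u) : SameSide z u := by
  induction z using Quotient.inductionOn with
  | _ v =>
  induction w using Quotient.inductionOn with
  | _ w =>
  induction u using Quotient.inductionOn with
  | _ u =>
    have h1 := hq.not_sameSide_mk.mp h
    have h2 := hq.not_sameSide_mk.mp h'
    set A : Matrix (Fin 2) (Fin 2) k := !![0, 1; 1, 0] with hA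
    have hdet : A.det = -1 := by simp [hA, Matrix.det_fin_two]
    refine sameSide_mk.mpr (hq.det_gram_trans v.2 (IsNegFrame.matAct (A := A) w.2 ?_) u.2 ?_ ?_)
    · rw [hdet]; exact neg_ne_zero.mpr one_ne_zero
    · rw [det_gram_comm, gram_matAct, Matrix.det_mul, hdet, det_gram_comm]
      linarith
    · rw [gram_matAct, Matrix.det_mul, hdet]
      linarith

/-- Two planes on a side are joined by the segment between adapted frames. Orthogonality to `s` is
linear, so it persists along the segment, and the segment cannot leave the side because sides are
clopen. -/
theorem NegIndexTwo.isPreconnected_side (hq : NegIndexTwo q) (z : OrientedNegPlane q) (s : Set E) :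
    IsPreconnected {w | SameSide z w ∧ w.Perp s} := by
  refine isPreconnected_of_forall_pair fun x hx y hy => ?_
  have hxy : SameSide x y := hq.sameSide_trans hx.1.symm hy.1
  obtain ⟨hzx, v, rfl, hv⟩ := hx
  obtain ⟨-, w, rfl, hw⟩ := hy
  obtain ⟨B, hB, hpath⟩ := hq.exists_adapted v.2 w.2 (sameSide_mk.mp hxy)
  set p : Set.Icc (0 : k) 1 → OrientedNegPlane q := fun t => orPlane
    ⟨fun i => v.1 i + (t : k) • (matAct B w.1 i - v.1 i), hpath t t.2.1 t.2.2⟩ with hp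
  have hpc : Continuous p := continuous_orPlane.comp
    (((continuous_path _ _).comp continuous_subtype_val).subtype_mk _)
  have : PreconnectedSpace (Set.Icc (0 : k) 1) :=
    Subtype.preconnectedSpace isPreconnected_unitInterval
  have hp0 : p ⟨0, le_refl _, zero_le_one⟩ = orPlane v := by
    simp only [hp, zero_smul, add_zero]
    rfl
  have hp1 : p ⟨1, zero_le_one, le_refl _⟩ = orPlane w := by
    simp only [hp, one_smul, add_sub_cancel]
    exact orPlane_matAct w hB
  refine ⟨Set.range p, ?_, ⟨_, hp0⟩, ⟨_, hp1⟩, isPreconnected_range hpc⟩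
  rintro _ ⟨t, rfl⟩
  constructor
  · refine hq.sameSide_trans hzx ?_
    by_contra hcon
    exact hcon ((isPreconnected_range hpc).subset_isClopen
      (t := {u | SameSide (orPlane v) u}) ⟨⟨hq.isOpen_not_sameSide _⟩, isOpen_sameSide _⟩
      ⟨_, ⟨_, hp0⟩, SameSide.refl _⟩ ⟨t, rfl⟩)
  · refine perp_mk.mpr fun i y hy => ?_
    have h1 := matAct_perp B (q := q) (v := w.1) (fun j => hw j y hy) i
    simp only [QuadraticMap.polar_add_left, QuadraticMap.polar_smul_left,
      QuadraticMap.polar_sub_left, h1, hv i y hy, sub_zero, smul_zero, add_zero]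

end Sides


open Filter Topology

/-! ### Local behaviour near a point: uniform bounds, perturbations, projections. -/

section LocalTheory

variable {k E : Type*} [Field k] [LinearOrder k] [IsStrictOrderedRing k] [AddCommGroup E]
  [Module k E] {q : QuadraticForm k E}
  [TopologicalSpace k] [OrderTopology k] [TopologicalSpace E] [IsModuleTopology k E]
  [Module.Finite k E]

theorem continuous_matAct (A : Matrix (Fin 2) (Fin 2) k) :
    Continuous fun v : Fin 2 → E => matAct A v := by
  have := IsModuleTopology.toContinuousAdd k E
  exact continuous_pi fun i => continuous_finsetSum _ fun j _ =>
    continuous_const.smul (continuous_apply j)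

/-- The saturation of an open set of frames is the union of its preimages under the matrices of
positive determinant. -/
theorem isOpenMap_orPlane : IsOpenMap (orPlane : NegFrame q → OrientedNegPlane q) := by
  intro O hO
  rw [isOpen_orientedNegPlane]
  have h : {v : NegFrame q | orPlane v ∈ orPlane '' O} =
      ⋃ A : {A : Matrix (Fin 2) (Fin 2) k // 0 < A.det},
        (fun v : NegFrame q => (⟨matAct A.1 v.1, IsNegFrame.matAct v.2 A.2.ne'⟩ : NegFrame q)) ⁻¹'
          O := by
    ext v
    simp only [Set.mem_ofPred_eq, Set.mem_image, Set.mem_iUnion]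
    constructor
    · rintro ⟨w, hw, h⟩
      obtain ⟨A, hA, hAw⟩ := orPlane_eq_iff.mp h.symm
      refine ⟨⟨A, hA⟩, ?_⟩
      have hAw' : (⟨matAct A v.1, IsNegFrame.matAct v.2 hA.ne'⟩ : NegFrame q) = w :=
        Subtype.ext hAw.symm
      exact (congrArg (· ∈ O) hAw').mpr hw
    · rintro ⟨A, hA⟩
      exact ⟨_, hA, orPlane_matAct v A.2⟩
  rw [h]
  exact isOpen_iUnion fun A => hO.preimage
    (((continuous_matAct A.1).comp continuous_negFrame_val).subtype_mk _)

/-- If `q` is positive definite on the orthogonal complement of some vectors, then it is uniformly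
so on the orthogonal complements of all nearby vectors. -/
theorem eventually_bounded_of_perp [CompactIccSpace k] {r : ℕ} {κ : Type*} [Fintype κ]
    (b : Module.Basis κ k E) (v : Fin r → E)
    (hv : ∀ y, y ≠ 0 → (∀ i, QuadraticMap.polar q (v i) y = 0) → 0 < q y) :
    ∃ ε : k, 0 < ε ∧ ∀ᶠ v' in 𝓝 v, ∀ y, (∀ i, QuadraticMap.polar q (v' i) y = 0) →
      ∀ i, ε * (b.repr y i) ^ 2 ≤ q y := by
  have hadd := IsModuleTopology.toContinuousAdd k E
  set Y : (κ → k) → E := fun c => ∑ i, c i • b i with hY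
  have hYc : Continuous Y := continuous_finsetSum _ fun i _ =>
    (continuous_apply i).smul continuous_const
  -- The boundary of the unit cube replaces the unit sphere: every non-zero vector is a multiple of
  -- one with largest coordinate of absolute value one.
  set S : Set (κ → k) := (Set.univ.pi fun _ => Set.Icc (-1) 1) ∩ {c | ∃ i, |c i| = 1} with hS
  have hSc : IsCompact S := by
    refine (isCompact_univ_pi fun _ => isCompact_Icc).inter_right ?_
    have : {c : κ → k | ∃ i, |c i| = 1} = ⋃ i, {c : κ → k | |c i| = 1} := by ext; simp
    rw [this]
    exact isClosed_iUnion_of_finite fun i =>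
      isClosed_eq (continuous_abs.comp (continuous_apply i)) continuous_const
  have hSne {c : κ → k} (hc : c ∈ S) : Y c ≠ 0 := by
    obtain ⟨-, i, hi⟩ := hc
    intro h
    have h0 : c i = 0 := Fintype.linearIndependent_iff.mp b.linearIndependent c h i
    rw [h0, abs_zero] at hi
    exact zero_ne_one hi
  have key : ∃ ε : k, 0 < ε ∧ ∀ᶠ v' in 𝓝 v, ∀ c ∈ S,
      (∀ i, QuadraticMap.polar q (v' i) (Y c) = 0) → ε ≤ q (Y c) := by
    refine hSc.induction_on (p := fun S' => ∃ ε : k, 0 < ε ∧ ∀ᶠ v' in 𝓝 v, ∀ c ∈ S',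
      (∀ i, QuadraticMap.polar q (v' i) (Y c) = 0) → ε ≤ q (Y c)) ?_ ?_ ?_ ?_
    · exact ⟨1, one_pos, Eventually.of_forall fun v' c hc => hc.elim⟩
    · rintro s t hst ⟨ε, hε, h⟩
      exact ⟨ε, hε, h.mono fun v' h' c hc => h' c (hst hc)⟩
    · rintro s t ⟨ε, hε, h⟩ ⟨ε', hε', h'⟩
      refine ⟨min ε ε', lt_min hε hε', (h.and h').mono fun v' H c hc hp => ?_⟩
      rcases hc with hc | hc
      · exact (min_le_left _ _).trans (H.1 c hc hp)
      · exact (min_le_right _ _).trans (H.2 c hc hp)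
    · intro c hc
      -- Either `Y c` is orthogonal to `v`, and then `q` stays above half its positive value nearby,
      -- or some product is non-zero and stays so nearby, making the condition void.
      have hloc : ∃ ε : k, 0 < ε ∧ ∀ᶠ p : (Fin r → E) × (κ → k) in 𝓝 v ×ˢ 𝓝 c,
          (∀ i, QuadraticMap.polar q (p.1 i) (Y p.2) = 0) → ε ≤ q (Y p.2) := by
        rw [← nhds_prod_eq]
        by_cases hp : ∀ i, QuadraticMap.polar q (v i) (Y c) = 0
        · have hpos := hv _ (hSne hc) hp
          refine ⟨q (Y c) / 2, half_pos hpos, ?_⟩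
          have hcont : Continuous fun p : (Fin r → E) × (κ → k) => q (Y p.2) :=
            (continuous_form q).comp (hYc.comp continuous_snd)
          filter_upwards [hcont.continuousAt.eventually (lt_mem_nhds (half_lt_self hpos))] with p h _
          exact h.le
        · push Not at hp
          obtain ⟨i, hi⟩ := hp
          refine ⟨1, one_pos, ?_⟩
          have hcont : Continuous fun p : (Fin r → E) × (κ → k) =>
              QuadraticMap.polar q (p.1 i) (Y p.2) :=
            continuous_polar q ((continuous_apply i).comp continuous_fst) (hYc.comp continuous_snd)
          filter_upwards [hcont.continuousAt.eventually (isOpen_ne.mem_nhds hi)] with p h h'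
          exact absurd (h' i) h
      obtain ⟨ε, hε, h⟩ := hloc
      obtain ⟨pa, ha, pb, hb, hab⟩ := eventually_prod_iff.mp h
      exact ⟨{c | pb c}, mem_nhdsWithin_of_mem_nhds hb, ε, hε,
        ha.mono fun v' hv' c' hc' => hab hv' hc'⟩
  obtain ⟨ε, hε, h⟩ := key
  refine ⟨ε, hε, h.mono fun v' H y hy i => ?_⟩
  have : Nonempty κ := ⟨i⟩
  obtain ⟨i₀, hi₀⟩ := Finite.exists_max fun i => |b.repr y i|
  rcases (abs_nonneg (b.repr y i₀)).eq_or_lt with h0 | h0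
  · have hz : b.repr y = 0 := Finsupp.ext fun j => abs_eq_zero.mp
      (le_antisymm ((hi₀ j).trans_eq h0.symm) (abs_nonneg _))
    have hy0 : y = 0 := by simpa using hz
    simp [hy0]
  · set M := |b.repr y i₀| with hM
    have hYy : Y (fun j => M⁻¹ * b.repr y j) = M⁻¹ • y := by
      conv_rhs => rw [← b.sum_repr y]
      simp only [hY, Finset.smul_sum, smul_smul]
    have hmem : (fun j => M⁻¹ * b.repr y j) ∈ S := by
      refine ⟨fun j _ => ?_, i₀, ?_⟩
      · refine abs_le.mp ?_
        rw [abs_mul, abs_of_pos (inv_pos.mpr h0), inv_mul_le_one₀ h0]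
        exact hi₀ j
      · rw [abs_mul, abs_of_pos (inv_pos.mpr h0), inv_mul_cancel₀ h0.ne']
    have h1 := H _ hmem fun j => by rw [hYy, QuadraticMap.polar_smul_right, hy, smul_zero]
    rw [hYy, QuadraticMap.map_smul, smul_eq_mul] at h1
    have h2 : ε * M ^ 2 ≤ q y := by
      have h3 := mul_le_mul_of_nonneg_right h1 (sq_nonneg M)
      have h4 : M⁻¹ * M⁻¹ * q y * M ^ 2 = q y := by field_simp
      rwa [h4] at h3
    refine le_trans (mul_le_mul_of_nonneg_left ?_ hε.le) h2
    rw [← sq_abs (b.repr y i)]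
    exact pow_le_pow_left₀ (abs_nonneg _) (hi₀ i) 2

theorem NegIndexTwo.exists_nhds_bounded [CompactIccSpace k] (hq : NegIndexTwo q)
    {κ : Type*} [Fintype κ] (b : Module.Basis κ k E) (z : OrientedNegPlane q) :
    ∃ ε : k, 0 < ε ∧ ∀ᶠ z' in 𝓝 z, ∀ y, OrientedNegPlane.Perp z' {y} →
      ∀ i, ε * (b.repr y i) ^ 2 ≤ q y := by
  induction z using Quotient.inductionOn with
  | _ v =>
    obtain ⟨ε, hε, h⟩ := eventually_bounded_of_perp b v.1 (hq v.1 v.2)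
    refine ⟨ε, hε, ?_⟩
    have h1 : ∀ᶠ v' in 𝓝 v, ∀ y, (∀ i, QuadraticMap.polar q (v'.1 i) y = 0) →
      ∀ i, ε * (b.repr y i) ^ 2 ≤ q y := continuous_negFrame_val.continuousAt.eventually h
    have h2 := isOpenMap_orPlane.image_mem_nhds h1
    filter_upwards [h2]
    rintro _ ⟨v', hv', rfl⟩ y hy
    exact hv' y fun i => perp_mk.mp hy i y rfl

theorem isOpen_not_perp (y : E) : IsOpen {z : OrientedNegPlane q | ¬ z.Perp {y}} := by
  rw [isOpen_orientedNegPlane]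
  have : {v : NegFrame q | orPlane v ∈ {z : OrientedNegPlane q | ¬ z.Perp {y}}} =
      ⋃ i, {v : NegFrame q | QuadraticMap.polar q (v.1 i) y ≠ 0} := by
    ext v
    simp [perp_mk, imp_iff_not_or]
  rw [this]
  exact isOpen_iUnion fun i => isOpen_ne_fun (continuous_polar q
    ((continuous_apply i).comp continuous_negFrame_val) continuous_const) continuous_const

theorem isOpen_isNegFrame : IsOpen {v : Fin 2 → E | IsNegFrame q v} := by
  simp only [isNegFrame_iff]
  exact (isOpen_lt ((continuous_form q).comp (continuous_apply 0)) continuous_const).inter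
    (isOpen_lt continuous_const (continuous_det_gram q continuous_id continuous_id))

/-- A plane orthogonal to `s` can be moved a little, inside the orthogonal complement of `s`, so
that it is not orthogonal to finitely many given vectors. -/
theorem exists_perturbation {z : OrientedNegPlane q} {s : Set E} (hz : z.Perp s) {e : E}
    (he : ∀ w ∈ s, QuadraticMap.polar q e w = 0) {S : Set E} (hS : S.Finite)
    (heS : ∀ u ∈ S, QuadraticMap.polar q e u ≠ 0) {N : Set (OrientedNegPlane q)} (hN : N ∈ 𝓝 z) :
    ∃ z' ∈ N, z'.Perp s ∧ ∀ u ∈ S, ¬ z'.Perp {u} := by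
  obtain ⟨v, rfl, hv⟩ := hz
  have hadd := IsModuleTopology.toContinuousAdd k E
  -- Only the first basis vector is moved, in the direction `e`. Each `u` then excludes no small `t
  -- > 0`, since its product with the moved vector is affine in `t` and not identically zero.
  set L : Fin 2 → E := ![e, 0] with hL
  set p : k → Fin 2 → E := fun t i => v.1 i + t • L i with hp
  have hpc : Continuous p := continuous_path v.1 L
  have hp0 : p 0 = v.1 := by simp [hp]
  have h1 : ∀ᶠ w in 𝓝 v, orPlane w ∈ N := continuous_orPlane.continuousAt.eventually hN
  -- The neighbourhood is stated in the ambient space of pairs, because the moved pair is known to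
  -- be a negative frame only for small `t`.
  have h1' : ∀ᶠ w in 𝓝 v.1, ∀ hw : IsNegFrame q w, orPlane ⟨w, hw⟩ ∈ N := by
    obtain ⟨O, hO, hOs⟩ := mem_nhds_subtype _ _ _ |>.mp h1
    filter_upwards [hO] with w hwO hw
    exact hOs (show (⟨w, hw⟩ : NegFrame q) ∈ _ from hwO)
  have h2 : ∀ᶠ t in 𝓝[>] (0 : k), IsNegFrame q (p t) ∧
      ∀ hw : IsNegFrame q (p t), orPlane ⟨p t, hw⟩ ∈ N := by
    have h := (isOpen_isNegFrame.eventually_mem v.2).and h1'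
    rw [← hp0] at h
    exact nhdsWithin_le_nhds (hpc.continuousAt.eventually h)
  have h3 : ∀ᶠ t in 𝓝[>] (0 : k), ∀ u ∈ S, QuadraticMap.polar q (p t 0) u ≠ 0 := by
    rw [hS.eventually_all]
    intro u hu
    have hpu (t : k) : QuadraticMap.polar q (p t 0) u =
        QuadraticMap.polar q (v.1 0) u + t * QuadraticMap.polar q e u := by
      simp [hp, hL, QuadraticMap.polar_add_left]
    by_cases h0 : QuadraticMap.polar q (v.1 0) u = 0
    · filter_upwards [self_mem_nhdsWithin] with t ht
      rw [hpu, h0, zero_add]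
      exact mul_ne_zero (ne_of_gt ht) (heS u hu)
    · have hc : Continuous fun t => QuadraticMap.polar q (p t 0) u :=
        continuous_polar q ((continuous_apply 0).comp hpc) continuous_const
      refine nhdsWithin_le_nhds (hc.continuousAt.eventually (isOpen_ne.eventually_mem ?_))
      change QuadraticMap.polar q (p 0 0) u ≠ 0
      rwa [hpu, zero_mul, add_zero]
  obtain ⟨t, ⟨ht, htN⟩, htS⟩ := (h2.and h3).exists
  refine ⟨orPlane ⟨p t, ht⟩, htN ht, perp_mk.mpr fun i w hw => ?_, fun u hu h => ?_⟩
  · simp only [hp, QuadraticMap.polar_add_left, QuadraticMap.polar_smul_left, hv i w hw, zero_add]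
    fin_cases i
    · simp [hL, he w hw]
    · simp [hL]
  · exact htS u hu (perp_mk.mp h 0 u rfl)

/-- Projecting a negative plane to the orthogonal complement of a positive definite space. -/
theorem NegIndexTwo.exists_perp_orthFamily [PreconnectedSpace k] (hq : NegIndexTwo q) {n : ℕ}
    {e : Fin n → E} (he : OrthFamily q e) (hpos : ∀ i, 0 < q (e i)) (z : OrientedNegPlane q) :
    ∃ z', SameSide z z' ∧ z'.Perp (Set.range e) := by
  induction z using Quotient.inductionOn with
  | _ v =>
    have hpol (x : E) : QuadraticMap.polar q x (orthProj q e x) = 2 * q (orthProj q e x) := by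
      rw [← polar_self_eq]
      have h1 (y : E) : QuadraticMap.polar q y (orthProj q e x) =
          ∑ i, (2 * q (e i))⁻¹ * QuadraticMap.polar q (e i) x * QuadraticMap.polar q y (e i) := by
        conv_lhs => rw [orthProj_apply, ← QuadraticMap.polarBilin_apply_apply, map_sum]
        simp
      rw [h1, h1]
      refine Finset.sum_congr rfl fun i _ => ?_
      rw [QuadraticMap.polar_comm q (orthProj q e x), he.polar_orthProj, QuadraticMap.polar_comm q x]
    have hnn (x : E) : 0 ≤ q (orthProj q e x) := by
      have h1 : 2 * q (orthProj q e x) =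
          ∑ i, (2 * q (e i))⁻¹ * QuadraticMap.polar q (e i) x ^ 2 := by
        rw [← hpol]
        conv_lhs => rw [orthProj_apply, ← QuadraticMap.polarBilin_apply_apply, map_sum]
        refine Finset.sum_congr rfl fun i _ => ?_
        rw [map_smul, QuadraticMap.polarBilin_apply_apply, QuadraticMap.polar_comm q x, smul_eq_mul]
        ring
      have h2 : 0 ≤ 2 * q (orthProj q e x) := by
        rw [h1]
        exact Finset.sum_nonneg fun i _ => mul_nonneg
          (inv_nonneg.mpr (mul_nonneg zero_le_two (hpos i).le)) (sq_nonneg _)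
      linarith
    -- Subtracting `t` times the projection `Px` changes the value by `-t(2 - t) q(Px) ≤ 0`, so
    -- frames stay negative up to `t = 1`, where they are orthogonal to the family.
    set p : k → Fin 2 → E := fun t i => v.1 i + t • (-orthProj q e (v.1 i)) with hp
    have hneg (t : k) (ht : 0 ≤ t) (ht' : t ≤ 1) : IsNegFrame q (p t) := by
      intro c hc
      have h1 : ∑ i, c i • p t i = (∑ i, c i • v.1 i) - t • orthProj q e (∑ i, c i • v.1 i) := by
        simp only [hp, map_sum, map_smul, smul_add, Finset.sum_add_distrib, Finset.smul_sum,
          smul_neg, Finset.sum_neg_distrib, smul_comm t, sub_eq_add_neg]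
      have h2 := v.2 c hc
      set x := ∑ i, c i • v.1 i
      rw [h1, sub_eq_add_neg, form_add, QuadraticMap.map_neg, QuadraticMap.map_smul,
        QuadraticMap.polar_neg_right, QuadraticMap.polar_smul_right, hpol]
      simp only [smul_eq_mul]
      nlinarith [hnn x, mul_nonneg (mul_nonneg ht (sub_nonneg.mpr ht')) (hnn x),
        mul_nonneg ht (hnn x)]
    have hdet := pos_of_continuous_ne_zero (f := fun t => (gram q v.1 (p t)).det)
      (continuous_det_gram q continuous_const (continuous_path v.1 _))
      (fun t ht ht' => hq.det_gram_ne_zero v.2 (hneg t ht ht'))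
      (by simpa [hp] using ((isNegFrame_iff q _).mp v.2).2)
    refine ⟨orPlane ⟨p 1, hneg 1 zero_le_one le_rfl⟩, sameSide_mk.mpr hdet, perp_mk.mpr ?_⟩
    rintro i _ ⟨j, rfl⟩
    simp only [hp, one_smul, ← sub_eq_add_neg]
    exact he.polar_sub_orthProj _ (Submodule.subset_span ⟨j, rfl⟩)

end LocalTheory


/-! ### From signatures to positivity on orthogonal complements. -/

section Signature

variable {k E : Type*} [Field k] [LinearOrder k] [IsStrictOrderedRing k] [AddCommGroup E]
  [Module k E] [FiniteDimensional k E] {q : QuadraticForm k E}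

theorem polar_sum_smul_left {r : ℕ} {v : Fin r → E} (c : Fin r → k) (y : E) :
    QuadraticMap.polar q (∑ i, c i • v i) y = ∑ i, c i * QuadraticMap.polar q (v i) y := by
  conv_lhs => rw [QuadraticMap.polar_comm, ← QuadraticMap.polarBilin_apply_apply, map_sum]
  simp [QuadraticMap.polar_comm q y]

/-- If a negative definite frame has the maximal possible length, then the form is nonnegative on
its orthogonal complement. -/
theorem nonneg_of_perp_of_sigNeg {r : ℕ} (hr : sigNeg q = r) {v : Fin r → E}
    (hv : ∀ c : Fin r → k, c ≠ 0 → q (∑ i, c i • v i) < 0) {y : E}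
    (hy : ∀ i, QuadraticMap.polar q (v i) y = 0) : 0 ≤ q y := by
  by_contra! hneg
  -- A negative `y` orthogonal to the frame would extend it to a negative definite space of
  -- dimension `r + 1`, beyond the negative index.
  set w : Fin (r + 1) → E := Fin.snoc v y with hw
  have hform (c : Fin (r + 1) → k) : q (∑ i, c i • w i) =
      q (∑ i : Fin r, c i.castSucc • v i) + c (Fin.last r) ^ 2 * q y := by
    rw [Fin.sum_univ_castSucc]
    simp only [hw, Fin.snoc_castSucc, Fin.snoc_last]
    have h0 : ∑ i : Fin r, c i.castSucc * QuadraticMap.polar q (v i) y = 0 :=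
      Finset.sum_eq_zero fun i _ => by rw [hy, mul_zero]
    rw [form_add, QuadraticMap.map_smul, QuadraticMap.polar_smul_right,
      polar_sum_smul_left (fun i : Fin r => c i.castSucc), h0]
    simp only [smul_eq_mul, mul_zero, add_zero]
    ring
  have hwneg (c : Fin (r + 1) → k) (hc : c ≠ 0) : q (∑ i, c i • w i) < 0 := by
    rw [hform]
    by_cases h0 : (fun i : Fin r => c i.castSucc) = 0
    · have hl : c (Fin.last r) ≠ 0 := by
        intro hl
        refine hc (funext fun i => ?_)
        induction i using Fin.lastCases with
        | last => exact hl
        | cast i => exact congrFun h0 i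
      have h1 : ∑ i : Fin r, c i.castSucc • v i = 0 :=
        Finset.sum_eq_zero fun i _ => by rw [show c i.castSucc = 0 from congrFun h0 i, zero_smul]
      rw [h1, QuadraticMap.map_zero, zero_add]
      have := pow_pos (abs_pos.mpr hl) 2
      rw [sq_abs] at this
      exact mul_neg_of_pos_of_neg this hneg
    · have := hv _ h0
      nlinarith [mul_nonpos_of_nonneg_of_nonpos (sq_nonneg (c (Fin.last r))) hneg.le]
  have hli : LinearIndependent k w := by
    rw [Fintype.linearIndependent_iff]
    intro c hc
    by_contra! hne
    obtain ⟨i, hi⟩ := hne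
    have := hwneg c fun h => hi (congrFun h i)
    rw [hc, QuadraticMap.map_zero] at this
    exact lt_irrefl _ this
  have hle := le_sigNeg_of_negDef (Q := q) (V := Submodule.span k (Set.range w)) (by
    rintro ⟨x, hx⟩ hx0
    obtain ⟨c, rfl⟩ := (Submodule.mem_span_range_iff_exists_fun k).mp hx
    have hc : c ≠ 0 := by
      rintro rfl
      exact hx0 (Subtype.ext (by simp))
    exact neg_pos.mpr (hwneg c hc))
  rw [finrank_span_eq_card hli, Fintype.card_fin, hr] at hle
  omega

/-- The form is already non-negative on the complement. A non-zero isotropic `y` there is not in the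
radical, which is zero by the dimension count. So it pairs non-trivially with some `u'` in the
complement, and `u' + t y` takes negative values. -/
theorem pos_of_perp_of_sigNeg {r : ℕ} (hr : sigNeg q = r)
    (hs : sigPos q + sigNeg q = Module.finrank k E) {v : Fin r → E}
    (hv : ∀ c : Fin r → k, c ≠ 0 → q (∑ i, c i • v i) < 0) {y : E} (hy0 : y ≠ 0)
    (hy : ∀ i, QuadraticMap.polar q (v i) y = 0) : 0 < q y := by
  refine lt_of_le_of_ne (nonneg_of_perp_of_sigNeg hr hv hy) fun h0 => hy0 ?_
  have hrad : q.polarBilin.ker = ⊥ := by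
    have h1 := QuadraticForm.sigPos_add_sigNeg_add_radical (Q := q)
    rw [← QuadraticMap.radical_eq_ker_polarBilin]
    exact Submodule.finrank_eq_zero.mp (by omega)
  rw [← Submodule.mem_bot (R := k), ← hrad, LinearMap.mem_ker]
  ext u
  rw [QuadraticMap.polarBilin_apply_apply, LinearMap.zero_apply]
  by_contra hu
  set G : Matrix (Fin r) (Fin r) k := Matrix.of fun i j => QuadraticMap.polar q (v i) (v j) with hG
  have hdet : G.det ≠ 0 := by
    intro h
    obtain ⟨c, hc, hcG⟩ := Matrix.exists_vecMul_eq_zero_iff.mpr h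
    have h1 := hv c hc
    have h2 : QuadraticMap.polar q (∑ i, c i • v i) (∑ i, c i • v i) = 0 := by
      rw [QuadraticMap.polar_comm, polar_sum_smul_left]
      refine Finset.sum_eq_zero fun j _ => ?_
      rw [QuadraticMap.polar_comm, polar_sum_smul_left]
      exact mul_eq_zero_of_right _ (congrFun hcG j)
    rw [polar_self_eq] at h2
    linarith
  set c := Matrix.mulVec G⁻¹ (fun i => QuadraticMap.polar q (v i) u) with hc
  have hGc : Matrix.mulVec G c = fun i => QuadraticMap.polar q (v i) u := by
    rw [hc, Matrix.mulVec_mulVec, Matrix.mul_nonsing_inv _ (isUnit_iff_ne_zero.mpr hdet),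
      Matrix.one_mulVec]
  -- The projection of `u` to the complement of the frame; its product with `y` is unchanged because
  -- `y` is orthogonal to the frame.
  set u' := u - ∑ i, c i • v i with hu'
  have hperp (i) : QuadraticMap.polar q (v i) u' = 0 := by
    rw [hu', QuadraticMap.polar_sub_right, QuadraticMap.polar_comm q (v i) (∑ i, c i • v i),
      polar_sum_smul_left, sub_eq_zero, ← congrFun hGc i]
    simp only [Matrix.mulVec, dotProduct, hG, Matrix.of_apply]
    exact Finset.sum_congr rfl fun j _ => by rw [QuadraticMap.polar_comm, mul_comm]
  have hyu : QuadraticMap.polar q u' y ≠ 0 := by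
    rwa [hu', QuadraticMap.polar_sub_left, polar_sum_smul_left,
      Finset.sum_eq_zero fun i _ => by rw [hy, mul_zero], sub_zero, QuadraticMap.polar_comm]
  -- With `q(y) = 0` the value of `q` on this line is affine in `t`; this parameter gives `-1`.
  set t := -(q u' + 1) / QuadraticMap.polar q u' y with ht
  have h3 : q (u' + t • y) = -1 := by
    rw [form_add, QuadraticMap.map_smul, ← h0, QuadraticMap.polar_smul_right, smul_zero,
      smul_eq_mul, ht, div_mul_cancel₀ _ hyu]
    ring
  have h4 := nonneg_of_perp_of_sigNeg hr hv (y := u' + t • y) fun i => by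
    rw [QuadraticMap.polar_add_right, QuadraticMap.polar_smul_right, hy, hperp, smul_zero,
      add_zero]
  rw [h3] at h4
  linarith

theorem negIndexTwo_of_signature (hr : sigNeg q = 2)
    (hs : sigPos q + sigNeg q = Module.finrank k E) : NegIndexTwo q :=
  fun _ hv _ hy0 hy => pos_of_perp_of_sigNeg hr hs hv hy0 hy

/-- The definite case is the case of the empty frame, whose complement is everything. -/
theorem pos_of_sigNeg_eq_zero (hr : sigNeg q = 0) (hs : sigPos q + sigNeg q = Module.finrank k E)
    {y : E} (hy0 : y ≠ 0) : 0 < q y :=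
  pos_of_perp_of_sigNeg hr hs (v := Fin.elim0) (fun c hc => absurd (Subsingleton.elim c 0) hc) hy0
    fun i => i.elim0

theorem exists_pos_of_sigPos (h : 0 < sigPos q) : ∃ y, 0 < q y := by
  obtain ⟨W, hW, hpos⟩ := exists_finrank_eq_sigPos_and_posDef q
  rw [← hW] at h
  obtain ⟨⟨y, hy⟩, hy0⟩ := @exists_ne _ (Module.finrank_pos_iff.mp h) (0 : W)
  exact ⟨y, hpos _ hy0⟩

end Signature

/-! ### Forms and reflections under extension of scalars. -/

section RealPlaces

variable {F : Type*} [Field F]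

instance (σ : F →+* ℝ) : OrderTopology (RealAt σ) := inferInstanceAs (OrderTopology ℝ)
instance (σ : F →+* ℝ) : CompactIccSpace (RealAt σ) := inferInstanceAs (CompactIccSpace ℝ)
instance (σ : F →+* ℝ) : PreconnectedSpace (RealAt σ) := inferInstanceAs (PreconnectedSpace ℝ)

instance {R M : Type*} [CommRing R] [TopologicalSpace R] [Algebra F R] [AddCommGroup M]
    [Module F M] : IsModuleTopology R (R ⊗[F] M) := ⟨rfl⟩

theorem algebraMap_realAt_pos (σ : F →+* ℝ) (a : F) :
    0 < algebraMap F (RealAt σ) a ↔ 0 < σ a := Iff.rfl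

variable [CharZero F] {V : Type*} [AddCommGroup V] [Module F V] (Q : QuadraticForm F V)

theorem form_baseChange_tmul (A : Type*) [CommRing A] [Algebra F A] (x : V) :
    Q.baseChange A (1 ⊗ₜ x) = algebraMap F A (Q x) := by
  rw [QuadraticForm.baseChange_tmul, mul_one, Algebra.algebraMap_eq_smul_one]

theorem polar_baseChange_tmul (A : Type*) [CommRing A] [Algebra F A] (x y : V) :
    QuadraticMap.polar (Q.baseChange A) (1 ⊗ₜ x) (1 ⊗ₜ y) =
      algebraMap F A (QuadraticMap.polar Q x y) := by
  simp only [QuadraticMap.polar, ← TensorProduct.tmul_add, form_baseChange_tmul, map_sub]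

theorem refl_baseChange (A : Type*) [Field A] [Algebra F A] (v : V) :
    (refl Q v).baseChange A = refl (Q.baseChange A) (1 ⊗ₜ v) := by
  ext x
  change (1 : A) ⊗ₜ[F] refl Q v x = refl (Q.baseChange A) (1 ⊗ₜ v) (1 ⊗ₜ x)
  rw [refl_apply, refl_apply, form_baseChange_tmul, polar_baseChange_tmul, ← map_inv₀ (algebraMap F A),
    ← map_mul (algebraMap F A),
    TensorProduct.tmul_sub, algebraMap_smul, TensorProduct.tmul_smul]

end RealPlaces


/-! ### Composition rules for sides. -/

section SignRule

variable {k E : Type*} [Field k] [LinearOrder k] [IsStrictOrderedRing k] [AddCommGroup E]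
  [Module k E] {q : QuadraticForm k E} [TopologicalSpace k] [OrderTopology k] [TopologicalSpace E]
  [IsModuleTopology k E] [Module.Finite k E] [PreconnectedSpace k]

/-- With exactly two sides, changes of side compose like signs. This is what makes the effect of a
product of reflections multiplicative. -/
theorem NegIndexTwo.sameSide_iff (hq : NegIndexTwo q) (z w u : OrientedNegPlane q) :
    SameSide z u ↔ (SameSide z w ↔ SameSide w u) := by
  constructor
  · intro h
    exact ⟨fun h' => hq.sameSide_trans h'.symm h, fun h' => hq.sameSide_trans h h'.symm⟩
  · intro h
    by_cases h' : SameSide z w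
    · exact hq.sameSide_trans h' (h.mp h')
    · exact hq.sameSide_of_not h' fun h'' => h' (h.mpr h'')

theorem map_congr_fun {f g : E →ₗ[k] E} (h : f = g) (hf : ∀ x, q (f x) = q x)
    (hg : ∀ x, q (g x) = q x) (z : OrientedNegPlane q) : z.map f hf = z.map g hg := by
  subst h
  rfl

theorem map_comp_apply {f g : E →ₗ[k] E} (hf : ∀ x, q (f x) = q x) (hg : ∀ x, q (g x) = q x)
    (hfg : ∀ x, q ((f ∘ₗ g) x) = q x) (z : OrientedNegPlane q) :
    z.map (f ∘ₗ g) hfg = (z.map g hg).map f hf := by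
  induction z using Quotient.inductionOn with
  | _ v => rfl

theorem map_id (h : ∀ x, q ((LinearMap.id : E →ₗ[k] E) x) = q x) (z : OrientedNegPlane q) :
    z.map LinearMap.id h = z := by
  induction z using Quotient.inductionOn with
  | _ v => rfl

end SignRule

theorem pos_mul_iff {k : Type*} [Field k] [LinearOrder k] [IsStrictOrderedRing k] {a b : k}
    (ha : a ≠ 0) (hb : b ≠ 0) : 0 < a * b ↔ (0 < a ↔ 0 < b) := by
  rcases lt_or_gt_of_ne ha with ha' | ha' <;> rcases lt_or_gt_of_ne hb with hb' | hb'
  · simp [mul_pos_of_neg_of_neg ha' hb', ha'.not_gt, hb'.not_gt]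
  · simp [(mul_neg_of_neg_of_pos ha' hb').not_gt, ha'.not_gt, hb']
  · simp [(mul_neg_of_pos_of_neg ha' hb').not_gt, ha', hb'.not_gt]
  · simp [mul_pos ha' hb', ha', hb']

/-! ### Connected components of `D` and the group `G(ℚ)_+`. -/

section SymmetricSpace

variable {F : Type*} [Field F] [NumberField F] {V : Type*} [AddCommGroup V] [Module F V]
  [FiniteDimensional F V] {Q : QuadraticForm F V}

/-- A product of reflections preserves the orientation of negative planes if and only if its spinor
norm is positive. -/
theorem sameSide_reflProd {σ : F →+* ℝ} (hq : NegIndexTwo (realForm Q σ)) {l : List V}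
    (hl : ∀ v ∈ l, Q v ≠ 0)
    (h : ∀ x, realForm Q σ ((reflProd Q l).baseChange (RealAt σ) x) = realForm Q σ x)
    (z : OrientedNegPlane (realForm Q σ)) :
    SameSide z (z.map ((reflProd Q l).baseChange (RealAt σ)) h) ↔ 0 < σ (formProd Q l) := by
  induction l with
  | nil =>
    have h1 : (reflProd Q []).baseChange (RealAt σ) = LinearMap.id :=
      LinearMap.baseChange_id (R := F) (M := V) (A := RealAt σ)
    rw [map_congr_fun h1 h (fun _ => rfl), map_id]
    simp [SameSide.refl, formProd]
  | cons v l ih =>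
    have hv := hl v List.mem_cons_self
    have hl' : ∀ w ∈ l, Q w ≠ 0 := fun w hw => hl w (List.mem_cons_of_mem _ hw)
    have hv' : realForm Q σ (1 ⊗ₜ v) ≠ 0 := by
      rw [form_baseChange_tmul]
      exact (map_ne_zero _).mpr hv
    have hcomp : (reflProd Q (v :: l)).baseChange (RealAt σ) =
        (refl (realForm Q σ) (1 ⊗ₜ v)) ∘ₗ (reflProd Q l).baseChange (RealAt σ) := by
      rw [← refl_baseChange, ← LinearMap.baseChange_comp]
      rfl
    have h2 := form_baseChange Q (RealAt σ) (reflProd Q l) (form_reflProd Q hl')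
    have h3 := form_refl (realForm Q σ) hv'
    have h4 (x) : realForm Q σ (((refl (realForm Q σ) (1 ⊗ₜ v)) ∘ₗ
        (reflProd Q l).baseChange (RealAt σ)) x) = realForm Q σ x := by
      rw [← hcomp]; exact h x
    -- The side changes under `l` by induction and under `v` according to the sign of `Q v`. The two
    -- signs multiply, as do the factors of the spinor norm.
    rw [map_congr_fun hcomp h h4, map_comp_apply h3 h2,
      hq.sameSide_iff z (z.map ((reflProd Q l).baseChange (RealAt σ)) h2), ih hl' h2,
      hq.sameSide_refl hv', form_baseChange_tmul, algebraMap_realAt_pos]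
    have h5 : formProd Q (v :: l) = formProd Q l * Q v := by simp [formProd, mul_comm]
    rw [h5, map_mul, pos_mul_iff ((map_ne_zero σ).mpr (formProd_ne_zero Q hl'))
      ((map_ne_zero σ).mpr hv)]

variable {Sp : Set (F →+* ℝ)}

/-- Two points of `D` lie in the same connected component. -/
def SameComp (z w : SymmSpace Q Sp) : Prop := ∀ σ : Sp, SameSide (z σ) (w σ)

theorem SameComp.refl (z : SymmSpace Q Sp) : SameComp z z := fun _ => SameSide.refl _

theorem SameComp.symm {z w : SymmSpace Q Sp} (h : SameComp z w) : SameComp w z :=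
  fun σ => (h σ).symm

theorem SameComp.trans (hq : ∀ σ ∈ Sp, NegIndexTwo (realForm Q σ)) {z w u : SymmSpace Q Sp}
    (h : SameComp z w) (h' : SameComp w u) : SameComp z u :=
  fun σ => (hq σ.1 σ.2).sameSide_trans (h σ) (h' σ)

theorem sameComp_smul (γ : GSpin Q) {z w : SymmSpace Q Sp} :
    SameComp (γ • z) (γ • w) ↔ SameComp z w :=
  forall_congr' fun _ => sameSide_map _

theorem perp_singleton_iff {k E : Type*} [Field k] [LinearOrder k] [IsStrictOrderedRing k]
    [AddCommGroup E] [Module k E] {q : QuadraticForm k E} {z : OrientedNegPlane q} {s : Set E} :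
    z.Perp s ↔ ∀ y ∈ s, z.Perp {y} := by
  induction z using Quotient.inductionOn with
  | _ v =>
    simp only [perp_mk, Set.mem_singleton_iff, forall_eq]
    exact ⟨fun h y hy i => h i y hy, fun h i y hy => h y hy i⟩

/-- `z` is orthogonal to the vector `y` of `V` at all places of `Σ₊`. -/
def PerpVec (z : SymmSpace Q Sp) (y : V) : Prop :=
  ∀ σ : Sp, (z σ).Perp {(1 : RealAt σ.1) ⊗ₜ[F] y}

theorem mem_symmSub_iff {z : SymmSpace Q Sp} {W : Submodule F V} :
    z ∈ symmSub Q Sp W ↔ ∀ y ∈ W, PerpVec z y := by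
  simp only [symmSub, PerpVec, Set.mem_ofPred_eq]
  constructor
  · intro h y hy σ
    exact perp_singleton_iff.mp (h σ) _ ⟨y, hy, rfl⟩
  · intro h σ
    refine perp_singleton_iff.mpr ?_
    rintro _ ⟨y, hy, rfl⟩
    exact h y hy σ

theorem mem_symmSub_span {z : SymmSpace Q Sp} {s : Set V} :
    z ∈ symmSub Q Sp (Submodule.span F s) ↔ ∀ y ∈ s, PerpVec z y := by
  rw [mem_symmSub_iff]
  refine ⟨fun h y hy => h y (Submodule.subset_span hy), fun h y hy σ => ?_⟩
  obtain ⟨v, hv⟩ := Quotient.exists_rep (z σ)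
  rw [← hv]
  refine perp_mk.mpr fun i w hw => ?_
  rw [Set.mem_singleton_iff.mp hw]
  clear hw
  induction hy using Submodule.span_induction with
  | mem y hy =>
    have h1 := h y hy σ
    rw [← hv] at h1
    exact perp_mk.mp h1 i _ rfl
  | zero => rw [TensorProduct.tmul_zero, QuadraticMap.polar_zero_right]
  | add a b _ _ ha hb =>
    rw [TensorProduct.tmul_add, QuadraticMap.polar_add_right, ha, hb, add_zero]
  | smul c a _ ha =>
    rw [TensorProduct.tmul_smul, ← algebraMap_smul (RealAt σ.1) c,
      QuadraticMap.polar_smul_right, ha, smul_zero]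

theorem PerpVec.smul {z : SymmSpace Q Sp} {y : V} (h : PerpVec z y) (γ : GSpin Q) :
    PerpVec (γ • z) (rho Q γ y) := fun σ =>
  perp_map _ (fun _ hw => ⟨_, Set.mem_singleton _, (Set.mem_singleton_iff.mp hw).symm⟩) (h σ)

theorem perpVec_smul_iff {z : SymmSpace Q Sp} {y : V} (γ : GSpin Q) :
    PerpVec (γ • z) (rho Q γ y) ↔ PerpVec z y := by
  refine ⟨fun h => ?_, fun h => h.smul γ⟩
  have := h.smul γ⁻¹
  rwa [inv_smul_smul, map_inv, LinearEquiv.coe_inv, LinearEquiv.symm_apply_apply] at this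

theorem continuous_symm_apply (σ : Sp) : Continuous fun z : SymmSpace Q Sp => z σ :=
  continuous_apply σ

theorem isOpen_sameComp (z : SymmSpace Q Sp) : IsOpen {w | SameComp z w} := by
  have h : {w | SameComp z w} = ⋂ σ : Sp, {w : SymmSpace Q Sp | SameSide (z σ) (w σ)} := by
    ext; simp [SameComp]
  rw [h]
  exact isOpen_iInter_of_finite fun σ => (isOpen_sameSide (z σ)).preimage (continuous_symm_apply σ)

theorem isOpen_not_perpVec (y : V) : IsOpen {z : SymmSpace Q Sp | ¬ PerpVec z y} := by
  have h : {z : SymmSpace Q Sp | ¬ PerpVec z y} =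
      ⋃ σ : Sp, {z : SymmSpace Q Sp | ¬ (z σ).Perp {(1 : RealAt σ.1) ⊗ₜ[F] y}} := by
    ext; simp [PerpVec]
  rw [h]
  exact isOpen_iUnion fun σ => (isOpen_not_perp _).preimage (continuous_symm_apply σ)

/-- Orthogonality to `W` and the choice of side are imposed place by place, so the set is a product
of preconnected sets. -/
theorem isPreconnected_sameComp (hq : ∀ σ ∈ Sp, NegIndexTwo (realForm Q σ)) (z : SymmSpace Q Sp)
    (W : Submodule F V) : IsPreconnected {w | SameComp z w ∧ w ∈ symmSub Q Sp W} := by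
  have h : {w | SameComp z w ∧ w ∈ symmSub Q Sp W} = Set.univ.pi fun σ : Sp =>
      {w : OrientedNegPlane (realForm Q σ.1) | SameSide (z σ) w ∧
        w.Perp ((fun w : V => (1 : RealAt σ.1) ⊗ₜ[F] w) '' (W : Set V))} := by
    ext w
    simp only [SameComp, symmSub, Set.mem_ofPred_eq, Set.mem_univ_pi]
    exact ⟨fun h σ => ⟨h.1 σ, h.2 σ⟩, fun h => ⟨fun σ => (h σ).1, fun σ => (h σ).2⟩⟩
  rw [h]
  exact isPreconnected_univ_pi fun σ => (hq σ.1 σ.2).isPreconnected_side _ _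

theorem symmSub_bot : symmSub Q Sp ⊥ = Set.univ := by
  refine Set.eq_univ_of_forall fun z => ?_
  rw [← Submodule.span_empty]
  exact mem_symmSub_span.mpr fun y hy => hy.elim

/-- The side at each place is clopen, which bounds the component from above; the product of sides is
preconnected by the case `W = 0`. -/
theorem connectedComponent_eq (hq : ∀ σ ∈ Sp, NegIndexTwo (realForm Q σ)) (z : SymmSpace Q Sp) :
    connectedComponent z = {w | SameComp z w} := by
  refine Set.Subset.antisymm ?_ ?_
  · intro w hw σ
    have hcl : IsClopen {w : SymmSpace Q Sp | SameSide (z σ) (w σ)} :=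
      ⟨⟨((hq σ.1 σ.2).isOpen_not_sameSide (z σ)).preimage (continuous_symm_apply σ)⟩,
        (isOpen_sameSide (z σ)).preimage (continuous_symm_apply σ)⟩
    exact hcl.connectedComponent_subset (SameSide.refl (z σ)) hw
  · refine IsPreconnected.subset_connectedComponent ?_ (SameComp.refl z)
    have := isPreconnected_sameComp hq z ⊥
    simpa [symmSub_bot] using this

theorem mem_symmSubPlus_iff (hq : ∀ σ ∈ Sp, NegIndexTwo (realForm Q σ)) {z₀ z : SymmSpace Q Sp}
    {W : Submodule F V} : z ∈ symmSubPlus Q z₀ W ↔ z ∈ symmSub Q Sp W ∧ SameComp z₀ z := by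
  rw [symmSubPlus, connectedComponent_eq hq]
  rfl

theorem exists_sameComp_symmSub (hq : ∀ σ ∈ Sp, NegIndexTwo (realForm Q σ)) {n : ℕ}
    {e : Fin n → V} (he : OrthFamily Q e) (hpos : ∀ σ : F →+* ℝ, ∀ j, 0 < σ (Q (e j)))
    (z : SymmSpace Q Sp) :
    ∃ z', SameComp z z' ∧ z' ∈ symmSub Q Sp (Submodule.span F (Set.range e)) := by
  have h (σ : Sp) : ∃ z' : OrientedNegPlane (realForm Q σ.1), SameSide (z σ) z' ∧
      z'.Perp (Set.range fun j => (1 : RealAt σ.1) ⊗ₜ[F] e j) := by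
    refine (hq σ.1 σ.2).exists_perp_orthFamily ⟨fun i j hij => ?_, fun i => ?_⟩ (fun i => ?_) (z σ)
    · change QuadraticMap.polar _ _ _ = 0
      rw [polar_baseChange_tmul, he.ortho hij, map_zero]
    · rw [form_baseChange_tmul]
      exact (map_ne_zero _).mpr (he.ne_zero i)
    · rw [form_baseChange_tmul, algebraMap_realAt_pos]
      exact hpos _ i
  choose z' hz' hp using h
  refine ⟨z', hz', mem_symmSub_span.mpr ?_⟩
  rintro _ ⟨j, rfl⟩ σ
  exact perp_singleton_iff.mp (hp σ) _ ⟨j, rfl⟩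

theorem sameComp_smul_self_iff (hq : ∀ σ ∈ Sp, NegIndexTwo (realForm Q σ)) {l : List V}
    (hl : ∀ v ∈ l, Q v ≠ 0) {γ : GSpin Q} (hγ : ∀ x, rho Q γ x = reflProd Q l x)
    (z : SymmSpace Q Sp) (σ : Sp) :
    SameSide (z σ) ((γ • z) σ) ↔ 0 < σ.1 (formProd Q l) := by
  have h1 : ((rho Q γ : V →ₗ[F] V).baseChange (RealAt σ.1)) =
      (reflProd Q l).baseChange (RealAt σ.1) := congrArg _ (LinearMap.ext hγ)
  have h2 := form_baseChange Q (RealAt σ.1) (reflProd Q l) (form_reflProd Q hl)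
  rw [← sameSide_reflProd (hq σ.1 σ.2) hl h2 (z σ), ← map_congr_fun h1
    (form_baseChange Q (RealAt σ.1) _ (form_rho Q γ)) h2]
  rfl

/-- `G(ℚ)₊` is the stabilizer of a connected component of `D`. -/
theorem mem_Gplus_iff (hQ : ∀ x, (∀ y, QuadraticMap.polar Q x y = 0) → x = 0)
    (hq : ∀ σ ∈ Sp, NegIndexTwo (realForm Q σ))
    (hq' : ∀ σ ∉ Sp, ∀ y, y ≠ 0 → 0 < realForm Q σ y) (γ : GSpin Q) (z : SymmSpace Q Sp) :
    γ ∈ Gplus Q ↔ SameComp z (γ • z) := by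
  obtain ⟨l, hl, hγ, c, hc, hrev⟩ := reverse_mul_GSpin Q hQ γ
  -- At the definite places the spinor norm is positive automatically, so only the places of `Sp`
  -- impose a condition.
  have hdef : ∀ σ ∉ Sp, 0 < σ (formProd Q l) := by
    intro σ hσ
    rw [formProd, map_list_prod]
    refine List.prod_pos fun a ha => ?_
    obtain ⟨b, hb, rfl⟩ := List.mem_map.mp ha
    obtain ⟨v, hv, rfl⟩ := List.mem_map.mp hb
    have h1 : (1 : RealAt σ) ⊗ₜ[F] v ≠ 0 := by
      intro h0
      have := form_baseChange_tmul Q (RealAt σ) v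
      rw [h0, QuadraticMap.map_zero] at this
      exact (map_ne_zero (algebraMap F (RealAt σ))).mpr (hl v hv) this.symm
    have := hq' σ hσ _ h1
    rwa [form_baseChange_tmul, algebraMap_realAt_pos] at this
  have hsq (σ : F →+* ℝ) : 0 < σ (c ^ 2 * formProd Q l) ↔ 0 < σ (formProd Q l) := by
    rw [map_mul, map_pow]
    have : 0 < σ c ^ 2 := by
      have := (map_ne_zero σ).mpr hc
      positivity
    exact ⟨fun h => pos_of_mul_pos_right h this.le, fun h => mul_pos this h⟩
  have hside : SameComp z (γ • z) ↔ ∀ σ : Sp, 0 < σ.1 (formProd Q l) :=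
    forall_congr' fun σ => sameComp_smul_self_iff hq hl hγ z σ
  rw [hside]
  constructor
  · rintro ⟨a, ha, -, h⟩ σ
    have : a = c ^ 2 * formProd Q l := algebraMap_clifford_injective Q (h.symm.trans hrev)
    rw [← hsq, ← this]
    exact ha σ
  · intro h
    refine ⟨c ^ 2 * formProd Q l, fun σ => (hsq σ).mpr ?_,
      mul_ne_zero (pow_ne_zero 2 hc) (formProd_ne_zero Q hl), hrev⟩
    by_cases hσ : σ ∈ Sp
    · exact h ⟨σ, hσ⟩
    · exact hdef σ hσ

end SymmetricSpace


/-! ### Weak approximation at the real places. -/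

section WeakApproximation

variable {F : Type*} [Field F] [NumberField F]

/-- The infinite place defined by a real embedding. -/
def realPlace (σ : F →+* ℝ) : NumberField.InfinitePlace F :=
  NumberField.InfinitePlace.mk (Complex.ofRealHom.comp σ)

theorem realPlace_injective : Function.Injective (realPlace (F := F)) := by
  intro σ τ h
  have h1 : Complex.ofRealHom.comp σ = Complex.ofRealHom.comp τ := by
    rcases NumberField.InfinitePlace.mk_eq_iff.mp h with h | h
    · exact h
    · rw [← h]
      ext x
      simp [NumberField.ComplexEmbedding.conjugate_coe_eq]
  ext x
  have := RingHom.congr_fun h1 x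
  simpa using this

/-- A number field is dense in the product of its real completions. -/
theorem denseRange_realEmbeddings : DenseRange fun (a : F) (σ : F →+* ℝ) => σ a := by
  classical
  -- Weak approximation makes the diagonal dense in the product of copies of `F` with the topologies
  -- of the infinite places. The map `Φ` to the product of real lines is continuous with dense
  -- range, as each copy contains `ℚ`.
  set Φ : ((v : NumberField.InfinitePlace F) → WithAbs v.1) → (F →+* ℝ) → ℝ :=
    fun x σ => σ (x (realPlace σ)).ofAbs with hΦ
  have hcont : Continuous Φ := by
    refine continuous_pi fun σ => ?_
    have h1 : Continuous fun y : WithAbs (realPlace σ).1 => σ y.ofAbs := by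
      refine (AddMonoidHomClass.isometry_of_norm
        (σ.comp (WithAbs.equiv (realPlace σ).1).toRingHom) fun y => ?_).continuous
      have : ‖y‖ = ‖Complex.ofRealHom (σ y.ofAbs)‖ := rfl
      rw [this]
      simp
    exact h1.comp (continuous_apply (realPlace σ))
  have hdense : DenseRange Φ := by
    have h1 : DenseRange (Pi.map fun (σ : F →+* ℝ) (a : F) => σ a) := by
      refine DenseRange.piMap fun σ => ?_
      refine Dense.mono ?_ (Rat.denseRange_cast (𝕜 := ℝ))
      rintro _ ⟨r, rfl⟩
      exact ⟨(r : F), map_ratCast σ r⟩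
    refine Dense.mono ?_ h1
    rintro _ ⟨a, rfl⟩
    refine ⟨fun v => WithAbs.toAbs v.1
      (if h : ∃ σ, realPlace σ = v then a h.choose else 0), funext fun σ => ?_⟩
    have h : ∃ τ, realPlace τ = realPlace σ := ⟨σ, rfl⟩
    simp only [hΦ, dif_pos h, Pi.map_apply]
    rw [realPlace_injective h.choose_spec]
  exact hdense.comp (NumberField.InfinitePlace.denseRange_algebraMap_pi F) hcont

variable {V : Type*} [AddCommGroup V] [Module F V] [FiniteDimensional F V] {Q : QuadraticForm F V}

/-- There are vectors of `V` with prescribed sign at the real places. -/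
theorem exists_vector_of_signs (P : (F →+* ℝ) → ℝ → Prop) (hP : ∀ σ, IsOpen {t | P σ t})
    (h : ∀ σ, ∃ y : RealAt σ ⊗[F] V, P σ (realForm Q σ y)) :
    ∃ v : V, ∀ σ, P σ (σ (Q v)) := by
  set b := Module.finBasis F V
  set B := fun σ : F →+* ℝ => Algebra.TensorProduct.basis (RealAt σ) b with hB
  set f : ∀ σ : F →+* ℝ, (Fin (Module.finrank F V) → RealAt σ) → RealAt σ :=
    fun σ c => realForm Q σ (∑ i, c i • B σ i) with hf
  have hfc (σ) : Continuous (f σ) := by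
    have := IsModuleTopology.toContinuousAdd (RealAt σ) (RealAt σ ⊗[F] V)
    exact (continuous_form (realForm Q σ)).comp (continuous_finsetSum _ fun i _ =>
      (continuous_apply i).smul continuous_const)
  set U : Set (Fin (Module.finrank F V) → (F →+* ℝ) → ℝ) :=
    {c | ∀ σ, P σ (f σ fun i => c i σ)} with hU
  have hUo : IsOpen U := by
    have : U = ⋂ σ, (fun c : Fin (Module.finrank F V) → (F →+* ℝ) → ℝ => f σ fun i => c i σ) ⁻¹'
        {t | P σ t} := by ext; simp only [hU, Set.mem_iInter]; rfl
    rw [this]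
    refine isOpen_iInter_of_finite fun σ => (hP σ).preimage ((hfc σ).comp ?_)
    exact continuous_pi fun i => (continuous_apply σ).comp (continuous_apply i)
  have hUne : U.Nonempty := by
    choose y hy using h
    refine ⟨fun i σ => (B σ).repr (y σ) i, fun σ => ?_⟩
    have : f σ (fun i => (B σ).repr (y σ) i) = realForm Q σ (y σ) := by
      simp only [hf, (B σ).sum_repr]
    exact this ▸ hy σ
  -- In coordinates, `V` is dense in the product of its real completions, and the sign conditions
  -- define a non-empty open set there.
  have hd : DenseRange (Pi.map fun (_ : Fin (Module.finrank F V)) (a : F) (σ : F →+* ℝ) => σ a) :=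
    DenseRange.piMap fun _ => denseRange_realEmbeddings
  obtain ⟨a, ha⟩ := hd.exists_mem_open hUo hUne
  refine ⟨∑ i, a i • b i, fun σ => ?_⟩
  have h1 : f σ (fun i => algebraMap F (RealAt σ) (a i)) =
      algebraMap F (RealAt σ) (Q (∑ i, a i • b i)) := by
    rw [← form_baseChange_tmul, TensorProduct.tmul_sum]
    simp only [hf, hB, Algebra.TensorProduct.basis_apply, TensorProduct.tmul_smul, algebraMap_smul]
  have h2 : P σ (f σ fun i => algebraMap F (RealAt σ) (a i)) := ha σ
  rw [h1] at h2
  exact h2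

variable {Sp : Set (F →+* ℝ)}

/-- `G(ℚ)` acts transitively on the connected components of `D`. -/
theorem exists_GSpin_sameComp (hq : ∀ σ ∈ Sp, NegIndexTwo (realForm Q σ))
    (hpos : ∀ σ, ∃ y, 0 < realForm Q σ y) (z w : SymmSpace Q Sp) :
    ∃ γ : GSpin Q, SameComp w (γ • z) := by
  classical
  have hneg (σ : Sp) : ∃ y, realForm Q σ.1 y < 0 := by
    obtain ⟨v, -⟩ := Quotient.exists_rep (z σ)
    exact ⟨v.1 0, ((isNegFrame_iff _ _).mp v.2).1⟩
  obtain ⟨v₁, hv₁⟩ := exists_vector_of_signs (Q := Q) (fun _ t => 0 < t)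
    (fun _ => isOpen_lt continuous_const continuous_id) hpos
  -- The vector `v₂` is negative exactly at the places where `z` and `w` lie on different sides. The
  -- totally positive `v₁` changes no side and serves to make the number of reflections even.
  obtain ⟨v₂, hv₂⟩ := exists_vector_of_signs (Q := Q)
    (fun σ t => if ∃ h : σ ∈ Sp, ¬ SameSide (w ⟨σ, h⟩) (z ⟨σ, h⟩) then t < 0 else 0 < t)
    (fun σ => by
      split_ifs
      · exact isOpen_lt continuous_id continuous_const
      · exact isOpen_lt continuous_const continuous_id)
    (fun σ => by
      by_cases h : ∃ h : σ ∈ Sp, ¬ SameSide (w ⟨σ, h⟩) (z ⟨σ, h⟩)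
      · simp only [if_pos h]
        exact hneg ⟨σ, h.1⟩
      · simp only [if_neg h]
        exact hpos σ)
  rcases Sp.eq_empty_or_nonempty with hSp | ⟨σ₀, hσ₀⟩
  · refine ⟨1, fun σ => ?_⟩
    have := σ.2
    simp [hSp] at this
  have h1 : Q v₁ ≠ 0 := by
    intro h
    have := hv₁ σ₀
    rw [h, map_zero] at this
    exact lt_irrefl _ this
  have h2 : Q v₂ ≠ 0 := by
    intro h
    have := hv₂ σ₀
    rw [h, map_zero] at this
    split_ifs at this <;> exact lt_irrefl _ this
  have hl : ∀ v ∈ [v₁, v₂], Q v ≠ 0 := by simp [h1, h2]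
  obtain ⟨γ, -, hγ⟩ := exists_GSpin_of_reflProd Q [v₁, v₂] hl ⟨1, rfl⟩
  refine ⟨γ, fun σ => ?_⟩
  have h3 := sameComp_smul_self_iff hq hl hγ z σ
  have h4 : formProd Q [v₁, v₂] = Q v₁ * Q v₂ := by simp [formProd]
  rw [h4, map_mul, mul_pos_iff_of_pos_left (hv₁ σ)] at h3
  rw [(hq σ.1 σ.2).sameSide_iff (w σ) (z σ), h3]
  have h5 := hv₂ σ
  by_cases h : SameSide (w σ) (z σ)
  · rw [if_neg (by rintro ⟨_, h'⟩; exact h' h)] at h5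
    exact iff_of_true h h5
  · rw [if_pos ⟨σ.2, h⟩] at h5
    exact iff_of_false h h5.not_gt

end WeakApproximation


/-! ### Finiteness of the tuples orthogonal to points near a given one. -/

section Finiteness

variable {F : Type*} [Field F] [NumberField F]

/-- The finite adeles that are integral at every place form an open set. -/
theorem isOpen_integral_adeles :
    IsOpen {a : Af F | ∀ v, a v ∈ v.adicCompletionIntegers F} :=
  RestrictedProduct.isOpen_forall_mem fun v =>
    Valued.isOpen_valuationSubring (v.adicCompletion F)

/-- An element of a totally real number field that is integral at every finite place is bounded by
its real embeddings up to finitely many choices. -/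
theorem finite_integral_of_bounded [NumberField.IsTotallyReal F] (B : ℝ) :
    {a : F | (∀ v, algebraMap F (Af F) a v ∈ v.adicCompletionIntegers F) ∧
      ∀ σ : F →+* ℝ, |σ a| ≤ B}.Finite := by
  refine (NumberField.Embeddings.finite_of_norm_le F ℂ B).subset ?_
  rintro a ⟨h1, h2⟩
  refine ⟨?_, fun ψ => ?_⟩
  · have h3 : ∀ v : IsDedekindDomain.HeightOneSpectrum (𝓞 F), v.valuation F a ≤ 1 := by
      intro v
      have := h1 v
      rw [IsDedekindDomain.HeightOneSpectrum.mem_adicCompletionIntegers] at this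
      rwa [← IsDedekindDomain.HeightOneSpectrum.valuedAdicCompletion_eq_valuation']
    obtain ⟨x, rfl⟩ := IsDedekindDomain.HeightOneSpectrum.mem_integers_of_valuation_le_one F a h3
    exact NumberField.RingOfIntegers.isIntegral_coe x
  · have hr : NumberField.ComplexEmbedding.IsReal ψ :=
      NumberField.IsTotallyReal.complexEmbedding_isReal ψ
    have := h2 hr.embedding
    rw [← hr.coe_embedding_apply a, Complex.norm_real]
    exact this

/-- A compact set of finite adeles contains finitely many elements of a totally real field whose
real embeddings are bounded. -/
theorem finite_of_isCompact_of_bounded [NumberField.IsTotallyReal F] {Ω : Set (Af F)}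
    (hΩ : IsCompact Ω) (B : ℝ) :
    {a : F | algebraMap F (Af F) a ∈ Ω ∧ ∀ σ : F →+* ℝ, |σ a| ≤ B}.Finite := by
  set U : Set (Af F) := {a | ∀ v, a v ∈ v.adicCompletionIntegers F} with hU
  have hUo : IsOpen U := isOpen_integral_adeles
  have h0 : (0 : Af F) ∈ U := fun v => zero_mem (v.adicCompletionIntegers F)
  have hsub : ∀ x ∈ U, ∀ y ∈ U, x - y ∈ U := fun x hx y hy v =>
    sub_mem (hx v) (hy v)
  -- The compact set is covered by finitely many translates of the integral adeles. Inside one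
  -- translate, subtracting a fixed element `a₀` leaves integral elements bounded by `2B`.
  obtain ⟨t, -, ht⟩ := hΩ.elim_nhds_subcover (fun c => {a | a - c ∈ U}) fun c _ =>
    (hUo.preimage (continuous_id.sub continuous_const)).mem_nhds (by simpa using h0)
  refine (t.finite_toSet.biUnion (t := fun c =>
    {a : F | algebraMap F (Af F) a - c ∈ U ∧ ∀ σ : F →+* ℝ, |σ a| ≤ B}) fun c _ => ?_).subset ?_
  · rcases Set.eq_empty_or_nonempty
      {a : F | algebraMap F (Af F) a - c ∈ U ∧ ∀ σ : F →+* ℝ, |σ a| ≤ B} with h | ⟨a₀, h1, h2⟩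
    · rw [h]; exact Set.finite_empty
    · refine Set.Finite.of_finite_image (f := fun a => a - a₀)
        ((finite_integral_of_bounded (F := F) (B + B)).subset ?_) (sub_left_injective.injOn)
      rintro _ ⟨a, ⟨h3, h4⟩, rfl⟩
      refine ⟨?_, fun σ => ?_⟩
      · have := hsub _ h3 _ h1
        rw [sub_sub_sub_cancel_right, ← map_sub] at this
        exact this
      · rw [map_sub]
        exact (abs_sub _ _).trans (add_le_add (h4 σ) (h2 σ))
  · rintro a ⟨h1, h2⟩
    obtain ⟨c, hc, hac⟩ := Set.mem_iUnion₂.mp (ht h1)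
    exact Set.mem_iUnion₂.mpr ⟨c, hc, hac, h2⟩

variable {V : Type*} [AddCommGroup V] [Module F V] [FiniteDimensional F V] {Q : QuadraticForm F V}
  {Sp : Set (F →+* ℝ)}

/-- The crude estimate `|c| ≤ c² + 1` avoids a square root. -/
theorem abs_le_of_mul_sq_le {ε c t : ℝ} (hε : 0 < ε) (h : ε * c ^ 2 ≤ t) : |c| ≤ t / ε + 1 := by
  have h1 : c ^ 2 ≤ t / ε := by rw [le_div_iff₀ hε]; linarith
  have h2 : |c| ≤ c ^ 2 + 1 := by
    rw [← sq_abs]; nlinarith [sq_nonneg (|c| - 1), abs_nonneg c]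
  linarith

/-- Locally on `D`, the vectors orthogonal to a point have bounded coordinates in terms of
the quadratic form. -/
theorem exists_nhds_coord_bounded (hq : ∀ σ ∈ Sp, NegIndexTwo (realForm Q σ))
    (hq' : ∀ σ ∉ Sp, ∀ y, y ≠ 0 → 0 < realForm Q σ y) {κ : Type*} [Fintype κ]
    (b : Module.Basis κ F V) (z : SymmSpace Q Sp) (σ : F →+* ℝ) :
    ∃ ε : ℝ, 0 < ε ∧ ∀ᶠ z' in 𝓝 z, ∀ y : V, PerpVec z' y → ∀ i,
      |σ (b.repr y i)| ≤ σ (Q y) / ε + 1 := by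
  have key (y : V) (i : κ) : (Algebra.TensorProduct.basis (RealAt σ) b).repr (1 ⊗ₜ y) i =
      algebraMap F (RealAt σ) (b.repr y i) := by
    rw [Algebra.TensorProduct.basis_repr_tmul, one_smul]
    rfl
  by_cases hσ : σ ∈ Sp
  · obtain ⟨ε, hε, h⟩ := (hq σ hσ).exists_nhds_bounded
      (Algebra.TensorProduct.basis (RealAt σ) b) (z ⟨σ, hσ⟩)
    refine ⟨ε, hε, ?_⟩
    have h1 := (continuous_symm_apply (Q := Q) (⟨σ, hσ⟩ : Sp)).continuousAt (x := z) |>.eventually h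
    filter_upwards [h1] with z' hz' y hy i
    have h2 := hz' _ (hy ⟨σ, hσ⟩) i
    rw [key, form_baseChange_tmul] at h2
    exact abs_le_of_mul_sq_le hε h2
  -- At a definite place no orthogonality is needed: the bound is applied to the empty tuple.
  · obtain ⟨ε, hε, h⟩ := eventually_bounded_of_perp (q := realForm Q σ)
      (Algebra.TensorProduct.basis (RealAt σ) b) (Fin.elim0 : Fin 0 → _)
      fun y hy _ => hq' σ hσ y hy
    refine ⟨ε, hε, Filter.Eventually.of_forall fun z' y _ i => ?_⟩
    have h2 := h.self_of_nhds (1 ⊗ₜ y) (fun i => i.elim0) i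
    rw [key, form_baseChange_tmul] at h2
    exact abs_le_of_mul_sq_le hε h2

/-- Locally on `D`, a compact set of `V(𝔸_f)^n` contains finitely many tuples of vectors of `V` with
a given Gram matrix that are orthogonal to a point. -/
theorem exists_nhds_finite_hyperboloid [NumberField.IsTotallyReal F]
    (hq : ∀ σ ∈ Sp, NegIndexTwo (realForm Q σ))
    (hq' : ∀ σ ∉ Sp, ∀ y, y ≠ 0 → 0 < realForm Q σ y) {n : ℕ} (T : Matrix (Fin n) (Fin n) F)
    {Ω : Set (Fin n → Af F ⊗[F] V)} (hΩ : IsCompact Ω) (z : SymmSpace Q Sp) :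
    ∃ N ∈ 𝓝 z, {y : Fin n → V | y ∈ hyperboloid Q T ∧ toVAf y ∈ Ω ∧
      ∃ z' ∈ N, ∀ i, PerpVec z' (y i)}.Finite := by
  classical
  set b := Module.finBasis F V with hb
  choose ε hε hN using exists_nhds_coord_bounded hq hq' b z
  refine ⟨_, Filter.eventually_all.mpr hN, ?_⟩
  -- On the hyperboloid `Q(y_i) = T_ii` is fixed, so the bounds depend only on `σ` and `i` and have
  -- a common maximum.
  obtain ⟨B, hB⟩ := (Set.finite_range fun p : (F →+* ℝ) × Fin n =>
    p.1 (T p.2 p.2) / ε p.1 + 1).bddAbove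
  set A := fun (i : Fin n) (j : Fin (Module.finrank F V)) =>
    {a : F | algebraMap F (Af F) a ∈ (fun x : Fin n → Af F ⊗[F] V =>
      (Algebra.TensorProduct.basis (Af F) b).repr (x i) j) '' Ω ∧ ∀ σ : F →+* ℝ, |σ a| ≤ B} with hA
  have hAf (i j) : (A i j).Finite := by
    refine finite_of_isCompact_of_bounded (hΩ.image ?_) B
    have : IsModuleTopology (Af F) (Af F ⊗[F] V) := ⟨rfl⟩
    have h1 : Continuous ((Algebra.TensorProduct.basis (Af F) b).coord j) :=
      IsModuleTopology.continuous_of_linearMap _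
    exact h1.comp (continuous_apply i)
  have hfin : (Set.univ.pi fun i => Set.univ.pi fun j => A i j).Finite :=
    Set.Finite.pi fun i => Set.Finite.pi fun j => hAf i j
  refine Set.Finite.of_finite_image (f := fun y i j => b.repr (y i) j) (hfin.subset ?_) ?_
  · rintro _ ⟨y, ⟨h1, h2, z', h3, h4⟩, rfl⟩ i - j -
    refine ⟨⟨_, h2, ?_⟩, fun σ => ?_⟩
    · change (Algebra.TensorProduct.basis (Af F) b).repr (1 ⊗ₜ y i) j = _
      rw [Algebra.TensorProduct.basis_repr_tmul, one_smul]
      rfl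
    · refine (h3 σ (y i) (h4 i) j).trans ?_
      have h5 : Q (y i) = T i i := by
        have := h1 i i
        rw [polar_self_eq] at this
        exact mul_left_cancel₀ two_ne_zero this
      rw [h5]
      exact hB ⟨(σ, i), rfl⟩
  · intro x _ y _ hxy
    funext i
    exact b.repr.injective (Finsupp.ext fun j => congrFun (congrFun hxy i) j)

end Finiteness


/-! ### Topology of the adelic group, its action, and stabilizers of tuples. -/

section AdelicTopology

/-- Two-sided multiplication is continuous on `GSpin`, for the topology of the units of the Clifford
algebra. -/
theorem continuous_mul_mul_GSpin {R M : Type*} [CommRing R] [TopologicalSpace R]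
    [IsTopologicalRing R] [AddCommGroup M] [Module R M] (q : QuadraticForm R M) (a b : GSpin q) :
    Continuous fun x : GSpin q => a * x * b := by
  have hm : IsModuleTopology R (CliffordAlgebra q) := ⟨rfl⟩
  have hadd := IsModuleTopology.toContinuousAdd R (CliffordAlgebra q)
  have key (c d : CliffordAlgebra q) : Continuous fun x : CliffordAlgebra q => c * x * d :=
    IsModuleTopology.continuous_of_linearMap (R := R)
      ((LinearMap.mulRight R d).comp (LinearMap.mulLeft R c))
  refine Continuous.subtype_mk (Units.continuous_iff.mpr ⟨?_, ?_⟩) _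
  · exact (key (a : (CliffordAlgebra q)ˣ) (b : (CliffordAlgebra q)ˣ)).comp (Units.continuous_val.comp continuous_subtype_val)
  · have h := (key ((b⁻¹ : GSpin q) : (CliffordAlgebra q)ˣ)
      ((a⁻¹ : GSpin q) : (CliffordAlgebra q)ˣ)).comp
      ((Units.continuous_iff.mp continuous_id).2.comp
        (continuous_subtype_val (p := fun x => x ∈ GSpin q)))
    convert h using 2 with x
    simp [mul_assoc]

variable {F : Type*} [Field F] [NumberField F] {V : Type*} [AddCommGroup V] [Module F V]
  (Q : QuadraticForm F V) {K : Subgroup (GAf Q)}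

theorem isOpen_mul_mul_mem (hK : IsOpen (K : Set (GAf Q))) (a b : GAf Q) :
    IsOpen {x : GAf Q | a * x * b ∈ K} :=
  hK.preimage (continuous_mul_mul_GSpin (adelicForm Q) a b)

theorem continuous_actA {n : ℕ} (a : GAf Q) :
    Continuous (actA Q a : (Fin n → Af F ⊗[F] V) → _) :=
  have : IsModuleTopology (Af F) (Af F ⊗[F] V) := ⟨rfl⟩
  have := IsModuleTopology.toContinuousAdd (Af F) (Af F ⊗[F] V)
  continuous_pi fun i => (IsModuleTopology.continuous_of_linearMap (R := Af F)
    (rho (adelicForm Q) a : Af F ⊗[F] V →ₗ[Af F] Af F ⊗[F] V)).comp (continuous_apply i)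

variable {Q}

theorem actA_mul {n : ℕ} (a b : GAf Q) (x : Fin n → Af F ⊗[F] V) :
    actA Q (a * b) x = actA Q a (actA Q b x) := by
  funext i
  simp [actA]

theorem actA_one {n : ℕ} (x : Fin n → Af F ⊗[F] V) : actA Q 1 x = x := by
  funext i
  simp [actA]

theorem actA_toGAf {n : ℕ} (γ : GSpin Q) (x : Fin n → V) :
    actA Q (toGAf Q γ) (toVAf x) = toVAf fun i => rho Q γ (x i) := by
  funext i
  exact rho_gspinBC Q (Af F) γ (x i)

/-- The stabilizer of the span is the stabilizer of the tuple. This is what translates between `H`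
and orbits of `x₀`. -/
theorem mem_HAf_span {n : ℕ} {x : Fin n → V} {h : GAf Q} :
    h ∈ HAf Q (Submodule.span F (Set.range x)) ↔ actA Q h (toVAf x) = toVAf x := by
  constructor
  · intro hh
    funext i
    exact hh _ ⟨x i, Submodule.subset_span ⟨i, rfl⟩, rfl⟩
  · rintro hh _ ⟨w, hw, rfl⟩
    change rho (adelicForm Q) h (1 ⊗ₜ w) = 1 ⊗ₜ w
    induction hw using Submodule.span_induction with
    | mem y hy =>
      obtain ⟨i, rfl⟩ := hy
      exact congrFun hh i
    | zero => simp
    | add y y' _ _ h1 h2 => rw [TensorProduct.tmul_add, map_add, h1, h2]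
    | smul c y _ h1 =>
      rw [TensorProduct.tmul_smul, ← algebraMap_smul (Af F) c, map_smul, h1]

theorem mem_HQ_span {n : ℕ} {x : Fin n → V} {γ : GSpin Q} :
    γ ∈ HQ Q (Submodule.span F (Set.range x)) ↔ ∀ i, rho Q γ (x i) = x i := by
  constructor
  · intro hγ i
    exact hγ _ (Submodule.subset_span ⟨i, rfl⟩)
  · intro hγ w hw
    induction hw using Submodule.span_induction with
    | mem y hy =>
      obtain ⟨i, rfl⟩ := hy
      exact hγ i
    | zero => simp
    | add y y' _ _ h1 h2 => rw [map_add, h1, h2]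
    | smul c y _ h1 => rw [map_smul, h1]

theorem toGAf_mem_HAf {W : Submodule F V} {γ : GSpin Q} (hγ : γ ∈ HQ Q W) :
    toGAf Q γ ∈ HAf Q W := by
  rintro _ ⟨w, hw, rfl⟩
  exact (rho_gspinBC Q (Af F) γ w).trans (by rw [hγ w hw])

end AdelicTopology

/-! ### Connected components of the source of the natural map. -/

section Components

variable {F : Type*} [Field F] [NumberField F] {V : Type*} [AddCommGroup V] [Module F V]
  [FiniteDimensional F V] {Q : QuadraticForm F V} {K : Subgroup (GAf Q)} {Sp : Set (F →+* ℝ)}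
  {W : Submodule F V} {g : GAf Q}

/-- The class of `(z, h)` in `H(ℚ) \ D_W × H(𝔸_f) / K_{H,g}`. -/
def natPt (K : Subgroup (GAf Q)) (g : GAf Q) (p : symmSub Q Sp W × HAf Q W) :
    NatSource Q K Sp W g := Quotient.mk (natSetoid Q K Sp W g) p

theorem natMap_natPt (p : symmSub Q Sp W × HAf Q W) :
    natMap Q K Sp W g (natPt K g p) = pt Q K p.1.1 ((p.2 : GAf Q) * g) := rfl

/-- `p` and `q` are related if, up to the action of `H(ℚ)` and `K_{H,g}`, they lie in the same
connected component of `D_W`. -/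
def NatRel (K : Subgroup (GAf Q)) (g : GAf Q) (p q : symmSub Q Sp W × HAf Q W) : Prop :=
  ∃ η ∈ HQ Q W, ∃ k ∈ HAf Q W, g⁻¹ * k * g ∈ K ∧ (q.2 : GAf Q) = toGAf Q η * p.2 * k ∧
    SameComp (η • p.1.1) q.1.1

theorem NatRel.of_sameComp {p q : symmSub Q Sp W × HAf Q W} (h : SameComp p.1.1 q.1.1)
    (h2 : p.2 = q.2) : NatRel K g p q :=
  ⟨1, one_mem _, 1, one_mem _, by simp [K.one_mem], by simp [h2], by simpa using h⟩

theorem NatRel.trans (hq : ∀ σ ∈ Sp, NegIndexTwo (realForm Q σ))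
    {p q r : symmSub Q Sp W × HAf Q W} (h : NatRel K g p q) (h' : NatRel K g q r) :
    NatRel K g p r := by
  obtain ⟨η, hη, k, hk, hkK, h1, h2⟩ := h
  obtain ⟨θ, hθ, l, hl, hlK, h3, h4⟩ := h'
  refine ⟨θ * η, mul_mem hθ hη, k * l, mul_mem hk hl, ?_, ?_, ?_⟩
  · have := K.mul_mem hkK hlK
    simpa [mul_assoc] using this
  · rw [h3, h1, map_mul]
    simp only [mul_assoc]
  · rw [mul_smul]
    exact ((sameComp_smul θ).mpr h2).trans hq h4

theorem NatRel.symm {p q : symmSub Q Sp W × HAf Q W} (h : NatRel K g p q) : NatRel K g q p := by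
  obtain ⟨η, hη, k, hk, hkK, h1, h2⟩ := h
  refine ⟨η⁻¹, inv_mem hη, k⁻¹, inv_mem hk, ?_, by rw [h1, map_inv]; group, ?_⟩
  · have := K.inv_mem hkK
    simpa [mul_assoc] using this
  · rw [← sameComp_smul η, smul_inv_smul]
    exact h2.symm

theorem natRel_of_natPt_eq {p q : symmSub Q Sp W × HAf Q W} (h : natPt K g p = natPt K g q) :
    NatRel K g p q := by
  obtain ⟨η, hη, k, hk, hkK, h1, h2⟩ := Quotient.exact h
  exact ⟨η, hη, k, hk, hkK, h2, h1 ▸ SameComp.refl _⟩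

theorem isOpen_natRel (hK : IsOpen (K : Set (GAf Q))) (p : symmSub Q Sp W × HAf Q W) :
    IsOpen {q : symmSub Q Sp W × HAf Q W | SameComp p.1.1 q.1.1 ∧
      g⁻¹ * (p.2 : GAf Q)⁻¹ * (q.2 : GAf Q) * g ∈ K} :=
  ((isOpen_sameComp p.1.1).preimage (continuous_subtype_val.comp continuous_fst)).inter
    ((isOpen_mul_mul_mem Q hK (g⁻¹ * (p.2 : GAf Q)⁻¹) g).preimage
      (continuous_subtype_val.comp continuous_snd))

/-- Since `K` is open, a nearby `h'` differs from `h` on the right by an element of `K_{H,g}`, and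
components of `D` are open. -/
theorem natRel_eventually (hK : IsOpen (K : Set (GAf Q))) (p : symmSub Q Sp W × HAf Q W) :
    ∀ᶠ q in 𝓝 p, NatRel K g p q := by
  filter_upwards [(isOpen_natRel (g := g) hK p).mem_nhds
    ⟨SameComp.refl _, by simp [mul_assoc, K.one_mem]⟩] with q hq
  refine ⟨1, one_mem _, (p.2 : GAf Q)⁻¹ * q.2, mul_mem (inv_mem p.2.2) q.2.2, ?_, ?_, ?_⟩
  · simpa [mul_assoc] using hq.2
  · simp
  · simpa using hq.1

/-- The connected components of `H(ℚ) \ D_W × H(𝔸_f) / K_{H,g}`. -/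
theorem connectedComponents_mk_natPt_eq_iff (hq : ∀ σ ∈ Sp, NegIndexTwo (realForm Q σ))
    (hK : IsOpen (K : Set (GAf Q))) {p q : symmSub Q Sp W × HAf Q W} :
    (ConnectedComponents.mk (natPt K g p) = ConnectedComponents.mk (natPt K g q)) ↔
      NatRel K g p q := by
  have hcont : Continuous (natPt (Q := Q) (Sp := Sp) (W := W) K g) := continuous_quotient_mk'
  rw [ConnectedComponents.coe_eq_coe']
  constructor
  · intro h
    -- The classes of an equivalence relation with open classes are clopen; this set is saturated,
    -- so it is clopen in the quotient.
    set S : Set (NatSource Q K Sp W g) := {c | ∃ r, natPt K g r = c ∧ NatRel K g q r} with hS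
    have hpre : natPt K g ⁻¹' S = {r | NatRel K g q r} := by
      ext r
      constructor
      · rintro ⟨r', hr', hr⟩
        exact hr.trans hq (natRel_of_natPt_eq hr')
      · exact fun hr => ⟨r, rfl, hr⟩
    have hquot : IsQuotientMap (natPt (Q := Q) (Sp := Sp) (W := W) K g) := isQuotientMap_quotient_mk'
    have hclopen : IsClopen S := by
      refine ⟨⟨?_⟩, ?_⟩
      · rw [← hquot.isOpen_preimage, Set.preimage_compl, hpre, isOpen_iff_mem_nhds]
        intro r hr
        filter_upwards [natRel_eventually (g := g) hK r] with r' hr' hr''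
        exact hr (hr''.trans hq hr'.symm)
      · rw [← hquot.isOpen_preimage, hpre, isOpen_iff_mem_nhds]
        intro r hr
        filter_upwards [natRel_eventually (g := g) hK r] with r' hr'
        exact NatRel.trans hq hr hr'
    have h1 : natPt K g p ∈ S := hclopen.connectedComponent_subset
      ⟨q, rfl, NatRel.of_sameComp (SameComp.refl _) rfl⟩ h
    have h2 : p ∈ natPt K g ⁻¹' S := h1
    rw [hpre] at h2
    exact NatRel.symm h2
  · intro h
    obtain ⟨η, hη, k, hk, hkK, h1, h2⟩ := h.symm
    have hηW : η • q.1.1 ∈ symmSub Q Sp W := by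
      rw [mem_symmSub_iff]
      intro y hy
      rw [← hη y hy]
      exact (mem_symmSub_iff.mp q.1.2 y hy).smul η
    -- Another representative of the class of `q`, with the same adelic coordinate as `p`. It is
    -- joined to `p` through the connected part of `D_W` on one component of `D`.
    set q' : symmSub Q Sp W × HAf Q W := (⟨η • q.1.1, hηW⟩, p.2) with hq'
    have h3 : natPt K g q = natPt K g q' := Quotient.sound ⟨η, hη, k, hk, hkK, rfl, h1⟩
    set ψ : {w // SameComp p.1.1 w ∧ w ∈ symmSub Q Sp W} → NatSource Q K Sp W g :=
      fun w => natPt K g (⟨w.1, w.2.2⟩, p.2) with hψ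
    have hψc : Continuous ψ := hcont.comp
      ((continuous_subtype_val.subtype_mk _).prodMk continuous_const)
    have hpre : IsPreconnected (Set.range ψ) := by
      have : PreconnectedSpace {w // SameComp p.1.1 w ∧ w ∈ symmSub Q Sp W} :=
        Subtype.preconnectedSpace (isPreconnected_sameComp hq p.1.1 W)
      exact isPreconnected_range hψc
    rw [h3]
    exact hpre.subset_connectedComponent ⟨⟨η • q.1.1, h2.symm, hηW⟩, rfl⟩
      ⟨⟨p.1.1, SameComp.refl _, p.1.2⟩, rfl⟩

end Components


/-! ### The use of neatness. -/

section Neat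

variable {F : Type*} [Field F] [CharZero F] {V : Type*} [AddCommGroup V] [Module F V]
  [FiniteDimensional F V]

open Polynomial in
/-- An element of a neat group fixes every vector that is fixed by one of its powers. -/
theorem IsNeat.apply_eq_of_pow_apply_eq {Γ : Subgroup (V ≃ₗ[F] V)} (hΓ : IsNeat Γ)
    {γ : V ≃ₗ[F] V} (hγ : γ ∈ Γ) {i : ℕ} (hi : 0 < i) {x : V} (hx : (γ ^ i) x = x) : γ x = x := by
  set f : Module.End F V := (γ : V →ₗ[F] V) with hf
  set r : F[X] := ∑ j ∈ Finset.range i, X ^ j with hr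
  -- A common root would be an eigenvalue that is an `i`-th root of unity, hence `1` by neatness,
  -- but `1 + X + ⋯ + X^(i-1)` takes the value `i ≠ 0` at `1`.
  have hcop : IsCoprime (LinearMap.charpoly f) r := by
    rw [isCoprime_iff_aeval_ne_zero_of_isAlgClosed F (AlgebraicClosure F)]
    intro a
    by_contra! h
    obtain ⟨h1, h2⟩ := h
    have h3 : ∑ j ∈ Finset.range i, a ^ j = 0 := by simpa [hr] using h2
    have h4 : a ^ i = 1 := by
      have := geom_sum_mul a i
      rw [h3, zero_mul] at this
      exact (sub_eq_zero.mp this.symm)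
    have ha : a ≠ 0 := by
      rintro rfl
      rw [zero_pow hi.ne'] at h4
      exact zero_ne_one h4
    have h5 : Units.mk0 a ha = 1 := by
      refine hΓ γ hγ (Units.mk0 a ha) (Subgroup.subset_closure ?_) i hi (Units.ext (by simpa))
      change IsRoot _ a
      rw [IsRoot, eval_map_algebraMap]
      exact h1
    have h6 : a = 1 := congrArg Units.val h5
    rw [h6] at h3
    simp [hi.ne'] at h3
  have hpow (j : ℕ) : (f ^ j) x = (γ ^ j) x := by
    induction j with
    | zero => rfl
    | succ j ih => rw [pow_succ', pow_succ', Module.End.mul_apply, ih]; rfl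
  have hrf : aeval f r (f x - x) = 0 := by
    have h1 : aeval f r * (f - 1) = f ^ i - 1 := by
      rw [← geom_sum_mul, hr]
      simp
    have h2 := LinearMap.congr_fun h1 x
    rw [LinearMap.sub_apply, hpow, hx] at h2
    simpa using h2
  -- The vector `γ x - x` is killed by the characteristic polynomial (Cayley–Hamilton) and by `r`,
  -- so a Bézout relation shows that it vanishes.
  obtain ⟨s, t, hst⟩ := hcop
  have h1 := congrArg (fun p => aeval f p (f x - x)) hst
  simp only [map_add, map_mul, LinearMap.aeval_self_charpoly, mul_zero, zero_add, map_one,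
    Module.End.mul_apply, hrf, map_zero, Module.End.one_apply] at h1
  exact (sub_eq_zero.mp h1.symm)

end Neat

/-! ### Tuples of non-zero weight orthogonal to a point. -/

section SpecialTuples

variable {F : Type*} [Field F] [NumberField F] {V : Type*} [AddCommGroup V] [Module F V]
  [FiniteDimensional F V] {Q : QuadraticForm F V} {Sp : Set (F →+* ℝ)}

/-- The conditions on the real quadratic spaces `V ⊗_{F,σ} ℝ`, together with the non-degeneracy
of `V`, that are used from here on. -/
structure IsShimuraForm (Q : QuadraticForm F V) (Sp : Set (F →+* ℝ)) : Prop where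
  nondegenerate : ∀ x, (∀ y, QuadraticMap.polar Q x y = 0) → x = 0
  negIndexTwo : ∀ σ ∈ Sp, NegIndexTwo (realForm Q σ)
  pos_def : ∀ σ ∉ Sp, ∀ y, y ≠ 0 → 0 < realForm Q σ y
  exists_pos : ∀ σ, ∃ y, 0 < realForm Q σ y
  nonempty : Sp.Nonempty

theorem IsShimuraForm.mem_Gplus_iff (hQ : IsShimuraForm Q Sp) (γ : GSpin Q)
    (z : SymmSpace Q Sp) : γ ∈ Gplus Q ↔ SameComp z (γ • z) :=
  OrthShimura.mem_Gplus_iff hQ.nondegenerate hQ.negIndexTwo hQ.pos_def γ z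

theorem IsShimuraForm.nonempty_embeddings (hQ : IsShimuraForm Q Sp) : Nonempty (F →+* ℝ) :=
  ⟨hQ.nonempty.some⟩

variable {n : ℕ} {T : Matrix (Fin n) (Fin n) F} {φ : (Fin n → Af F ⊗[F] V) → ℂ}
  {K : Subgroup (GAf Q)}

/-- The tuples `y` in the hyperboloid that are orthogonal to `z` and satisfy `φ(b⁻¹ y) ≠ 0`. -/
def specialTuples (T : Matrix (Fin n) (Fin n) F) (φ : (Fin n → Af F ⊗[F] V) → ℂ)
    (z : SymmSpace Q Sp) (b : GAf Q) : Set (Fin n → V) :=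
  {y | y ∈ hyperboloid Q T ∧ φ (actA Q b⁻¹ (toVAf y)) ≠ 0 ∧ ∀ i, PerpVec z (y i)}

theorem specialTuples_mul_right (hφK : ∀ k ∈ K, ∀ x, φ (actA Q k x) = φ x) (z : SymmSpace Q Sp)
    (b : GAf Q) {k : GAf Q} (hk : k ∈ K) :
    specialTuples T φ z (b * k) = specialTuples T φ z b := by
  simp only [specialTuples, mul_inv_rev, actA_mul, hφK _ (K.inv_mem hk)]

theorem rho_mem_hyperboloid {x : Fin n → V} (hx : x ∈ hyperboloid Q T) (γ : GSpin Q) :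
    (fun i => rho Q γ (x i)) ∈ hyperboloid Q T := by
  intro i j
  rw [← hx i j]
  simp only [QuadraticMap.polar, ← map_add, form_rho]

theorem rho_mem_specialTuples {z : SymmSpace Q Sp} {b : GAf Q} {y : Fin n → V}
    (hy : y ∈ specialTuples T φ z b) (γ : GSpin Q) :
    (fun i => rho Q γ (y i)) ∈ specialTuples T φ (γ • z) (toGAf Q γ * b) := by
  refine ⟨rho_mem_hyperboloid hy.1 γ, ?_, fun i => (hy.2.2 i).smul γ⟩
  rw [← actA_toGAf, ← actA_mul]
  simpa using hy.2.1

theorem exists_nhds_specialTuples [NumberField.IsTotallyReal F] (hQ : IsShimuraForm Q Sp)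
    (hφc : HasCompactSupport φ) (z : SymmSpace Q Sp) (b : GAf Q) :
    ∃ N ∈ 𝓝 z, {y | ∃ z' ∈ N, y ∈ specialTuples T φ z' b}.Finite := by
  obtain ⟨N, hN, h⟩ := exists_nhds_finite_hyperboloid hQ.negIndexTwo hQ.pos_def T
    (hφc.isCompact.image (continuous_actA Q b)) z
  refine ⟨N, hN, h.subset ?_⟩
  rintro y ⟨z', hz', hy⟩
  refine ⟨hy.1, ⟨_, subset_tsupport φ hy.2.1, ?_⟩, z', hz', hy.2.2⟩
  rw [← actA_mul, mul_inv_cancel, actA_one]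

theorem finite_specialTuples [NumberField.IsTotallyReal F] (hQ : IsShimuraForm Q Sp)
    (hφc : HasCompactSupport φ) (z : SymmSpace Q Sp) (b : GAf Q) :
    (specialTuples T φ z b).Finite := by
  obtain ⟨N, hN, h⟩ := exists_nhds_specialTuples (T := T) hQ hφc z b
  exact h.subset fun y hy => ⟨z, mem_of_mem_nhds hN, hy⟩

/-- Near `z` only finitely many tuples can occur at all, and failing to be orthogonal is an open
condition. So near `z` no new special tuple appears. -/
theorem eventually_specialTuples_subset [NumberField.IsTotallyReal F] (hQ : IsShimuraForm Q Sp)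
    (hφc : HasCompactSupport φ) (z : SymmSpace Q Sp) (b : GAf Q) :
    ∀ᶠ z' in 𝓝 z, specialTuples T φ z' b ⊆ specialTuples T φ z b := by
  obtain ⟨N, hN, h⟩ := exists_nhds_specialTuples (T := T) hQ hφc z b
  have h1 : ∀ᶠ z' in 𝓝 z, ∀ y ∈ {y | ∃ z' ∈ N, y ∈ specialTuples T φ z' b}, ∀ i,
      PerpVec z' (y i) → PerpVec z (y i) := by
    refine (Filter.eventually_all_finite h).mpr fun y _ => Filter.eventually_all.mpr fun i => ?_
    by_cases hi : PerpVec z (y i)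
    · exact Filter.Eventually.of_forall fun _ _ => hi
    · filter_upwards [(isOpen_not_perpVec (y i)).mem_nhds hi] with z' hz' h'
      exact absurd h' hz'
  filter_upwards [h1, hN] with z' hz' hz'N y hy
  exact ⟨hy.1, hy.2.1, fun i => hz' y ⟨z', hz'N, hy⟩ i (hy.2.2 i)⟩

theorem finrank_span_of_mem_hyperboloid [Nonempty (F →+* ℝ)]
    (hT : ∀ σ : F →+* ℝ, (T.map σ).PosDef) {x : Fin n → V} (hx : x ∈ hyperboloid Q T) :
    Module.finrank F (Submodule.span F (Set.range x)) = n := by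
  obtain ⟨e, he, -, hspan⟩ := exists_orthFamily_of_hyperboloid hT hx
  rw [← hspan]
  have hli : LinearIndependent F e := by
    rw [Fintype.linearIndependent_iff]
    intro c hc i
    have h1 : QuadraticMap.polar Q (e i) (∑ j, c j • e j) = 0 := by
      rw [hc, QuadraticMap.polar_zero_right]
    rw [← QuadraticMap.polarBilin_apply_apply, map_sum, Finset.sum_eq_single i] at h1
    · simp only [map_smul, QuadraticMap.polarBilin_apply_apply, polar_self_eq, smul_eq_mul] at h1
      rcases mul_eq_zero.mp h1 with h | h
      · exact h
      · exact absurd h (mul_ne_zero two_ne_zero (he.ne_zero i))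
    · intro j _ hj
      simp [he.ortho hj.symm]
    · simp
  rw [finrank_span_eq_card hli, Fintype.card_fin]

/-- A vector orthogonal to a definite subspace, but to none of finitely many vectors outside. -/
theorem OrthFamily.exists_forall_polar_ne_zero {e : Fin n → V} (he : OrthFamily Q e)
    (hQ : ∀ x, (∀ y, QuadraticMap.polar Q x y = 0) → x = 0) {S : Set V} (hS : S.Finite)
    (hSe : ∀ u ∈ S, u ∉ Submodule.span F (Set.range e)) :
    ∃ y, (∀ w ∈ Submodule.span F (Set.range e), QuadraticMap.polar Q y w = 0) ∧
      ∀ u ∈ S, QuadraticMap.polar Q y u ≠ 0 := by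
  classical
  set P : Submodule F V :=
    { carrier := {y | ∀ w ∈ Submodule.span F (Set.range e), QuadraticMap.polar Q y w = 0}
      zero_mem' := fun w _ => by simp
      add_mem' := fun {a b} ha hb w hw => by
        rw [QuadraticMap.polar_add_left, ha w hw, hb w hw, add_zero]
      smul_mem' := fun c a ha w hw => by
        rw [QuadraticMap.polar_smul_left, ha w hw, smul_zero] } with hP
  -- Each `u` excludes a proper subspace of the orthogonal complement, and finitely many proper
  -- subspaces over an infinite field do not cover it.
  set L : V → Submodule F P := fun u =>
    LinearMap.ker ((QuadraticMap.polarBilin Q).flip u ∘ₗ P.subtype) with hL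
  have hmem (u : V) (y : P) : y ∈ L u ↔ QuadraticMap.polar Q y.1 u = 0 := Iff.rfl
  have htop : ⊤ ∉ hS.toFinset.image L := by
    intro h
    obtain ⟨u, hu, htop⟩ := Finset.mem_image.mp h
    obtain ⟨y, hy, hyu⟩ := he.exists_polar_ne_zero hQ (hSe u (hS.mem_toFinset.mp hu))
    have : (⟨y, hy⟩ : P) ∈ L u := htop ▸ Submodule.mem_top
    exact hyu ((hmem _ _).mp this)
  have hne := Subspace.biUnion_ne_univ_of_top_notMem htop
  obtain ⟨y, hy⟩ := (Set.ne_univ_iff_exists_notMem _).mp hne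
  refine ⟨y.1, y.2, fun u hu h => hy ?_⟩
  exact Set.mem_iUnion₂.mpr ⟨L u, Finset.mem_image_of_mem L (hS.mem_toFinset.mpr hu),
    (hmem u y).mpr h⟩

/-- The points of `D_W` near `z` that are orthogonal to none of finitely many vectors outside `W`
accumulate at `z`. -/
theorem exists_mem_symmSub_not_perpVec (hQ : IsShimuraForm Q Sp) {e : Fin n → V}
    (he : OrthFamily Q e) {z : SymmSpace Q Sp}
    (hz : z ∈ symmSub Q Sp (Submodule.span F (Set.range e))) {S : Set V} (hS : S.Finite)
    (hSe : ∀ u ∈ S, u ∉ Submodule.span F (Set.range e)) {N : Set (SymmSpace Q Sp)} (hN : N ∈ 𝓝 z) :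
    ∃ z' ∈ N, z' ∈ symmSub Q Sp (Submodule.span F (Set.range e)) ∧ ∀ u ∈ S, ¬ PerpVec z' u := by
  classical
  obtain ⟨y, hy, hyS⟩ := he.exists_forall_polar_ne_zero hQ.nondegenerate hS hSe
  -- Orthogonality is required at all places of `Sp`, so moving the component at one of them is
  -- enough to destroy it.
  obtain ⟨σ, hσ⟩ := hQ.nonempty
  have hupd : Continuous fun w : OrientedNegPlane (realForm Q σ) =>
      (Function.update z ⟨σ, hσ⟩ w : SymmSpace Q Sp) := continuous_const.update _ continuous_id
  have hN' : {w | (Function.update z ⟨σ, hσ⟩ w : SymmSpace Q Sp) ∈ N} ∈ 𝓝 (z ⟨σ, hσ⟩) := by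
    refine hupd.continuousAt ?_
    rwa [Function.update_eq_self]
  obtain ⟨w, hwN, hw, hwS⟩ := exists_perturbation (hz ⟨σ, hσ⟩) (e := 1 ⊗ₜ y)
    (S := (fun u : V => (1 : RealAt σ) ⊗ₜ[F] u) '' S) (by
      rintro _ ⟨v, hv, rfl⟩
      change QuadraticMap.polar (realForm Q σ) (1 ⊗ₜ y) (1 ⊗ₜ v) = 0
      rw [polar_baseChange_tmul, hy v hv, map_zero]) (hS.image _) (by
      rintro _ ⟨v, hv, rfl⟩
      change QuadraticMap.polar (realForm Q σ) (1 ⊗ₜ y) (1 ⊗ₜ v) ≠ 0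
      rw [polar_baseChange_tmul]
      exact (map_ne_zero_iff _ (algebraMap F (RealAt σ)).injective).mpr (hyS v hv)) hN'
  refine ⟨_, hwN, fun τ => ?_, fun u hu h => hwS _ ⟨u, hu, rfl⟩ ?_⟩
  · by_cases hτ : τ = ⟨σ, hσ⟩
    · subst hτ
      rw [Function.update_self]
      exact hw
    · rw [Function.update_of_ne hτ]
      exact hz τ
  · have := h ⟨σ, hσ⟩
    rwa [Function.update_self] at this

end SpecialTuples


/-! ### The natural map has degree one on each component. -/

section Degree

variable {F : Type*} [Field F] [NumberField F] {V : Type*} [AddCommGroup V] [Module F V]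
  [FiniteDimensional F V] {Q : QuadraticForm F V} {Sp : Set (F →+* ℝ)}
  {n : ℕ} {T : Matrix (Fin n) (Fin n) F} {φ : (Fin n → Af F ⊗[F] V) → ℂ}
  {K : Subgroup (GAf Q)} {x₀ : Fin n → V} {g : GAf Q}

/-- The points of `S_K` at which all special tuples span the same subspace. -/
def singleSpanLocus (Sp : Set (F →+* ℝ)) (K : Subgroup (GAf Q)) (T : Matrix (Fin n) (Fin n) F)
    (φ : (Fin n → Af F ⊗[F] V) → ℂ) : Set (ShimuraVar Q K Sp) :=
  {s | ∃ z b, pt Q K z b = s ∧ ∀ y ∈ specialTuples T φ z b, ∀ y' ∈ specialTuples T φ z b,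
    Submodule.span F (Set.range y) = Submodule.span F (Set.range y')}

theorem span_range_rho (γ : GSpin Q) (y : Fin n → V) :
    Submodule.span F (Set.range fun i => rho Q γ (y i)) =
      (Submodule.span F (Set.range y)).map (rho Q γ : V →ₗ[F] V) := by
  rw [Submodule.map_span, ← Set.range_comp]
  rfl

theorem pt_eq_of {z z' : SymmSpace Q Sp} {b b' k : GAf Q} {γ : GSpin Q} (hk : k ∈ K)
    (hz : z' = γ • z) (hb : b' = toGAf Q γ * b * k) : pt Q K z b = pt Q K z' b' :=
  Quotient.sound ⟨γ, k, hk, hz, hb⟩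

theorem natPt_eq_of {W : Submodule F V} {p q : symmSub Q Sp W × HAf Q W} {η : GSpin Q}
    (hη : η ∈ HQ Q W) {k : GAf Q} (hk : k ∈ HAf Q W) (hkK : g⁻¹ * k * g ∈ K)
    (h1 : q.1.1 = η • p.1.1) (h2 : (q.2 : GAf Q) = toGAf Q η * p.2 * k) :
    natPt K g p = natPt K g q :=
  Quotient.sound ⟨η, hη, k, hk, hkK, h1, h2⟩

theorem specialTuples_eq_of_pt_eq (hφK : ∀ k ∈ K, ∀ x, φ (actA Q k x) = φ x)
    {z z' : SymmSpace Q Sp} {b b' : GAf Q} (h : pt Q K z b = pt Q K z' b') :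
    ∃ γ : GSpin Q, ∀ y ∈ specialTuples T φ z' b',
      (fun i => rho Q γ (y i)) ∈ specialTuples T φ z b := by
  obtain ⟨γ, k, hk, h1, h2⟩ := Quotient.exact h.symm
  refine ⟨γ, fun y hy => ?_⟩
  change b = toGAf Q γ * b' * k at h2
  change z = γ • z' at h1
  rw [h1, h2, specialTuples_mul_right hφK _ _ hk]
  exact rho_mem_specialTuples hy γ

theorem pt_mem_singleSpanLocus_iff (hφK : ∀ k ∈ K, ∀ x, φ (actA Q k x) = φ x)
    {z : SymmSpace Q Sp} {b : GAf Q} :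
    pt Q K z b ∈ singleSpanLocus Sp K T φ ↔
      ∀ y ∈ specialTuples T φ z b, ∀ y' ∈ specialTuples T φ z b,
        Submodule.span F (Set.range y) = Submodule.span F (Set.range y') := by
  refine ⟨?_, fun h => ⟨z, b, rfl, h⟩⟩
  rintro ⟨z', b', h, h'⟩ y hy y' hy'
  obtain ⟨γ, hγ⟩ := specialTuples_eq_of_pt_eq (T := T) hφK h
  have := h' _ (hγ y hy) _ (hγ y' hy')
  rw [span_range_rho, span_range_rho] at this
  exact Submodule.map_injective_of_injective (rho Q γ).injective this

/-- The set of special tuples can only shrink under small changes of `z`, and it does not change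
under small changes of `b`, because `K` is open. -/
theorem isOpen_singleSpanLocus [NumberField.IsTotallyReal F] (hQ : IsShimuraForm Q Sp)
    (hφc : HasCompactSupport φ) (hK : IsOpen (K : Set (GAf Q)))
    (hφK : ∀ k ∈ K, ∀ x, φ (actA Q k x) = φ x) : IsOpen (singleSpanLocus Sp K T φ) := by
  have hquot : IsQuotientMap fun p : SymmSpace Q Sp × GAf Q => pt Q K p.1 p.2 :=
    isQuotientMap_quotient_mk'
  rw [← hquot.isOpen_preimage, isOpen_iff_mem_nhds]
  rintro ⟨z, b⟩ h
  have h1 := (pt_mem_singleSpanLocus_iff hφK).mp h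
  have h2 : {b' : GAf Q | b⁻¹ * b' * 1 ∈ K} ∈ 𝓝 b :=
    (isOpen_mul_mul_mem Q hK b⁻¹ 1).mem_nhds (by simp [K.one_mem])
  filter_upwards [prod_mem_nhds (eventually_specialTuples_subset (T := T) hQ hφc z b) h2]
  rintro ⟨z', b'⟩ ⟨h3, h4⟩
  refine (pt_mem_singleSpanLocus_iff hφK).mpr ?_
  have h5 : specialTuples T φ z' b' ⊆ specialTuples T φ z b := by
    have h6 := specialTuples_mul_right (T := T) hφK z' b h4
    rw [mul_one, mul_inv_cancel_left] at h6
    rw [h6]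
    exact h3
  exact fun y hy y' hy' => h1 y (h5 hy) y' (h5 hy')

theorem continuous_pt (K : Subgroup (GAf Q)) (b : GAf Q) :
    Continuous fun z : SymmSpace Q Sp => pt Q K z b :=
  (continuous_quotient_mk' (s := shimuraSetoid Q K Sp)).comp
    (continuous_id.prodMk continuous_const)

/-- The locus where all special tuples span the same subspace is dense in the image of `D_W`. -/
theorem exists_pt_mem_singleSpanLocus [NumberField.IsTotallyReal F] (hQ : IsShimuraForm Q Sp)
    (hφc : HasCompactSupport φ) (hφK : ∀ k ∈ K, ∀ x, φ (actA Q k x) = φ x)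
    (hT : ∀ σ : F →+* ℝ, (T.map σ).PosDef) (hx₀ : x₀ ∈ hyperboloid Q T) {z : SymmSpace Q Sp}
    (hz : z ∈ symmSub Q Sp (Submodule.span F (Set.range x₀))) (b : GAf Q)
    {N : Set (SymmSpace Q Sp)} (hN : N ∈ 𝓝 z) :
    ∃ z' ∈ N, z' ∈ symmSub Q Sp (Submodule.span F (Set.range x₀)) ∧
      pt Q K z' b ∈ singleSpanLocus Sp K T φ := by
  have := hQ.nonempty_embeddings
  obtain ⟨e, he, -, hspan⟩ := exists_orthFamily_of_hyperboloid hT hx₀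
  rw [← hspan] at hz ⊢
  -- The entries outside `W` of the finitely many special tuples are avoided. Any special tuple left
  -- has its span inside `W`, and equality follows since both have dimension `n`.
  set S : Set V := (⋃ y ∈ specialTuples T φ z b, Set.range y) \
    Submodule.span F (Set.range e) with hS
  have hSf : S.Finite := ((finite_specialTuples hQ hφc z b).biUnion fun y _ =>
    Set.finite_range y).sdiff
  obtain ⟨z', hz'N, hz', hz'S⟩ := exists_mem_symmSub_not_perpVec hQ he hz hSf (fun u hu => hu.2)
    (inter_mem hN (eventually_specialTuples_subset (T := T) hQ hφc z b))
  refine ⟨z', hz'N.1, hz', (pt_mem_singleSpanLocus_iff hφK).mpr ?_⟩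
  have key : ∀ y ∈ specialTuples T φ z' b,
      Submodule.span F (Set.range y) = Submodule.span F (Set.range e) := by
    intro y hy
    refine Submodule.eq_of_le_of_finrank_eq (Submodule.span_le.mpr ?_) ?_
    · rintro _ ⟨i, rfl⟩
      by_contra hi
      exact hz'S (y i) ⟨Set.mem_iUnion₂.mpr ⟨y, hz'N.2 hy, i, rfl⟩, hi⟩ (hy.2.2 i)
    · rw [hspan, finrank_span_of_mem_hyperboloid hT hy.1, finrank_span_of_mem_hyperboloid hT hx₀]
  exact fun y hy y' hy' => (key y hy).trans (key y' hy').symm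

theorem phi_ne_zero_of_mem_HAf (hφ0 : φ (actA Q g⁻¹ (toVAf x₀)) ≠ 0) {h : GAf Q}
    (hh : h ∈ HAf Q (Submodule.span F (Set.range x₀))) :
    φ (actA Q (h * g)⁻¹ (toVAf x₀)) ≠ 0 := by
  rwa [mul_inv_rev, actA_mul, mem_HAf_span.mp (inv_mem hh)]

/-- An element of `Γ_b` that moves a point of `D_W` to a point of `D_W` stabilizes `W` pointwise,
if all special tuples at the point span `W`. -/
theorem rho_eq_self_of_mem_singleSpanLocus [NumberField.IsTotallyReal F]
    (hQ : IsShimuraForm Q Sp) (hφc : HasCompactSupport φ)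
    (hφK : ∀ k ∈ K, ∀ x, φ (actA Q k x) = φ x) (hx₀ : x₀ ∈ hyperboloid Q T) {b : GAf Q}
    (hneat : IsNeat (Gamma Q K b)) (hφ0 : φ (actA Q b⁻¹ (toVAf x₀)) ≠ 0) {z : SymmSpace Q Sp}
    (hz : z ∈ symmSub Q Sp (Submodule.span F (Set.range x₀))) {γ : GSpin Q}
    (hγz : γ • z ∈ symmSub Q Sp (Submodule.span F (Set.range x₀)))
    (hγ : γ ∈ GammaPrime Q K b) (hU : pt Q K z b ∈ singleSpanLocus Sp K T φ) (i : Fin n) :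
    rho Q γ (x₀ i) = x₀ i := by
  set W := Submodule.span F (Set.range x₀) with hW
  have hφpow (δ : GSpin Q) (hδ : δ ∈ GammaPrime Q K b) :
      φ (actA Q b⁻¹ (toVAf fun i => rho Q δ (x₀ i))) ≠ 0 := by
    have h1 : b⁻¹ * toGAf Q δ * b ∈ K := by simpa using hδ.2
    rw [← actA_toGAf, ← actA_mul, show b⁻¹ * toGAf Q δ = (b⁻¹ * toGAf Q δ * b) * b⁻¹ by group,
      actA_mul, hφK _ h1]
    exact hφ0
  have hx0mem : x₀ ∈ specialTuples T φ z b :=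
    ⟨hx₀, hφ0, fun i => mem_symmSub_span.mp hz _ ⟨i, rfl⟩⟩
  -- The inverse occurs because `x₀` is orthogonal to `γ z`, so `γ⁻¹ x₀` is orthogonal to `z`. The
  -- weight does not change as `γ` lies in `Γ'_b`.
  have hmem : (fun i => rho Q γ⁻¹ (x₀ i)) ∈ specialTuples T φ z b := by
    refine ⟨rho_mem_hyperboloid hx₀ _, hφpow _ (inv_mem hγ), fun i => ?_⟩
    have := (mem_symmSub_span.mp hγz _ ⟨i, rfl⟩).smul γ⁻¹
    rwa [inv_smul_smul] at this
  have hWinv : W.map (rho Q γ⁻¹ : V →ₗ[F] V) = W := by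
    rw [hW, ← span_range_rho]
    exact (pt_mem_singleSpanLocus_iff hφK).mp hU _ hmem _ hx0mem
  have hstab (j : ℕ) : ∀ w ∈ W, rho Q (γ⁻¹ ^ j) w ∈ W := by
    induction j with
    | zero => intro w hw; simpa using hw
    | succ j ih =>
      intro w hw
      rw [pow_succ, map_mul, LinearEquiv.mul_apply]
      refine ih _ ?_
      have := Submodule.mem_map_of_mem (f := (rho Q γ⁻¹ : V →ₗ[F] V)) hw
      rwa [hWinv] at this
  have hpow (j : ℕ) : (fun i => rho Q (γ⁻¹ ^ j) (x₀ i)) ∈ specialTuples T φ z b :=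
    ⟨rho_mem_hyperboloid hx₀ _, hφpow _ (pow_mem (inv_mem hγ) j), fun i =>
      mem_symmSub_iff.mp hz _ (hstab j _ (Submodule.subset_span ⟨i, rfl⟩))⟩
  have hfin := finite_specialTuples (T := T) hQ hφc z b
  -- As `γ⁻¹` preserves `W`, all tuples `γ⁻ʲ x₀` are special at `z`. Finitely many exist, so some
  -- positive power fixes `x₀`, and neatness applies.
  obtain ⟨j, l, hjl, heq⟩ := Set.Finite.exists_lt_map_eq_of_forall_mem hpow hfin
  have hfix : (rho Q γ⁻¹ ^ (l - j)) (x₀ i) = x₀ i := by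
    have h1 : rho Q (γ⁻¹ ^ j) (x₀ i) = rho Q (γ⁻¹ ^ l) (x₀ i) := congrFun heq i
    have h2 : γ⁻¹ ^ l = γ⁻¹ ^ j * γ⁻¹ ^ (l - j) := by rw [← pow_add, Nat.add_sub_cancel' hjl.le]
    rw [h2, map_mul, LinearEquiv.mul_apply] at h1
    rw [← map_pow]
    exact ((rho Q (γ⁻¹ ^ j)).injective h1).symm
  have h3 := hneat.apply_eq_of_pow_apply_eq ⟨γ⁻¹, inv_mem hγ, rfl⟩ (Nat.sub_pos_of_lt hjl) hfix
  rw [map_inv] at h3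
  exact ((LinearEquiv.symm_apply_eq _).mp h3).symm

/-- On each component of the source, the natural map is injective over the locus where all special
tuples span the same subspace. -/
theorem natPt_eq_of_natRel [NumberField.IsTotallyReal F] (hQ : IsShimuraForm Q Sp)
    (hφc : HasCompactSupport φ) (hφK : ∀ k ∈ K, ∀ x, φ (actA Q k x) = φ x)
    (hx₀ : x₀ ∈ hyperboloid Q T) (hneat : ∀ b : GAf Q, IsNeat (Gamma Q K b))
    (hφ0 : φ (actA Q g⁻¹ (toVAf x₀)) ≠ 0)
    {p q : symmSub Q Sp (Submodule.span F (Set.range x₀)) ×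
      HAf Q (Submodule.span F (Set.range x₀))}
    (hrel : NatRel K g p q) (heq : natMap Q K Sp _ g (natPt K g p) = natMap Q K Sp _ g (natPt K g q))
    (hU : natMap Q K Sp _ g (natPt K g q) ∈ singleSpanLocus Sp K T φ) :
    natPt K g p = natPt K g q := by
  obtain ⟨η, hη, k, hk, hkK, h1, h2⟩ := hrel.symm
  rw [natMap_natPt, natMap_natPt] at heq
  rw [natMap_natPt] at hU
  obtain ⟨γ, l, hl, h3, h4⟩ := Quotient.exact heq.symm
  change p.1.1 = γ • q.1.1 at h3
  change (p.2 : GAf Q) * g = toGAf Q γ * ((q.2 : GAf Q) * g) * l at h4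
  have hb := phi_ne_zero_of_mem_HAf hφ0 p.2.2
  have hηz : η • q.1.1 ∈ symmSub Q Sp (Submodule.span F (Set.range x₀)) := by
    rw [mem_symmSub_iff]
    intro y hy
    rw [← hη y hy]
    exact (mem_symmSub_iff.mp q.1.2 y hy).smul η
  have hpt : pt Q K (η • q.1.1) ((p.2 : GAf Q) * g) = pt Q K q.1.1 ((q.2 : GAf Q) * g) := by
    refine (pt_eq_of hkK (γ := η) rfl ?_).symm
    rw [h1]
    group
  have hδz : (γ * η⁻¹) • (η • q.1.1) = p.1.1 := by rw [smul_smul, inv_mul_cancel_right, h3]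
  -- Dividing by `η` puts both points on the same adelic coordinate and in the same component of
  -- `D`, so the remaining element has totally positive spinor norm and lies in the arithmetic
  -- group.
  have hδ : γ * η⁻¹ ∈ GammaPrime Q K ((p.2 : GAf Q) * g) := by
    refine ⟨(hQ.mem_Gplus_iff _ (η • q.1.1)).mpr (by rw [hδz]; exact h2), ?_⟩
    have h5 : ((p.2 : GAf Q) * g)⁻¹ * toGAf Q (γ * η⁻¹) * ((p.2 : GAf Q) * g) =
        l⁻¹ * (g⁻¹ * k * g) := by
      have h6 : toGAf Q η⁻¹ * ((p.2 : GAf Q) * g) = (q.2 : GAf Q) * k * g := by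
        rw [h1, map_inv]; group
      rw [map_mul, mul_assoc, mul_assoc, h6, h4]
      group
    have h7 := K.mul_mem (K.inv_mem hl) hkK
    rw [← h5] at h7
    simpa [mul_assoc] using h7
  have hfix := rho_eq_self_of_mem_singleSpanLocus hQ hφc hφK hx₀ (hneat _) hb hηz
    (by rw [hδz]; exact p.1.2) hδ (by rw [hpt]; exact hU)
  have hδH : γ * η⁻¹ ∈ HQ Q (Submodule.span F (Set.range x₀)) := mem_HQ_span.mpr hfix
  have hγH : γ ∈ HQ Q (Submodule.span F (Set.range x₀)) := by
    have := mul_mem hδH hη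
    rwa [inv_mul_cancel_right] at this
  -- Once `γ` is known to lie in `H(ℚ)`, the discrepancy of the adelic coordinates is forced. It
  -- lies in `H(𝔸_f)`, and conjugating it by `g` gives `l ∈ K`.
  refine (natPt_eq_of hγH (k := (q.2 : GAf Q)⁻¹ * (toGAf Q γ)⁻¹ * p.2)
    (mul_mem (mul_mem (inv_mem q.2.2) (inv_mem (toGAf_mem_HAf hγH))) p.2.2) ?_ h3 (by group)).symm
  have h8 : g⁻¹ * ((q.2 : GAf Q)⁻¹ * (toGAf Q γ)⁻¹ * p.2) * g = l := by
    have : (p.2 : GAf Q) = toGAf Q γ * ((q.2 : GAf Q) * g) * l * g⁻¹ := by rw [← h4]; group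
    rw [this]
    group
  rwa [h8]

/-- Two dense relatively open parts of the image meet, so the fibre cardinality `1` on one of them
is the only possible value, and the supremum is taken over `{1}`. -/
theorem genericDegree_eq_one {X S : Type*} [TopologicalSpace X] [TopologicalSpace S] {f : X → S}
    {C : Set X} (hC : C.Nonempty) {U : Set S} (hU : IsOpen U)
    (hdense : f '' C ⊆ closure (f '' C ∩ U))
    (hinj : ∀ p ∈ C, ∀ q ∈ C, f p = f q → f q ∈ U → p = q) : genericDegree f C = 1 := by
  have hcard : ∀ y ∈ f '' C ∩ U, Nat.card {p : X // p ∈ C ∧ f p = y} = 1 := by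
    rintro _ ⟨⟨q, hq, rfl⟩, hqU⟩
    rw [Nat.card_eq_one_iff_exists]
    exact ⟨⟨q, hq, rfl⟩, fun p => Subtype.ext (hinj p p.2.1 q hq p.2.2 hqU)⟩
  have hset : {d | ∃ U : Set S, IsOpen U ∧ f '' C ⊆ closure (f '' C ∩ U) ∧
      ∀ y ∈ f '' C ∩ U, Nat.card {p : X // p ∈ C ∧ f p = y} = d} = {1} := by
    ext d
    refine ⟨?_, fun h => h ▸ ⟨U, hU, hdense, hcard⟩⟩
    rintro ⟨U', hU', hdense', hcard'⟩
    obtain ⟨c, hc⟩ := hC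
    obtain ⟨y, hy', hy, hyU⟩ : (U' ∩ (f '' C ∩ U)).Nonempty := by
      obtain ⟨y, hyC, hyU'⟩ := closure_nonempty_iff.mp ⟨_, hdense' ⟨c, hc, rfl⟩⟩
      exact mem_closure_iff.mp (hdense hyC) U' hU' hyU'
    exact (hcard' y ⟨hy, hy'⟩).symm.trans (hcard y ⟨hy, hyU⟩)
  rw [genericDegree, hset, csSup_singleton]

/-- The natural map has degree one on each component. -/
theorem genericDegree_natMap [NumberField.IsTotallyReal F] (hQ : IsShimuraForm Q Sp)
    (hφc : HasCompactSupport φ) (hK : IsOpen (K : Set (GAf Q)))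
    (hφK : ∀ k ∈ K, ∀ x, φ (actA Q k x) = φ x) (hT : ∀ σ : F →+* ℝ, (T.map σ).PosDef)
    (hx₀ : x₀ ∈ hyperboloid Q T) (hneat : ∀ b : GAf Q, IsNeat (Gamma Q K b))
    (hφ0 : φ (actA Q g⁻¹ (toVAf x₀)) ≠ 0)
    (C : ConnectedComponents (NatSource Q K Sp (Submodule.span F (Set.range x₀)) g)) :
    genericDegree (natMap Q K Sp _ g) (ConnectedComponents.mk ⁻¹' {C}) = 1 := by
  refine genericDegree_eq_one ?_ (isOpen_singleSpanLocus (T := T) hQ hφc hK hφK) ?_ ?_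
  · obtain ⟨c, rfl⟩ := ConnectedComponents.surjective_coe C
    exact ⟨c, rfl⟩
  · rintro _ ⟨c, hc, rfl⟩
    obtain ⟨⟨z, h⟩, rfl⟩ := Quotient.exists_rep c
    rw [mem_closure_iff]
    intro O hO hmem
    have hN : {z' : SymmSpace Q Sp | pt Q K z' ((h : GAf Q) * g) ∈ O ∧ SameComp z.1 z'} ∈ 𝓝 z.1 :=
      ((hO.preimage (continuous_pt K _)).inter (isOpen_sameComp z.1)).mem_nhds
        ⟨hmem, SameComp.refl _⟩
    obtain ⟨z', ⟨hz'O, hz'c⟩, hz', hz'U⟩ := exists_pt_mem_singleSpanLocus hQ hφc hφK hT hx₀ z.2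
      ((h : GAf Q) * g) hN
    refine ⟨_, hz'O, ⟨natPt K g (⟨z', hz'⟩, h), ?_, rfl⟩, hz'U⟩
    have h1 : ConnectedComponents.mk (natPt K g (z, h)) =
        ConnectedComponents.mk (natPt K g (⟨z', hz'⟩, h)) :=
      (connectedComponents_mk_natPt_eq_iff hQ.negIndexTwo hK).mpr (NatRel.of_sameComp hz'c rfl)
    exact h1.symm.trans hc
  · intro p hp q hq hpq hqU
    obtain ⟨p, rfl⟩ := Quotient.exists_rep p
    obtain ⟨q, rfl⟩ := Quotient.exists_rep q
    exact natPt_eq_of_natRel hQ hφc hφK hx₀ hneat hφ0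
      ((connectedComponents_mk_natPt_eq_iff hQ.negIndexTwo hK).mp (hp.trans hq.symm)) hpq hqU

end Degree


/-! ### The correspondence between components and orbits of tuples. -/

section Correspondence

variable {F : Type*} [Field F] [NumberField F] {V : Type*} [AddCommGroup V] [Module F V]
  [FiniteDimensional F V] {Q : QuadraticForm F V} {Sp : Set (F →+* ℝ)}
  {n : ℕ} {T : Matrix (Fin n) (Fin n) F} {φ : (Fin n → Af F ⊗[F] V) → ℂ}
  {K : Subgroup (GAf Q)} {x₀ : Fin n → V} {z₀ : SymmSpace Q Sp}

/-- The component `C` of `H(ℚ) \ D_W × H(𝔸_f) / K_{H,a}` corresponds to the connected cycle attached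
to the tuple `x` on the component of `S_K` given by `b`: for some `[z, h]` in `C` and some
`γ ∈ G(ℚ)` moving `z` to `D^+`, one has `x = γ x₀` and `γ h a ∈ b K`. -/
def CompRel (z₀ : SymmSpace Q Sp) {x₀ : Fin n → V} {a : GAf Q}
    (C : ConnectedComponents (NatSource Q K Sp (Submodule.span F (Set.range x₀)) a))
    (b : GAf Q) (x : Fin n → V) : Prop :=
  ∃ p, ConnectedComponents.mk (natPt K a p) = C ∧ ∃ γ : GSpin Q, ∃ k ∈ K,
    SameComp z₀ (γ • p.1.1) ∧ (∀ i, x i = rho Q γ (x₀ i)) ∧ toGAf Q γ * p.2 * a * k = b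

variable {a : GAf Q} {C : ConnectedComponents (NatSource Q K Sp (Submodule.span F (Set.range x₀)) a)}
  {b : GAf Q} {x : Fin n → V}

theorem sameComp_smul_of_mem_Gplus (hQ : IsShimuraForm Q Sp) {δ : GSpin Q} (hδ : δ ∈ Gplus Q)
    {z w : SymmSpace Q Sp} (h : SameComp z w) : SameComp z (δ • w) :=
  h.trans hQ.negIndexTwo ((hQ.mem_Gplus_iff δ w).mp hδ)

/-- The relation depends only on the `Γ_b`-orbit of the tuple, so it may be tested on the chosen
representative of each orbit. -/
theorem CompRel.rho (hQ : IsShimuraForm Q Sp) (h : CompRel z₀ C b x) {δ : V ≃ₗ[F] V}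
    (hδ : δ ∈ Gamma Q K b) {y : Fin n → V} (hy : ∀ i, y i = δ (x i)) : CompRel z₀ C b y := by
  obtain ⟨p, hp, γ, k, hk, h1, h2, h3⟩ := h
  obtain ⟨δ, hδ, rfl⟩ := hδ
  have h4 : b⁻¹ * (toGAf Q δ)⁻¹ * b ∈ K := by
    have := K.inv_mem hδ.2
    simpa [mul_assoc] using this
  refine ⟨p, hp, δ * γ, k * (b⁻¹ * (toGAf Q δ)⁻¹ * b), K.mul_mem hk h4, ?_, fun i => ?_, ?_⟩
  · rw [mul_smul]
    exact sameComp_smul_of_mem_Gplus hQ hδ.1 h1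
  · rw [hy, h2, map_mul]
    rfl
  · rw [map_mul, ← h3]
    group

/-- Some rational element moves `z` into `D^+`. The adelic coordinate is then brought to some `g_j`
by an element of `G(ℚ)_+`, which keeps `D^+`. -/
theorem exists_compRel (hQ : IsShimuraForm Q Sp) (z₀ : SymmSpace Q Sp) (hx₀ : x₀ ∈ hyperboloid Q T)
    {J : Type*} {g : J → GAf Q} (hg : IsComponentReps Q K g)
    (C : ConnectedComponents (NatSource Q K Sp (Submodule.span F (Set.range x₀)) a)) :
    ∃ q : Σ j : J, Quotient (orbitSetoid Q K T (g j)), CompRel z₀ C (g q.1) q.2.out.1 := by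
  obtain ⟨c, rfl⟩ := ConnectedComponents.surjective_coe C
  obtain ⟨p, rfl⟩ := Quotient.exists_rep c
  obtain ⟨γ, hγ⟩ := exists_GSpin_sameComp hQ.negIndexTwo hQ.exists_pos p.1.1 z₀
  obtain ⟨j, ⟨δ, hδ, k, hk, h⟩, -⟩ := hg (toGAf Q γ * p.2 * a)
  have h1 : CompRel z₀ (ConnectedComponents.mk (natPt K a p)) (g j)
      (fun i => OrthShimura.rho Q (δ⁻¹ * γ) (x₀ i)) := by
    refine ⟨p, rfl, δ⁻¹ * γ, k⁻¹, K.inv_mem hk, ?_, fun i => rfl, ?_⟩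
    · rw [mul_smul]
      exact sameComp_smul_of_mem_Gplus hQ (inv_mem hδ) hγ
    · rw [map_mul, map_inv, mul_assoc, mul_assoc, mul_assoc, ← mul_assoc _ a,
        ← mul_assoc _ (_ * a), ← mul_assoc (toGAf Q γ), h]
      group
  set q : Quotient (orbitSetoid Q K T (g j)) :=
    Quotient.mk _ ⟨_, rho_mem_hyperboloid hx₀ (δ⁻¹ * γ)⟩ with hq
  obtain ⟨ε, hε, hq'⟩ := (orbitSetoid Q K T (g j)).symm (Quotient.mk_out
    (s := orbitSetoid Q K T (g j)) ⟨_, rho_mem_hyperboloid hx₀ (δ⁻¹ * γ)⟩)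
  exact ⟨⟨j, q⟩, h1.rho hQ hε hq'⟩

/-- Two choices differ by `δ = γ' η γ⁻¹` with `η ∈ H(ℚ)`. It preserves `D^+`, so it lies in
`G(ℚ)_+`; this forces equal `j`, puts `δ` in `Γ_{g_j}`, and `δ` carries one tuple to the other. -/
theorem CompRel.unique (hQ : IsShimuraForm Q Sp) (hK : IsOpen (K : Set (GAf Q)))
    {J : Type*} {g : J → GAf Q} (hg : IsComponentReps Q K g)
    {q q' : Σ j : J, Quotient (orbitSetoid Q K T (g j))} (h : CompRel z₀ C (g q.1) q.2.out.1)
    (h' : CompRel z₀ C (g q'.1) q'.2.out.1) : q = q' := by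
  obtain ⟨p, hp, γ, k, hk, h1, h2, h3⟩ := h
  obtain ⟨p', hp', γ', k', hk', h1', h2', h3'⟩ := h'
  obtain ⟨η, hη, l, hl, hlK, h4, h5⟩ :=
    (connectedComponents_mk_natPt_eq_iff hQ.negIndexTwo hK).mp (hp.trans hp'.symm)
  set δ := γ' * η * γ⁻¹ with hδ
  set κ := k⁻¹ * (a⁻¹ * l * a) * k' with hκ
  have hκK : κ ∈ K := K.mul_mem (K.mul_mem (K.inv_mem hk) hlK) hk'
  have h6 : g q'.1 = toGAf Q δ * g q.1 * κ := by
    rw [← h3, ← h3', h4, hδ, hκ, map_mul, map_mul, map_inv]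
    group
  have hδ' : δ ∈ Gplus Q := by
    rw [hQ.mem_Gplus_iff δ (γ • p.1.1), hδ, smul_smul, inv_mul_cancel_right, mul_smul]
    exact h1.symm.trans hQ.negIndexTwo
      (h1'.trans hQ.negIndexTwo ((sameComp_smul γ').mpr h5).symm)
  obtain ⟨j, q⟩ := q
  obtain ⟨j', q'⟩ := q'
  obtain rfl : j = j' := (hg (g j')).unique ⟨δ, hδ', κ, hκK, h6⟩
    ⟨1, one_mem _, 1, one_mem _, by simp⟩
  have h7 : OrthShimura.rho Q δ ∈ Gamma Q K (g j) := by
    refine ⟨δ, ⟨hδ', ?_⟩, rfl⟩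
    have h8 : (g j)⁻¹ * toGAf Q δ * g j = κ⁻¹ := by
      rw [eq_inv_iff_mul_eq_one, mul_assoc, mul_assoc, ← mul_assoc (toGAf Q δ)]
      exact inv_mul_eq_one.mpr h6
    have h9 := K.inv_mem hκK
    rw [← h8] at h9
    simpa using h9
  have h8 : q = q' := by
    rw [← Quotient.out_eq q, ← Quotient.out_eq q']
    refine Quotient.sound ⟨_, h7, fun i => ?_⟩
    rw [h2' i, h2 i, hδ, map_mul, map_mul, LinearEquiv.mul_apply, LinearEquiv.mul_apply,
      ← LinearEquiv.mul_apply (OrthShimura.rho Q γ⁻¹), ← map_mul, inv_mul_cancel, map_one,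
      LinearEquiv.coe_one, id, mem_HQ_span.mp hη i]
  rw [h8]

/-- From `γ h a k = b` and `h x₀ = x₀` one gets `b⁻¹ γ x₀ = k⁻¹ a⁻¹ x₀`. This gives equality of
weights and recovers the index `r`. -/
theorem CompRel.actA_eq (h : CompRel z₀ C b x) :
    ∃ k ∈ K, actA Q a⁻¹ (toVAf x₀) = actA Q k (actA Q b⁻¹ (toVAf x)) := by
  obtain ⟨p, -, γ, k, hk, -, h2, h3⟩ := h
  refine ⟨k, hk, ?_⟩
  have h4 : x = fun i => OrthShimura.rho Q γ (x₀ i) := funext h2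
  have h5 := mem_HAf_span.mp (inv_mem p.2.2)
  rw [h4, ← actA_toGAf, ← actA_mul, ← actA_mul, ← h3]
  conv_lhs => rw [← h5, ← actA_mul]
  congr 1
  group

theorem CompRel.phi_eq (hφK : ∀ k ∈ K, ∀ x, φ (actA Q k x) = φ x) (h : CompRel z₀ C b x) :
    φ (actA Q a⁻¹ (toVAf x₀)) = φ (actA Q b⁻¹ (toVAf x)) := by
  obtain ⟨k, hk, h1⟩ := h.actA_eq
  rw [h1, hφK k hk]

/-- If `γ x₀ = γ' x₀`, then `γ'⁻¹ γ ∈ H(ℚ)`, and this element relates the two points of the source.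
-/
theorem CompRel.component_unique (hQ : IsShimuraForm Q Sp) (hK : IsOpen (K : Set (GAf Q)))
    {C' : ConnectedComponents (NatSource Q K Sp (Submodule.span F (Set.range x₀)) a)}
    (h : CompRel z₀ C b x) (h' : CompRel z₀ C' b x) : C = C' := by
  obtain ⟨p, rfl, γ, k, hk, h1, h2, h3⟩ := h
  obtain ⟨p', rfl, γ', k', hk', h1', h2', h3'⟩ := h'
  rw [connectedComponents_mk_natPt_eq_iff hQ.negIndexTwo hK]
  have hη : γ'⁻¹ * γ ∈ HQ Q (Submodule.span F (Set.range x₀)) := by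
    refine mem_HQ_span.mpr fun i => ?_
    rw [map_mul, LinearEquiv.mul_apply, ← h2, h2', ← LinearEquiv.mul_apply, ← map_mul,
      inv_mul_cancel, map_one]
    rfl
  have h4 : (p'.2 : GAf Q) = toGAf Q (γ'⁻¹ * γ) * p.2 * (a * (k * k'⁻¹) * a⁻¹) := by
    have h5 : (p'.2 : GAf Q) = (toGAf Q γ')⁻¹ * b * k'⁻¹ * a⁻¹ := by rw [← h3']; group
    rw [h5, ← h3, map_mul, map_inv]
    group
  refine ⟨γ'⁻¹ * γ, hη, _, ?_, ?_, h4, ?_⟩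
  · rw [← inv_mul_eq_iff_eq_mul.mpr h4]
    exact mul_mem (inv_mem (mul_mem (toGAf_mem_HAf hη) p.2.2)) p'.2.2
  · have := K.mul_mem hk (K.inv_mem hk')
    convert this using 1
    group
  · rw [← sameComp_smul γ', smul_smul, mul_inv_cancel_left]
    exact h1.symm.trans hQ.negIndexTwo h1'

/-- Witt's theorem gives `x = γ x₀`, and non-zero weight gives `b⁻¹ x = k ξ_r⁻¹ x₀`. Hence `h = γ⁻¹
b k ξ_r⁻¹` fixes `x₀`, and `D_W` has a point on the component `γ⁻¹ D^+`. -/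
theorem exists_compRel_of_ne_zero (hQ : IsShimuraForm Q Sp) (z₀ : SymmSpace Q Sp)
    (hT : ∀ σ : F →+* ℝ, (T.map σ).PosDef) (hn : n < Module.finrank F V)
    (hx₀ : x₀ ∈ hyperboloid Q T) {I : Type*} {ξ : I → GAf Q} (hξ : IsOrbitReps Q K T φ x₀ ξ)
    (hx : x ∈ hyperboloid Q T) (hφ : φ (actA Q b⁻¹ (toVAf x)) ≠ 0) :
    ∃ r, ∃ C : ConnectedComponents (NatSource Q K Sp (Submodule.span F (Set.range x₀)) (ξ r)),
      CompRel z₀ C b x := by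
  have := hQ.nonempty_embeddings
  have hmem : actA Q b⁻¹ (toVAf x) ∈ Function.support φ ∩
      hyperboloid (adelicForm Q) (T.map (algebraMap F (Af F))) := by
    refine ⟨hφ, fun i j => ?_⟩
    have h1 : QuadraticMap.polar (adelicForm Q) (1 ⊗ₜ x i) (1 ⊗ₜ x j) =
        2 * algebraMap F (Af F) (T i j) := by
      rw [polar_baseChange_tmul, hx i j, map_mul, map_ofNat]
    rw [Matrix.map_apply, ← h1]
    simp only [QuadraticMap.polar, actA, toVAf, ← map_add, form_rho]
  rw [hξ.1] at hmem
  obtain ⟨r, k, hk, hkr⟩ := Set.mem_iUnion.mp hmem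
  obtain ⟨γ, hγ⟩ := exists_GSpin_hyperboloid hQ.nondegenerate hT hn hx₀ hx
  obtain ⟨e, he, hpos, hspan⟩ := exists_orthFamily_of_hyperboloid hT hx₀
  obtain ⟨z, hz, hzW⟩ := exists_sameComp_symmSub hQ.negIndexTwo he hpos (γ⁻¹ • z₀)
  rw [hspan] at hzW
  have hh : (toGAf Q γ)⁻¹ * b * k * (ξ r)⁻¹ ∈ HAf Q (Submodule.span F (Set.range x₀)) := by
    rw [mem_HAf_span, mul_assoc, actA_mul, ← hkr, ← actA_mul, mul_assoc, mul_inv_cancel, mul_one,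
      ← map_inv, actA_toGAf]
    congr 1
    funext i
    rw [← hγ i, map_inv]
    exact LinearEquiv.symm_apply_apply _ _
  refine ⟨r, _, (⟨z, hzW⟩, ⟨_, hh⟩), rfl, γ, k⁻¹, K.inv_mem hk, ?_, fun i => (hγ i).symm, by group⟩
  rw [← sameComp_smul γ, smul_inv_smul] at hz
  exact hz

/-- On the given adelic coordinate the component is the part of `D_W` on one component of `D`, and
translation by `γ` carries it to `D^+_{γW}`. -/
theorem CompRel.image_eq_connCycle (hQ : IsShimuraForm Q Sp) (hK : IsOpen (K : Set (GAf Q)))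
    (h : CompRel z₀ C b x) : natMap Q K Sp _ a '' (ConnectedComponents.mk ⁻¹' {C}) =
      connCycle Q K z₀ (Submodule.span F (Set.range x)) b := by
  obtain ⟨p, rfl, γ, k, hk, h1, h2, h3⟩ := h
  obtain rfl : x = fun i => OrthShimura.rho Q γ (x₀ i) := funext h2
  ext s
  constructor
  · rintro ⟨c, hc, rfl⟩
    obtain ⟨p', rfl⟩ := Quotient.exists_rep c
    obtain ⟨η, hη, l, hl, hlK, h4, h5⟩ :=
      (connectedComponents_mk_natPt_eq_iff hQ.negIndexTwo hK).mp (Eq.symm hc)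
    refine ⟨(γ * η⁻¹) • p'.1.1, (mem_symmSubPlus_iff hQ.negIndexTwo).mpr ⟨?_, ?_⟩, ?_⟩
    · rw [mem_symmSub_span]
      rintro _ ⟨i, rfl⟩
      have := (mem_symmSub_span.mp p'.1.2 _ ⟨i, rfl⟩).smul (γ * η⁻¹)
      rwa [map_mul, LinearEquiv.mul_apply, mem_HQ_span.mp (inv_mem hη)] at this
    · rw [mul_smul]
      refine h1.trans hQ.negIndexTwo ((sameComp_smul γ).mpr ?_)
      rw [← sameComp_smul η, smul_inv_smul]
      exact h5
    · refine (pt_eq_of (K := K) (γ := γ * η⁻¹) (K.mul_mem (K.inv_mem hlK) hk) rfl ?_).symm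
      rw [h4, ← h3, map_mul, map_inv]
      group
  · rintro ⟨w, hw, rfl⟩
    obtain ⟨hw, hw'⟩ := (mem_symmSubPlus_iff hQ.negIndexTwo).mp hw
    have hwW : γ⁻¹ • w ∈ symmSub Q Sp (Submodule.span F (Set.range x₀)) := by
      rw [mem_symmSub_span]
      rintro _ ⟨i, rfl⟩
      rw [← perpVec_smul_iff γ, smul_inv_smul]
      exact mem_symmSub_span.mp hw _ ⟨i, rfl⟩
    refine ⟨natPt K a (⟨γ⁻¹ • w, hwW⟩, p.2), ?_, ?_⟩
    · have h4 : SameComp p.1.1 (γ⁻¹ • w) := by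
        rw [← sameComp_smul γ, smul_inv_smul]
        exact h1.symm.trans hQ.negIndexTwo hw'
      have h5 : ConnectedComponents.mk (natPt K a p) =
          ConnectedComponents.mk (natPt K a (⟨γ⁻¹ • w, hwW⟩, p.2)) :=
        (connectedComponents_mk_natPt_eq_iff hQ.negIndexTwo hK).mpr (NatRel.of_sameComp h4 rfl)
      exact h5.symm
    · exact pt_eq_of (K := K) (γ := γ) hk (by simp) (by rw [← h3]; group)

theorem nonempty_connCycle (hQ : IsShimuraForm Q Sp) (hT : ∀ σ : F →+* ℝ, (T.map σ).PosDef)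
    (hx : x ∈ hyperboloid Q T) (z₀ : SymmSpace Q Sp) (b : GAf Q) :
    (connCycle Q K z₀ (Submodule.span F (Set.range x)) b).Nonempty := by
  have := hQ.nonempty_embeddings
  obtain ⟨e, he, hpos, hspan⟩ := exists_orthFamily_of_hyperboloid hT hx
  obtain ⟨z, hz, hzW⟩ := exists_sameComp_symmSub hQ.negIndexTwo he hpos z₀
  rw [hspan] at hzW
  exact ⟨_, z, (mem_symmSubPlus_iff hQ.negIndexTwo).mpr ⟨hzW, hz⟩, rfl⟩

theorem eq_of_primeCycle_ne_zero {S : Type*} {Y Y' : Set S} (h : primeCycle Y Y' ≠ 0) :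
    Y' = Y := by
  by_contra h'
  exact h (if_neg h')

/-- Every subvariety occurs in finitely many terms of the weighted sum of connected cycles. -/
theorem locFinite_wtTerm [NumberField.IsTotallyReal F] (hQ : IsShimuraForm Q Sp)
    (hT : ∀ σ : F →+* ℝ, (T.map σ).PosDef) (hφc : HasCompactSupport φ)
    (hφK : ∀ k ∈ K, ∀ x, φ (actA Q k x) = φ x) {J : Type*} {g : J → GAf Q}
    (hg : IsComponentReps Q K g) : LocFinite (wtTerm Q K z₀ T φ g) := by
  classical
  intro Y
  have hY (p : Σ j : J, Quotient (orbitSetoid Q K T (g j))) (hp : wtTerm Q K z₀ T φ g p Y ≠ 0) :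
      φ (actA Q (g p.1)⁻¹ (toVAf p.2.out.1)) ≠ 0 ∧
        Y = connCycle Q K z₀ (Submodule.span F (Set.range p.2.out.1)) (g p.1) := by
    have h : φ (actA Q (g p.1)⁻¹ (toVAf p.2.out.1)) *
        primeCycle (connCycle Q K z₀ (Submodule.span F (Set.range p.2.out.1)) (g p.1)) Y ≠ 0 := hp
    exact ⟨left_ne_zero_of_mul h, eq_of_primeCycle_ne_zero (right_ne_zero_of_mul h)⟩
  rcases Set.eq_empty_or_nonempty {p | wtTerm Q K z₀ T φ g p Y ≠ 0} with h | ⟨p₀, hp₀⟩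
  · rw [h]; exact Set.finite_empty
  -- One point of `Y` is fixed. Every term in which `Y` occurs has the same `j`, and its orbit
  -- contains a special tuple at that point; there are finitely many of these.
  obtain ⟨s, hs⟩ := nonempty_connCycle (K := K) hQ hT p₀.2.out.2 z₀ (g p₀.1)
  rw [← (hY p₀ hp₀).2] at hs
  have hs0 : s ∈ connCycle Q K z₀ (Submodule.span F (Set.range p₀.2.out.1)) (g p₀.1) :=
    (hY p₀ hp₀).2 ▸ hs
  obtain ⟨w₀, hw₀, rfl⟩ := hs0
  obtain ⟨-, hw₀⟩ := (mem_symmSubPlus_iff hQ.negIndexTwo).mp hw₀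
  have hfin := finite_specialTuples (T := T) hQ hφc w₀ (g p₀.1)
  have hfin' := (hfin.preimage (f := Subtype.val (p := fun y => y ∈ hyperboloid Q T))
    Subtype.val_injective.injOn).image (fun y => (⟨p₀.1, Quotient.mk _ y⟩ :
      Σ j : J, Quotient (orbitSetoid Q K T (g j))))
  refine hfin'.subset fun p hp => ?_
  obtain ⟨hφp, hYp⟩ := hY p hp
  rw [hYp] at hs
  obtain ⟨w, hw, hww₀⟩ := hs
  obtain ⟨hw, hw'⟩ := (mem_symmSubPlus_iff hQ.negIndexTwo).mp hw
  obtain ⟨γ, k, hk, h1, h2⟩ := Quotient.exact hww₀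
  change w₀ = γ • w at h1
  change g p₀.1 = toGAf Q γ * g p.1 * k at h2
  have hγ : γ ∈ Gplus Q := (hQ.mem_Gplus_iff γ w).mpr
    (h1 ▸ hw'.symm.trans hQ.negIndexTwo hw₀)
  obtain ⟨j₀, q₀⟩ := p₀
  obtain ⟨j, q⟩ := p
  obtain rfl : j = j₀ := (hg (g j₀)).unique ⟨γ, hγ, k, hk, h2⟩ ⟨1, one_mem _, 1, one_mem _, by simp⟩
  have hmem : (fun i => OrthShimura.rho Q γ (q.out.1 i)) ∈ specialTuples T φ w₀ (g j) := by
    have h3 : q.out.1 ∈ specialTuples T φ w (g j) :=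
      ⟨q.out.2, hφp, fun i => mem_symmSub_span.mp hw _ ⟨i, rfl⟩⟩
    have h4 := rho_mem_specialTuples h3 γ
    rw [← specialTuples_mul_right hφK _ _ hk] at h4
    change g j = _ at h2
    rwa [← h2, ← h1] at h4
  refine ⟨⟨_, hmem.1⟩, hmem, ?_⟩
  change (⟨j, _⟩ : Σ j : J, Quotient (orbitSetoid Q K T (g j))) = ⟨j, q⟩
  have h5 : OrthShimura.rho Q γ ∈ Gamma Q K (g j) := by
    refine ⟨γ, ⟨hγ, ?_⟩, rfl⟩
    have h8 : (g j)⁻¹ * toGAf Q γ * g j = k⁻¹ := by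
      rw [eq_inv_iff_mul_eq_one, mul_assoc, mul_assoc, ← mul_assoc (toGAf Q γ)]
      exact inv_mul_eq_one.mpr h2
    have h9 := K.inv_mem hk
    rw [← h8] at h9
    simpa using h9
  congr 1
  conv_rhs => rw [← Quotient.out_eq q]
  exact (Quotient.sound (s := orbitSetoid Q K T (g j)) ⟨_, h5, fun i => rfl⟩).symm

end Correspondence


/-! ### Reindexing finite sums. -/

section Finsum

theorem finsum_eq_finsum_comp {P I M : Type*} [AddCommMonoid M] {f : P → M} {ψ : I → P}
    (hψ : Function.Injective ψ) (hf : Function.support f ⊆ Set.range ψ) :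
    ∑ᶠ p, f p = ∑ᶠ i, f (ψ i) := by
  rw [← finsum_mem_range hψ, finsum_mem_def, Set.indicator_eq_self.mpr hf]

theorem finsum_sigma_of_finite {I M : Type*} {A : I → Type*} [AddCommMonoid M]
    {f : (Σ r, A r) → M} (hf : (Function.support f).Finite) :
    ∑ᶠ i, f i = ∑ᶠ r, ∑ᶠ c, f ⟨r, c⟩ := by
  classical
  set s := hf.toFinset.image Sigma.fst
  set t := fun r => (hf.preimage (sigma_mk_injective (i := r)).injOn).toFinset
  have ht (r : I) : ∑ᶠ c, f ⟨r, c⟩ = ∑ c ∈ t r, f ⟨r, c⟩ :=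
    finsum_eq_sum_of_support_subset _ fun c hc => by simpa [t] using hc
  have hmem (r : I) (c : A r) (h : f ⟨r, c⟩ ≠ 0) : r ∈ s :=
    Finset.mem_image.mpr ⟨⟨r, c⟩, hf.mem_toFinset.mpr h, rfl⟩
  rw [finsum_eq_sum_of_support_subset f (s := s.sigma t), Finset.sum_sigma,
    finsum_eq_sum_of_support_subset (s := s)]
  · exact Finset.sum_congr rfl fun r _ => (ht r).symm
  · intro r hr
    rw [Function.mem_support, ht] at hr
    obtain ⟨c, -, hc⟩ := Finset.exists_ne_zero_of_sum_ne_zero hr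
    exact hmem r c hc
  · rintro ⟨r, c⟩ h
    exact Finset.mem_coe.mpr (Finset.mem_sigma.mpr ⟨hmem r c h, by simpa [t] using h⟩)

end Finsum

/-! ### The hypotheses on the signatures. -/

section Signature

variable {F : Type*} [Field F] [NumberField F] {V : Type*} [AddCommGroup V] [Module F V]
  [FiniteDimensional F V] {Q : QuadraticForm F V} {Sp : Set (F →+* ℝ)}

theorem isShimuraForm_of_signature {m : ℕ} (hm : 0 < m) (hdim : Module.finrank F V = m + 2)
    (hSp : Sp.Nonempty)
    (hsig : ∀ σ ∈ Sp, sigPos (realForm Q σ) = m ∧ sigNeg (realForm Q σ) = 2)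
    (hsig' : ∀ σ ∉ Sp, sigPos (realForm Q σ) = m + 2 ∧ sigNeg (realForm Q σ) = 0)
    (z₀ : SymmSpace Q Sp) : IsShimuraForm Q Sp := by
  have hfin (σ : F →+* ℝ) : Module.finrank (RealAt σ) (RealAt σ ⊗[F] V) = m + 2 := by
    rw [Module.finrank_baseChange, hdim]
  have hneg : ∀ σ ∈ Sp, NegIndexTwo (realForm Q σ) := fun σ hσ =>
    negIndexTwo_of_signature (hsig σ hσ).2 (by rw [(hsig σ hσ).1, (hsig σ hσ).2, hfin])
  refine ⟨fun x hx => ?_, hneg, fun σ hσ y hy => pos_of_sigNeg_eq_zero (hsig' σ hσ).2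
    (by rw [(hsig' σ hσ).1, (hsig' σ hσ).2, hfin]) hy, fun σ => exists_pos_of_sigPos ?_, hSp⟩
  · obtain ⟨σ, hσ⟩ := hSp
    -- The base point supplies a negative plane. A non-zero radical vector would be orthogonal to
    -- it, hence positive, while its value is zero.
    obtain ⟨v, -⟩ := Quotient.exists_rep (z₀ ⟨σ, hσ⟩)
    by_contra hx0
    have h0 (y : RealAt σ ⊗[F] V) : QuadraticMap.polar (realForm Q σ) y (1 ⊗ₜ x) = 0 := by
      induction y using TensorProduct.induction_on with
      | zero => simp
      | tmul c y =>
        have : c ⊗ₜ[F] y = c • ((1 : RealAt σ) ⊗ₜ[F] y) := by simp [TensorProduct.smul_tmul']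
        rw [this, QuadraticMap.polar_smul_left, polar_baseChange_tmul, QuadraticMap.polar_comm, hx,
          map_zero, smul_zero]
      | add y y' h h' => rw [QuadraticMap.polar_add_left, h, h', add_zero]
    have hne : (1 : RealAt σ) ⊗ₜ[F] x ≠ 0 := by
      intro h
      refine hx0 ((Module.finBasis F V).ext_elem fun i => ?_)
      have h1 := Algebra.TensorProduct.basis_repr_tmul (Module.finBasis F V) (1 : RealAt σ) x
      have h2 := DFunLike.congr_fun h1 i
      rw [h, map_zero, one_smul] at h2
      rw [map_zero, Finsupp.zero_apply]
      exact (map_eq_zero_iff (algebraMap F (RealAt σ)) (algebraMap F (RealAt σ)).injective).mp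
        h2.symm
    have h1 := hneg σ hσ v.1 v.2 _ hne fun i => h0 _
    rw [← mul_pos_iff_of_pos_left (two_pos : (0 : RealAt σ) < 2), ← polar_self_eq, h0] at h1
    exact lt_irrefl _ h1
  · by_cases hσ : σ ∈ Sp
    · rw [(hsig σ hσ).1]; exact hm
    · rw [(hsig' σ hσ).1]; omega

end Signature

end

end OrthShimura


/-! ### Comparison of the two weighted cycles. -/

theorem proposition10p2
    {F : Type*} [Field F] [NumberField F] [NumberField.IsTotallyReal F]
    {V : Type*} [AddCommGroup V] [Module F V] [FiniteDimensional F V] (Q : QuadraticForm F V)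
    (m : ℕ) (hm : 0 < m) (hdim : Module.finrank F V = m + 2)
    (Sp : Set (F →+* ℝ)) (hSp : Sp.Nonempty)
    (hsig : ∀ σ ∈ Sp, sigPos (realForm Q σ) = m ∧ sigNeg (realForm Q σ) = 2)
    (hsig' : ∀ σ ∉ Sp, sigPos (realForm Q σ) = m + 2 ∧ sigNeg (realForm Q σ) = 0)
    (z₀ : SymmSpace Q Sp)
    (K : Subgroup (GAf Q)) (hKo : IsOpen (K : Set (GAf Q))) (hKc : IsCompact (K : Set (GAf Q)))
    (hKn : ∀ a : GAf Q, IsNeat (Gamma Q K a))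
    (n : ℕ) (hn : 1 ≤ n) (hnm : n ≤ m)
    (T : Matrix (Fin n) (Fin n) F) (hT : ∀ σ : F →+* ℝ, (T.map σ).PosDef)
    (x₀ : Fin n → V) (hx₀ : x₀ ∈ hyperboloid Q T)
    (φ : (Fin n → Af F ⊗[F] V) → ℂ) (hφ : IsLocallyConstant φ) (hφc : HasCompactSupport φ)
    (hφK : ∀ k ∈ K, ∀ x, φ (actA Q k x) = φ x)
    {J : Type*} (g : J → GAf Q) (hg : IsComponentReps Q K g)
    {I : Type*} (ξ : I → GAf Q) (hξ : IsOrbitReps Q K T φ x₀ ξ) :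
    LocFinite (wtTerm Q K z₀ T φ g) ∧
    (∀ r, LocFinite (componentCycle
      (natMap Q K Sp (Submodule.span F (Set.range x₀)) (ξ r)))) ∧
    LocFinite (fun r => natTerm Q K Sp φ x₀ (ξ r)) ∧
    wtCycle Q K z₀ T φ g = natWtCycle Q K Sp φ x₀ ξ := by
  have hQ := isShimuraForm_of_signature hm hdim hSp hsig hsig' z₀
  have hn' : n < Module.finrank F V := by omega
  have hlf : LocFinite (wtTerm Q K z₀ T φ g) := locFinite_wtTerm hQ hT hφc hφK hg
  have hφ0 (r : I) : φ (actA Q (ξ r)⁻¹ (toVAf x₀)) ≠ 0 := by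
    have h : actA Q (ξ r)⁻¹ (toVAf x₀) ∈ Function.support φ ∩
        hyperboloid (adelicForm Q) (T.map (algebraMap F (Af F))) := by
      rw [hξ.1]
      exact Set.mem_iUnion.mpr ⟨r, 1, K.one_mem, by rw [one_mul]⟩
    exact h.1
  -- The map `ψ` sends a component of the source for `ξ_r` to the corresponding pair of an index `j`
  -- and an orbit of `Γ_{g_j}`.
  choose ψ hψ using fun i : Σ r, ConnectedComponents
    (NatSource Q K Sp (Submodule.span F (Set.range x₀)) (ξ r)) => exists_compRel hQ z₀ hx₀ hg i.2
  have hinj : Function.Injective ψ := by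
    rintro ⟨r, C⟩ ⟨r', C'⟩ h
    have h1 := hψ ⟨r, C⟩
    have h2 := hψ ⟨r', C'⟩
    rw [← h] at h2
    obtain rfl : r = r' := by
      by_contra hne
      obtain ⟨k, hk, h3⟩ := h1.actA_eq
      obtain ⟨l, hl, h4⟩ := h2.actA_eq
      -- Equal images would put `ξ_r⁻¹ x₀` and `ξ_{r'}⁻¹ x₀` in one `K`-orbit.
      refine Set.disjoint_left.mp (hξ.2 hne) ⟨1, K.one_mem, by rw [one_mul]⟩
        ⟨k * l⁻¹, K.mul_mem hk (K.inv_mem hl), ?_⟩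
      rw [actA_mul, h4, h3, ← actA_mul, ← actA_mul, ← actA_mul]
      congr 1
      group
    exact congrArg (Sigma.mk r) (h1.component_unique hQ hKo h2)
  have hterm (i : Σ r, ConnectedComponents
      (NatSource Q K Sp (Submodule.span F (Set.range x₀)) (ξ r))) :
      wtTerm Q K z₀ T φ g (ψ i) =
        φ (actA Q (ξ i.1)⁻¹ (toVAf x₀)) • componentCycle (natMap Q K Sp _ (ξ i.1)) i.2 := by
    rw [wtTerm, componentCycle, genericDegree_natMap hQ hφc hKo hφK hT hx₀ hKn (hφ0 i.1),
      (hψ i).image_eq_connCycle hQ hKo, (hψ i).phi_eq hφK, Nat.cast_one, one_smul]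
  have hfin (Y : Set (ShimuraVar Q K Sp)) : {i | wtTerm Q K z₀ T φ g (ψ i) Y ≠ 0}.Finite :=
    (hlf Y).preimage hinj.injOn
  have hfin' (Y : Set (ShimuraVar Q K Sp)) :
      {i : Σ r, ConnectedComponents (NatSource Q K Sp (Submodule.span F (Set.range x₀)) (ξ r)) |
        componentCycle (natMap Q K Sp _ (ξ i.1)) i.2 Y ≠ 0}.Finite := by
    -- All weights `φ(ξ_r⁻¹ x₀)` are non-zero, so finiteness passes from the weighted terms to the
    -- components themselves.
    refine (hfin Y).subset fun i hi => ?_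
    change wtTerm Q K z₀ T φ g (ψ i) Y ≠ 0
    rw [hterm]
    exact mul_ne_zero (hφ0 i.1) hi
  have hsec (r : I) : LocFinite (componentCycle
      (natMap Q K Sp (Submodule.span F (Set.range x₀)) (ξ r))) := fun Y =>
    (hfin' Y).preimage (sigma_mk_injective (i := r)).injOn
  have hnat (r : I) (Y : Set (ShimuraVar Q K Sp)) : natTerm Q K Sp φ x₀ (ξ r) Y =
      ∑ᶠ C, wtTerm Q K z₀ T φ g (ψ ⟨r, C⟩) Y := by
    simp only [hterm]
    exact smul_finsum' (φ (actA Q (ξ r)⁻¹ (toVAf x₀))) (hsec r Y)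
  refine ⟨hlf, hsec, fun Y => ?_, funext fun Y => ?_⟩
  · refine ((hfin Y).image Sigma.fst).subset fun r hr => ?_
    change natTerm Q K Sp φ x₀ (ξ r) Y ≠ 0 at hr
    rw [hnat] at hr
    by_contra hne
    refine hr (finsum_eq_zero_of_forall_eq_zero fun C => ?_)
    by_contra hC
    exact hne ⟨⟨r, C⟩, hC, rfl⟩
  · change ∑ᶠ p, wtTerm Q K z₀ T φ g p Y = ∑ᶠ r, natTerm Q K Sp φ x₀ (ξ r) Y
    simp only [hnat]
    rw [← finsum_sigma_of_finite (f := fun i => wtTerm Q K z₀ T φ g (ψ i) Y) (hfin Y)]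
    -- Orbits outside the range of `ψ` have weight zero, so the double sum over `(r, C)` is the
    -- whole sum over `(j, x)`.
    refine finsum_eq_finsum_comp hinj fun p hp => ?_
    have hne : φ (actA Q (g p.1)⁻¹ (toVAf p.2.out.1)) ≠ 0 :=
      left_ne_zero_of_mul (show φ (actA Q (g p.1)⁻¹ (toVAf p.2.out.1)) * primeCycle
        (connCycle Q K z₀ (Submodule.span F (Set.range p.2.out.1)) (g p.1)) Y ≠ 0 from hp)
    obtain ⟨r, C, hC⟩ := exists_compRel_of_ne_zero hQ z₀ hT hn' hx₀ hξ p.2.out.2 hne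
    exact ⟨⟨r, C⟩, (hψ ⟨r, C⟩).unique hQ hKo hg hC⟩
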